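/- Let $N$ be a smooth time-oriented four-manifold with a smooth Lorentzian metric $\langle\cdot,\cdot\rangle$ of signature $(-,+,+,+)$ and Levi-Civita connection $\nabla^N$. Let $i:\Sigma\hookrightarrow N$ be a smooth embedding of a closed surface which is space-like, i.e. the induced metric $\sigma$ is Riemannian; write $\nabla$, $\Delta$, $dv_\Sigma$ for the gradient, Laplace operator and area measure of $\sigma$. Let $H=\operatorname{tr}_\sigma \mathrm{II}$, with $\mathrm{II}(X,Y)=(\nabla^N_XY)^\perp$, be the mean curvature vector, and let $\tau$ be a smooth function on $\Sigma$. For a smooth space-like unit normal field $e_3$ along $\Sigma$ let $e_4$ be the future-directed time-like unit normal orthogonal to $e_3$, and put \[\alpha_{e_3}(X)=\langle\nabla^N_Xe_3,e_4\rangle,\qquad h(\Sigma,i,\tau,e_3)=-\sqrt{1+|\nabla\tau|^2}\,\langle H,e_3\rangle-\alpha_{e_3}(\nabla\tau).\] Suppose that $H$ is space-like, i.e. $\langle H,H\rangle>0$ everywhere on $\Sigma$. Let $|H|=\sqrt{\langle H,H\rangle}$, $\hat e_3=-H/|H|$, let $\hat e_4$ be the future-directed time-like unit normal orthogonal to $\hat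 e_3$, let $\phi$ be the function with \[\sinh\phi=\frac{-\Delta\tau}{|H|\sqrt{1+|\nabla\tau|^2}},\] and put \[\mathfrak H(\Sigma,i,\tau)=\int_\Sigma\Big[\sqrt{(\Delta\tau)^2+|H|^2(1+|\nabla\tau|^2)}-\nabla\tau\cdot\nabla\phi-\alpha_{\hat e_3}(\nabla\tau)\Big]dv_\Sigma ,\] where the integrand is integrable. Then: (1) For every smooth space-like unit normal field $e_3$ with $\langle H,e_3\rangle<0$ on $\Sigma$, the function $h(\Sigma,i,\tau,e_3)$ is integrable and \[\int_\Sigma h(\Sigma,i,\tau,e_3)\,dv_\Sigma\ \ge\ \mathfrak H(\Sigma,i,\tau).\] (2) The minimum is attained: $\bar e_3=\cosh\phi\,\hat e_3-\sinh\phi\,\hat e_4$ is a smooth space-like unit normal field with $\langle H,\bar e_3\rangle<0$, the future-directed time-like unit normal $\bar e_4$ orthogonal to it satisfies $\langle H,\bar e_4\rangle=-\Delta\tau/\sqrt{1+|\nabla\tau|^2}$, and \[\int_\Sigma h(\Sigma,i,\tau,\bar e_3)\,dv_\Sigma=\mathfrak H(\Sigma,i,\tau).\] -/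

import Mathlib

open scoped Manifold ContDiff Topology

noncomputable section

namespace SpacetimeSurface

open MeasureTheory

/-- A field of continuous bilinear forms on the tangent spaces of an `n`-manifold `M`. -/
abbrev BilinField (n : ℕ) (M : Type*) [TopologicalSpace M]
    [ChartedSpace (EuclideanSpace ℝ (Fin n)) M] : Type _ :=
  ∀ x : M, TangentSpace (𝓡 n) x →L[ℝ] TangentSpace (𝓡 n) x →L[ℝ] ℝ

section ChartQuantities

variable {n : ℕ} {M : Type*} [TopologicalSpace M] [ChartedSpace (EuclideanSpace ℝ (Fin n)) M]

/-- The pull-back of a bilinear form `B` on a vector space `W` by a linear map `L : V → W`. -/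
def pullbackForm {V W : Type*} [AddCommGroup V] [Module ℝ V] [TopologicalSpace V]
    [IsTopologicalAddGroup V] [ContinuousSMul ℝ V]
    [AddCommGroup W] [Module ℝ W] [TopologicalSpace W]
    [IsTopologicalAddGroup W] [ContinuousSMul ℝ W]
    (B : W →L[ℝ] W →L[ℝ] ℝ) (L : V →L[ℝ] W) : V →L[ℝ] V →L[ℝ] ℝ :=
  (ContinuousLinearMap.precomp ℝ L).comp (B.comp L)

@[simp] lemma pullbackForm_apply {V W : Type*} [AddCommGroup V] [Module ℝ V] [TopologicalSpace V]
    [IsTopologicalAddGroup V] [ContinuousSMul ℝ V]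
    [AddCommGroup W] [Module ℝ W] [TopologicalSpace W]
    [IsTopologicalAddGroup W] [ContinuousSMul ℝ W]
    (B : W →L[ℝ] W →L[ℝ] ℝ) (L : V →L[ℝ] W) (v w : V) :
    pullbackForm B L v w = B (L v) (L w) := rfl

/-- The metric `g` in the chart around `c`: the bilinear form on `ℝⁿ` at the point `y` of the
coordinate domain with `(u, v) ↦ ∑ g_{jk}(y) u^j v^k`. -/
def chartMetric (g : BilinField n M) (c : M) (y : EuclideanSpace ℝ (Fin n)) :
    EuclideanSpace ℝ (Fin n) →L[ℝ] EuclideanSpace ℝ (Fin n) →L[ℝ] ℝ :=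
  pullbackForm (V := EuclideanSpace ℝ (Fin n)) (g ((extChartAt (𝓡 n) c).symm y))
    (mfderiv 𝓘(ℝ, EuclideanSpace ℝ (Fin n)) (𝓡 n) (extChartAt (𝓡 n) c).symm y)

/-- The Christoffel symbols `Γ(u, v) = (∑ Γ^l_{jk}(y) u^j v^k)_l` of the Levi-Civita connection
of `g` in the chart around `c`, that is the vector `Γ(u, v)` with
`g(Γ(u, v), z) = ½ (∂_u g (v, z) + ∂_v g (u, z) - ∂_z g (u, v))` for all `z`. -/
def christoffel (g : BilinField n M) (c : M) (y u v : EuclideanSpace ℝ (Fin n)) :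
    EuclideanSpace ℝ (Fin n) :=
  (chartMetric g c y).inverse
    ((1 / 2 : ℝ) • (fderiv ℝ (chartMetric g c) y u v + fderiv ℝ (chartMetric g c) y v u
      - ((fderiv ℝ (chartMetric g c) y).flip u).flip v))

/-- For a vector field `V` along a map `f : S → M`, the covariant derivative `∇_X V` at `p` in the
direction `X`, with respect to the Levi-Civita connection of the metric `g` of `M`:
in coordinates around `f p` it is `X(V^l) + Γ^l_{jk} (df X)^j V^k`. -/
def covDerivAlong {m : ℕ} {S : Type*} [TopologicalSpace S]
    [ChartedSpace (EuclideanSpace ℝ (Fin m)) S] (g : BilinField n M) (f : S → M)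
    (V : ∀ q : S, TangentSpace (𝓡 n) (f q)) (p : S) (X : TangentSpace (𝓡 m) p) :
    TangentSpace (𝓡 n) (f p) :=
  let φ := extChartAt (𝓡 n) (f p)
  let dφ : ∀ q : S, TangentSpace (𝓡 n) (f q) →L[ℝ] EuclideanSpace ℝ (Fin n) :=
    fun q => mfderiv (𝓡 n) 𝓘(ℝ, EuclideanSpace ℝ (Fin n)) φ (f q)
  let dV : EuclideanSpace ℝ (Fin n) :=
    mfderiv (𝓡 m) 𝓘(ℝ, EuclideanSpace ℝ (Fin n)) (fun q => dφ q (V q)) p X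
  (dφ p).inverse (dV + christoffel g (f p) (φ (f p))
    (dφ p (mfderiv (𝓡 m) (𝓡 n) f p X)) (dφ p (V p)))

/-- The gradient of a function: the vector `∇τ` with `σ(∇τ, X) = dτ(X)` for all `X`. -/
def grad (σ : BilinField n M) (τ : M → ℝ) (x : M) : TangentSpace (𝓡 n) x :=
  (σ x).inverse (mfderiv (𝓡 n) 𝓘(ℝ, ℝ) τ x : TangentSpace (𝓡 n) x →L[ℝ] ℝ)

/-- The volume density `√det(σ_{ab})` in the chart around `c`. -/
def chartDensity (σ : BilinField n M) (c : M) (y : EuclideanSpace ℝ (Fin n)) : ℝ :=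
  Real.sqrt (Matrix.of fun a b : Fin n => chartMetric σ c y
    (EuclideanSpace.basisFun (Fin n) ℝ a) (EuclideanSpace.basisFun (Fin n) ℝ b)).det

/-- The Laplace-Beltrami operator `Δτ = (√det σ)⁻¹ ∑ₐ ∂ₐ (√det σ · (∇τ)ᵃ)` at `x`, computed in the
chart around `x`. -/
def laplacian (σ : BilinField n M) (τ : M → ℝ) (x : M) : ℝ :=
  let ψ := extChartAt (𝓡 n) x
  let X : EuclideanSpace ℝ (Fin n) → EuclideanSpace ℝ (Fin n) := fun y =>
    mfderiv (𝓡 n) 𝓘(ℝ, EuclideanSpace ℝ (Fin n)) ψ (ψ.symm y) (grad σ τ (ψ.symm y))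
  (chartDensity σ x (ψ x))⁻¹ *
    LinearMap.trace ℝ (EuclideanSpace ℝ (Fin n))
      (fderiv ℝ (fun y => chartDensity σ x y • X y) (ψ x)).toLinearMap

/-- The Riemannian measure `dv_σ`. In the chart around `c` it is `√det(σ_{ab}) dy`; these measures
on the chart domains agree on overlaps, and their supremum is the measure on `M` that restricts to
each of them. -/
def volumeMeasure [MeasurableSpace M] (σ : BilinField n M) : Measure M :=
  ⨆ c : M, Measure.map (extChartAt (𝓡 n) c).symm
    ((volume.restrict (extChartAt (𝓡 n) c).target).withDensity
      fun y => ENNReal.ofReal (chartDensity σ c y))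

/-- The metric trace `∑ σ^{ab} B(b_a, b_b)` of a map `B` of two tangent vectors at `x`, in the
standard basis `b` of the tangent space. -/
def metricTrace {W : Type*} [AddCommGroup W] [Module ℝ W] (σ : BilinField n M) (x : M)
    (B : TangentSpace (𝓡 n) x → TangentSpace (𝓡 n) x → W) : W :=
  let b : Fin n → TangentSpace (𝓡 n) x := fun a => EuclideanSpace.basisFun (Fin n) ℝ a
  let G : Matrix (Fin n) (Fin n) ℝ := Matrix.of fun a c => σ x (b a) (b c)
  ∑ a, ∑ c, G⁻¹ a c • B (b a) (b c)

end ChartQuantities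

/-- A smooth Lorentzian metric, of signature `(-,+,+,+)`, on a four-manifold. -/
structure LorentzMetric (N : Type*) [TopologicalSpace N]
    [ChartedSpace (EuclideanSpace ℝ (Fin 4)) N] [IsManifold (𝓡 4) ∞ N] where
  inner : BilinField 4 N
  symm : ∀ (x : N) (v w : TangentSpace (𝓡 4) x), inner x v w = inner x w v
  signature : ∀ x : N, ∃ e : Module.Basis (Fin 4) ℝ (TangentSpace (𝓡 4) x),
    ∀ a b, inner x (e a) (e b) = Matrix.diagonal ![-1, 1, 1, 1] a b
  contMDiff : ContMDiff (𝓡 4) ((𝓡 4).prod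
      𝓘(ℝ, EuclideanSpace ℝ (Fin 4) →L[ℝ] EuclideanSpace ℝ (Fin 4) →L[ℝ] ℝ)) ∞
    (fun x => Bundle.TotalSpace.mk'
      (EuclideanSpace ℝ (Fin 4) →L[ℝ] EuclideanSpace ℝ (Fin 4) →L[ℝ] ℝ)
      (E := fun x : N => TangentSpace (𝓡 4) x →L[ℝ] TangentSpace (𝓡 4) x →L[ℝ] ℝ) x (inner x))

/-- A time orientation, given by a smooth time-like vector field, which points to the future. -/
structure TimeOrientation {N : Type*} [TopologicalSpace N]
    [ChartedSpace (EuclideanSpace ℝ (Fin 4)) N] [IsManifold (𝓡 4) ∞ N] (g : LorentzMetric N) where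
  field : ∀ x : N, TangentSpace (𝓡 4) x
  contMDiff : ContMDiff (𝓡 4) (𝓡 4).tangent ∞
    (fun x => (⟨x, field x⟩ : TangentBundle (𝓡 4) N))
  timelike : ∀ x, g.inner x (field x) (field x) < 0

section Surface

variable {N : Type*} [TopologicalSpace N] [ChartedSpace (EuclideanSpace ℝ (Fin 4)) N]
  [IsManifold (𝓡 4) ∞ N]
  {S : Type*} [TopologicalSpace S] [ChartedSpace (EuclideanSpace ℝ (Fin 2)) S]
  [IsManifold (𝓡 2) ∞ S]

/-- The metric `σ` induced on `S` by `i : S → N`. -/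
def inducedMetric (g : LorentzMetric N) (i : S → N) : BilinField 2 S :=
  fun p => pullbackForm (g.inner (i p)) (mfderiv (𝓡 2) (𝓡 4) i p)

/-- `i : S → N` is space-like: the induced metric is positive definite. -/
def IsSpacelike (g : LorentzMetric N) (i : S → N) : Prop :=
  ∀ (p : S) (X : TangentSpace (𝓡 2) p), X ≠ 0 → 0 < inducedMetric g i p X X

/-- `v` is normal to the surface at `p`. -/
def IsNormal (g : LorentzMetric N) (i : S → N) (p : S) (v : TangentSpace (𝓡 4) (i p)) : Prop :=
  ∀ X : TangentSpace (𝓡 2) p, g.inner (i p) v (mfderiv (𝓡 2) (𝓡 4) i p X) = 0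

/-- The projection `v^⊥ = v - di(w)` onto the normal space of the surface at `p`, where `w` is the
tangent vector with `σ(w, X) = ⟨v, di(X)⟩` for all `X`. -/
def normalPart (g : LorentzMetric N) (i : S → N) (p : S) (v : TangentSpace (𝓡 4) (i p)) :
    TangentSpace (𝓡 4) (i p) :=
  v - mfderiv (𝓡 2) (𝓡 4) i p ((inducedMetric g i p).inverse
    ((g.inner (i p) v).comp (mfderiv (𝓡 2) (𝓡 4) i p)))

/-- The second fundamental form `II(X, Y) = (∇^N_X Y)^⊥`. Here `Y` is extended around `p` to the
tangent vector field with constant coordinates in the trivialization at `p` (`II` is tensorial, so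
that every extension gives the same value). -/
def secondFundamentalForm (g : LorentzMetric N) (i : S → N) (p : S)
    (X Y : TangentSpace (𝓡 2) p) : TangentSpace (𝓡 4) (i p) :=
  normalPart g i p (covDerivAlong g.inner i
    (fun q => mfderiv (𝓡 2) (𝓡 4) i q
      (FiberBundle.extend (E := fun q : S => TangentSpace (𝓡 2) q)
        (EuclideanSpace ℝ (Fin 2)) Y q)) p X)

/-- The mean curvature vector `H = tr_σ II`. -/
def meanCurvature (g : LorentzMetric N) (i : S → N) (p : S) : TangentSpace (𝓡 4) (i p) :=
  metricTrace (inducedMetric g i) p (secondFundamentalForm g i p)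

/-- `|H| = √⟨H, H⟩` for a space-like mean curvature vector. -/
def meanCurvatureNorm (g : LorentzMetric N) (i : S → N) (p : S) : ℝ :=
  Real.sqrt (g.inner (i p) (meanCurvature g i p) (meanCurvature g i p))

/-- The mean curvature vector is space-like at every point of the surface. -/
def HasSpacelikeMeanCurvature (g : LorentzMetric N) (i : S → N) : Prop :=
  ∀ p, 0 < g.inner (i p) (meanCurvature g i p) (meanCurvature g i p)

/-- `e₃` is a smooth space-like unit normal vector field along the surface. -/
structure IsSpacelikeUnitNormal (g : LorentzMetric N) (i : S → N)
    (e₃ : ∀ p : S, TangentSpace (𝓡 4) (i p)) : Prop where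
  contMDiff : ContMDiff (𝓡 2) (𝓡 4).tangent ∞
    (fun p => (⟨i p, e₃ p⟩ : TangentBundle (𝓡 4) N))
  normal : ∀ p, IsNormal g i p (e₃ p)
  unit : ∀ p, g.inner (i p) (e₃ p) (e₃ p) = 1

/-- `e₄` is a future-directed time-like unit normal of the surface at `p`, orthogonal to `e₃`. -/
def IsFutureUnitNormal (g : LorentzMetric N) (T : TimeOrientation g) (i : S → N) (p : S)
    (e₃ e₄ : TangentSpace (𝓡 4) (i p)) : Prop :=
  IsNormal g i p e₄ ∧ g.inner (i p) e₃ e₄ = 0 ∧ g.inner (i p) e₄ e₄ = -1 ∧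
    g.inner (i p) e₄ (T.field (i p)) < 0

/-- The future-directed time-like unit normal `e₄` orthogonal to the space-like unit normal `e₃`
(it exists and is unique when the surface is space-like). -/
def futureUnitNormal (g : LorentzMetric N) (T : TimeOrientation g) (i : S → N)
    (e₃ : ∀ p : S, TangentSpace (𝓡 4) (i p)) (p : S) : TangentSpace (𝓡 4) (i p) :=
  Classical.epsilon fun e₄ => IsFutureUnitNormal g T i p (e₃ p) e₄

/-- The connection form `α_{e₃}(X) = ⟨∇^N_X e₃, e₄⟩`. -/
def connectionForm (g : LorentzMetric N) (T : TimeOrientation g) (i : S → N)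
    (e₃ : ∀ p : S, TangentSpace (𝓡 4) (i p)) (p : S) (X : TangentSpace (𝓡 2) p) : ℝ :=
  g.inner (i p) (covDerivAlong g.inner i e₃ p X) (futureUnitNormal g T i e₃ p)

/-- `∇τ` on the surface, for the induced metric. -/
def surfaceGrad (g : LorentzMetric N) (i : S → N) (τ : S → ℝ) (p : S) : TangentSpace (𝓡 2) p :=
  grad (inducedMetric g i) τ p

/-- `|∇τ|²` on the surface, for the induced metric. -/
def gradNormSq (g : LorentzMetric N) (i : S → N) (τ : S → ℝ) (p : S) : ℝ :=
  inducedMetric g i p (surfaceGrad g i τ p) (surfaceGrad g i τ p)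

/-- The generalized mean curvature
`h(Σ, i, τ, e₃) = -√(1 + |∇τ|²) ⟨H, e₃⟩ - α_{e₃}(∇τ)`. -/
def generalizedMeanCurvature (g : LorentzMetric N) (T : TimeOrientation g) (i : S → N) (τ : S → ℝ)
    (e₃ : ∀ p : S, TangentSpace (𝓡 4) (i p)) (p : S) : ℝ :=
  -Real.sqrt (1 + gradNormSq g i τ p) * g.inner (i p) (meanCurvature g i p) (e₃ p)
    - connectionForm g T i e₃ p (surfaceGrad g i τ p)

/-- The base frame vector `ê₃ = -H / |H|`. -/
def baseNormal (g : LorentzMetric N) (i : S → N) (p : S) : TangentSpace (𝓡 4) (i p) :=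
  -((meanCurvatureNorm g i p)⁻¹ • meanCurvature g i p)

/-- The function `φ` with `sinh φ = -Δτ / (|H| √(1 + |∇τ|²))`. -/
def gaugeAngle (g : LorentzMetric N) (i : S → N) (τ : S → ℝ) (p : S) : ℝ :=
  Real.arsinh (-laplacian (inducedMetric g i) τ p /
    (meanCurvatureNorm g i p * Real.sqrt (1 + gradNormSq g i τ p)))

/-- `ē₃ = cosh φ ê₃ - sinh φ ê₄` with `φ` the gauge angle. -/
def gaugeNormal (g : LorentzMetric N) (T : TimeOrientation g) (i : S → N) (τ : S → ℝ) (p : S) :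
    TangentSpace (𝓡 4) (i p) :=
  Real.cosh (gaugeAngle g i τ p) • baseNormal g i p
    - Real.sinh (gaugeAngle g i τ p) • futureUnitNormal g T i (baseNormal g i) p

/-- The integrand
`√((Δτ)² + |H|² (1 + |∇τ|²)) - ∇τ · ∇φ - α_{ê₃}(∇τ)` of `𝔥(Σ, i, τ)`. -/
def gaugeEnergyDensity (g : LorentzMetric N) (T : TimeOrientation g) (i : S → N) (τ : S → ℝ)
    (p : S) : ℝ :=
  Real.sqrt (laplacian (inducedMetric g i) τ p ^ 2
      + meanCurvatureNorm g i p ^ 2 * (1 + gradNormSq g i τ p))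
    - inducedMetric g i p (surfaceGrad g i τ p) (surfaceGrad g i (gaugeAngle g i τ) p)
    - connectionForm g T i (baseNormal g i) p (surfaceGrad g i τ p)

/-- `𝔥(Σ, i, τ)`. -/
def gaugeEnergy [MeasurableSpace S] (g : LorentzMetric N) (T : TimeOrientation g) (i : S → N)
    (τ : S → ℝ) : ℝ :=
  ∫ p, gaugeEnergyDensity g T i τ p ∂volumeMeasure (inducedMetric g i)

end Surface

end SpacetimeSurface

end

open SpacetimeSurface MeasureTheory

/-! The problem reduces to minimising over one function. The normal plane is Lorentzian, and the
condition `⟨H, e₃⟩ < 0` makes the `ê₃`-coefficient of `e₃` positive, so every admissible field is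
`cosh t ê₃ - sinh t ê₄` for a smooth `t` (`exists_boostedNormal_eq`). Such a boost multiplies `-⟨H,
ê₃⟩ = |H|` by `cosh t`. Since the derivatives of an orthonormal frame are skew, it changes `α` only
by adding `dt` (`connectionForm_boost`). With `W = |H| √(1 + |∇τ|²)` this gives `h(t) = W cosh t -
dt(∇τ) - α_{ê₃}(∇τ)` (`generalizedMeanCurvature_boostedNormal`). The angle `φ` satisfies `W sinh φ =
-Δτ`, hence `W cosh φ = √((Δτ)² + |H|² (1 + |∇τ|²))`. The integrand of `𝔥` is therefore pointwise
`h(φ)` (`gaugeEnergyDensity_eq`), which settles attainment.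

For the inequality put `u = t - φ`. Then `h(t) - h(φ) + u Δτ + du(∇τ) = W (cosh t - cosh φ - (t - φ)
sinh φ) ≥ 0`, because `cosh` is convex (`sub_mul_sinh_le_cosh_sub`). The added terms are the
divergence of `u ∇τ` and integrate to zero on a closed surface (`integral_mul_laplacian_add`).
Integration gives the bound (`gaugeEnergy_le`).

Most of the work lies in making the coordinate definitions usable. Covariant derivative, mean
curvature and Laplacian at a point are computed in the chart centred at that point, which changes
with the point, so their smoothness is visible only after comparison with one fixed chart:
`coord_covDerivAlong`, `meanCurvature_eq`, `chartDivergence_change`. Likewise the area measure is a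
supremum over charts and has to be identified on each chart domain (`volumeMeasure_apply`).
Compactness then gives integrability, and a partition of unity reduces the divergence theorem to
compactly supported fields on `ℝⁿ`. -/

noncomputable section

namespace SpacetimeSurface

set_option maxSynthPendingDepth 3
set_option linter.unusedSectionVars false

/-! ### Tangent coordinates and transition maps. -/

section Charts

variable {n : ℕ} {M : Type*} [TopologicalSpace M] [ChartedSpace (EuclideanSpace ℝ (Fin n)) M]

/-- The coordinates of tangent vectors at `q` in the chart around `c`. -/
def coord (c q : M) : TangentSpace (𝓡 n) q →L[ℝ] EuclideanSpace ℝ (Fin n) :=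
  mfderiv (𝓡 n) 𝓘(ℝ, EuclideanSpace ℝ (Fin n)) (extChartAt (𝓡 n) c) q

/-- The change of coordinates from the chart around `c` to the chart around `c'`. -/
def transition (c c' : M) : EuclideanSpace ℝ (Fin n) → EuclideanSpace ℝ (Fin n) :=
  extChartAt (𝓡 n) c' ∘ (extChartAt (𝓡 n) c).symm

lemma transition_chart {c c' q : M} (hq : q ∈ (extChartAt (𝓡 n) c).source) :
    transition c c' (extChartAt (𝓡 n) c q) = extChartAt (𝓡 n) c' q := by
  simp only [transition, Function.comp_apply, (extChartAt (𝓡 n) c).left_inv hq]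

variable [IsManifold (𝓡 n) ∞ M]

lemma coord_isInvertible {c q : M} (hq : q ∈ (extChartAt (𝓡 n) c).source) :
    (coord (n := n) c q).IsInvertible :=
  isInvertible_mfderiv_extChartAt hq

lemma coord_injective {c q : M} (hq : q ∈ (extChartAt (𝓡 n) c).source) :
    Function.Injective (coord (n := n) c q) := by
  obtain ⟨e, he⟩ := coord_isInvertible hq
  rw [← he]; exact e.injective

lemma coord_self (c : M) (v : TangentSpace (𝓡 n) c) : coord c c v = v := by
  have := mfderiv_extChartAt_self (I := 𝓡 n) (x := c)
  unfold coord
  rw [this]; rfl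

lemma mdifferentiableAt_chart {c q : M} (hq : q ∈ (extChartAt (𝓡 n) c).source) :
    MDifferentiableAt (𝓡 n) 𝓘(ℝ, EuclideanSpace ℝ (Fin n)) (extChartAt (𝓡 n) c) q :=
  mdifferentiableAt_extChartAt (by rwa [← extChartAt_source (𝓡 n)])

lemma contMDiffAt_chart {c q : M} (hq : q ∈ (extChartAt (𝓡 n) c).source) :
    ContMDiffAt (𝓡 n) 𝓘(ℝ, EuclideanSpace ℝ (Fin n)) ∞ (extChartAt (𝓡 n) c) q :=
  contMDiffAt_extChartAt' (by rwa [← extChartAt_source (𝓡 n)])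

lemma contMDiffAt_chart_symm {c : M} {y : EuclideanSpace ℝ (Fin n)}
    (hy : y ∈ (extChartAt (𝓡 n) c).target) :
    ContMDiffAt 𝓘(ℝ, EuclideanSpace ℝ (Fin n)) (𝓡 n) ∞ (extChartAt (𝓡 n) c).symm y :=
  (contMDiffOn_extChartAt_symm c).contMDiffAt ((isOpen_extChartAt_target c).mem_nhds hy)

lemma chart_symm_coord {c q : M} (hq : q ∈ (extChartAt (𝓡 n) c).source)
    (v : TangentSpace (𝓡 n) q) :
    mfderiv 𝓘(ℝ, EuclideanSpace ℝ (Fin n)) (𝓡 n) (extChartAt (𝓡 n) c).symm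
      (extChartAt (𝓡 n) c q) (coord c q v) = v := by
  have := mfderivWithin_extChartAt_symm_comp_mfderiv_extChartAt' (I := 𝓡 n) hq
  rw [ModelWithCorners.range_eq_univ, mfderivWithin_univ] at this
  exact DFunLike.congr_fun this v

lemma chartMetric_coord (g : BilinField n M) {c q : M} (hq : q ∈ (extChartAt (𝓡 n) c).source)
    (v w : TangentSpace (𝓡 n) q) :
    chartMetric g c (extChartAt (𝓡 n) c q) (coord c q v) (coord c q w) = g q v w := by
  have h1 := chart_symm_coord hq v
  have h2 := chart_symm_coord hq w
  have h3 := (extChartAt (𝓡 n) c).left_inv hq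
  change g ((extChartAt (𝓡 n) c).symm (extChartAt (𝓡 n) c q))
    (mfderiv 𝓘(ℝ, EuclideanSpace ℝ (Fin n)) (𝓡 n) (extChartAt (𝓡 n) c).symm
      (extChartAt (𝓡 n) c q) (coord c q v))
    (mfderiv 𝓘(ℝ, EuclideanSpace ℝ (Fin n)) (𝓡 n) (extChartAt (𝓡 n) c).symm
      (extChartAt (𝓡 n) c q) (coord c q w)) = g q v w
  -- The vectors live in the tangent space at `symm (chart q)`, which equals `q` only
  -- propositionally. Generalising the vectors and then the base point lets `subst` identify the two
  -- fibres.
  generalize mfderiv 𝓘(ℝ, EuclideanSpace ℝ (Fin n)) (𝓡 n) (extChartAt (𝓡 n) c).symm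
      (extChartAt (𝓡 n) c q) (coord c q v) = v' at h1 ⊢
  generalize mfderiv 𝓘(ℝ, EuclideanSpace ℝ (Fin n)) (𝓡 n) (extChartAt (𝓡 n) c).symm
      (extChartAt (𝓡 n) c q) (coord c q w) = w' at h2 ⊢
  generalize (extChartAt (𝓡 n) c).symm (extChartAt (𝓡 n) c q) = q' at *
  subst h3
  subst h1; subst h2; rfl

lemma contDiffAt_transition {c c' q : M} (hq : q ∈ (extChartAt (𝓡 n) c).source)
    (hq' : q ∈ (extChartAt (𝓡 n) c').source) :
    ContDiffAt ℝ ∞ (transition c c') (extChartAt (𝓡 n) c q) := by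
  rw [← contMDiffAt_iff_contDiffAt]
  refine ContMDiffAt.comp (I' := 𝓡 n) _ ?_
    (contMDiffAt_chart_symm ((extChartAt (𝓡 n) c).map_source hq))
  rw [(extChartAt (𝓡 n) c).left_inv hq]
  exact contMDiffAt_chart hq'

lemma coord_change {c c' q : M} (hq : q ∈ (extChartAt (𝓡 n) c).source)
    (hq' : q ∈ (extChartAt (𝓡 n) c').source) (v : TangentSpace (𝓡 n) q) :
    coord c' q v = fderiv ℝ (transition c c') (extChartAt (𝓡 n) c q) (coord c q v) := by
  have h : (extChartAt (𝓡 n) c' : M → EuclideanSpace ℝ (Fin n)) =ᶠ[𝓝 q]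
      transition c c' ∘ extChartAt (𝓡 n) c := by
    filter_upwards [extChartAt_source_mem_nhds' (I := 𝓡 n) hq] with z hz
    exact (transition_chart hz).symm
  have h1 : MDifferentiableAt 𝓘(ℝ, EuclideanSpace ℝ (Fin n)) 𝓘(ℝ, EuclideanSpace ℝ (Fin n))
      (transition c c') (extChartAt (𝓡 n) c q) :=
    ((contDiffAt_transition hq hq').differentiableAt (by simp)).mdifferentiableAt
  unfold coord
  rw [h.mfderiv_eq, mfderiv_comp q h1 (mdifferentiableAt_chart hq), mfderiv_eq_fderiv]
  rfl

lemma transition_deriv_isInvertible {c c' q : M} (hq : q ∈ (extChartAt (𝓡 n) c).source)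
    (hq' : q ∈ (extChartAt (𝓡 n) c').source) :
    (fderiv ℝ (transition c c') (extChartAt (𝓡 n) c q)).IsInvertible := by
  obtain ⟨e, he⟩ := coord_isInvertible hq
  obtain ⟨e', he'⟩ := coord_isInvertible hq'
  refine ⟨e.symm.trans e', ?_⟩
  ext1 u
  obtain ⟨v, rfl⟩ := e.surjective u
  have := coord_change hq hq' v
  rw [← he, ← he'] at this
  simpa using this

/-- A field of tangent vectors along a map is smooth if its coordinates in a chart are. -/
lemma contMDiffAt_along_iff {E' H' : Type*} [NormedAddCommGroup E'] [NormedSpace ℝ E']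
    [TopologicalSpace H'] {I' : ModelWithCorners ℝ E' H'} {S : Type*} [TopologicalSpace S]
    [ChartedSpace H' S] {f : S → M} {p : S} (hf : ContMDiffAt I' (𝓡 n) ∞ f p)
    {c : M} (hc : f p ∈ (extChartAt (𝓡 n) c).source) (V : ∀ q, TangentSpace (𝓡 n) (f q)) :
    ContMDiffAt I' (𝓡 n).tangent ∞ (fun q => (⟨f q, V q⟩ : TangentBundle (𝓡 n) M)) p ↔
      ContMDiffAt I' 𝓘(ℝ, EuclideanSpace ℝ (Fin n)) ∞ (fun q => coord c (f q) (V q)) p := by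
  have hc' : f p ∈ (chartAt (EuclideanSpace ℝ (Fin n)) c).source := by
    rwa [← extChartAt_source (𝓡 n)]
  rw [(trivializationAt (EuclideanSpace ℝ (Fin n)) (TangentSpace (𝓡 n)) c).contMDiffAt_iff
    (by rw [Bundle.Trivialization.mem_source]; simpa using hc')]
  simp only [hf, true_and]
  apply Filter.EventuallyEq.contMDiffAt_iff
  have : ∀ᶠ q in 𝓝 p, f q ∈ (chartAt (EuclideanSpace ℝ (Fin n)) c).source :=
    hf.continuousAt.eventually_mem ((chartAt _ c).open_source.mem_nhds hc')
  filter_upwards [this] with q hq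
  -- On the chart domain the fibre part of the tangent bundle trivialization at `c` is exactly
  -- `coord c`.
  have h := TangentBundle.continuousLinearMapAt_trivializationAt (I := 𝓡 n) hq
  have h2 := DFunLike.congr_fun h (V q)
  rw [Bundle.Trivialization.continuousLinearMapAt_apply,
    Bundle.Trivialization.coe_linearMapAt_of_mem _ (by simpa using hq)] at h2
  exact h2

end Charts

/-! ### Christoffel symbols of a metric on a vector space. -/

section Euclidean

/-- An injective linear map into the dual is bijective by dimension count. Gradients, Christoffel
symbols and normal projections are defined with `ContinuousLinearMap.inverse`, which is zero on maps
that are not invertible, so this is what gives them meaning. -/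
lemma isInvertible_of_nondegenerate {V : Type*} [AddCommGroup V] [Module ℝ V] [TopologicalSpace V]
    [IsTopologicalAddGroup V] [ContinuousSMul ℝ V] [T2Space V] [FiniteDimensional ℝ V]
    (B : V →L[ℝ] V →L[ℝ] ℝ) (h : ∀ v, (∀ w, B v w = 0) → v = 0) : B.IsInvertible := by
  have hinj : Function.Injective B.toLinearMap := by
    rw [← LinearMap.ker_eq_bot, LinearMap.ker_eq_bot']
    intro v hv
    exact h v fun w => by
      have : B v = 0 := hv
      rw [this]; rfl
  have hfin : Module.finrank ℝ V = Module.finrank ℝ (V →L[ℝ] ℝ) := by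
    rw [← (LinearMap.toContinuousLinearMap (𝕜 := ℝ) (E := V) (F' := ℝ)).finrank_eq]
    exact (Subspace.dual_finrank_eq (K := ℝ) (V := V)).symm
  have : FiniteDimensional ℝ (V →L[ℝ] ℝ) :=
    (LinearMap.toContinuousLinearMap (𝕜 := ℝ) (E := V) (F' := ℝ)).finiteDimensional
  let e : V ≃ₗ[ℝ] (V →L[ℝ] ℝ) := LinearEquiv.ofInjectiveOfFinrankEq B.toLinearMap hinj hfin
  have he : ∀ v, e v = B v := fun v => rfl
  have hc : Continuous e.symm := by
    have : T2Space (V →L[ℝ] ℝ) := inferInstance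
    exact LinearMap.continuous_of_finiteDimensional e.symm.toLinearMap
  exact ⟨⟨e, B.continuous, hc⟩, by ext v; rfl⟩

variable {E : Type*} [NormedAddCommGroup E] [NormedSpace ℝ E]

/-- The Christoffel symbols of a metric `G` on a vector space. -/
def flatChristoffel (G : E → E →L[ℝ] E →L[ℝ] ℝ) (y u v : E) : E :=
  (G y).inverse ((1 / 2 : ℝ) • (fderiv ℝ G y u v + fderiv ℝ G y v u
    - ((fderiv ℝ G y).flip u).flip v))

lemma apply_inverse_of_isInvertible {V W : Type*} [AddCommGroup V] [Module ℝ V]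
    [TopologicalSpace V] [AddCommGroup W] [Module ℝ W] [TopologicalSpace W]
    {B : V →L[ℝ] W} (h : B.IsInvertible) (w : W) : B (B.inverse w) = w := by
  obtain ⟨e, rfl⟩ := h
  simp

lemma inverse_apply_of_isInvertible {V W : Type*} [AddCommGroup V] [Module ℝ V]
    [TopologicalSpace V] [AddCommGroup W] [Module ℝ W] [TopologicalSpace W]
    {B : V →L[ℝ] W} (h : B.IsInvertible) (v : V) : B.inverse (B v) = v := by
  obtain ⟨e, rfl⟩ := h
  simp

lemma flatChristoffel_spec {G : E → E →L[ℝ] E →L[ℝ] ℝ} {y : E} (hG : (G y).IsInvertible)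
    (u v w : E) : G y (flatChristoffel G y u v) w =
      1 / 2 * (fderiv ℝ G y u v w + fderiv ℝ G y v u w - fderiv ℝ G y w u v) := by
  rw [flatChristoffel, apply_inverse_of_isInvertible hG]
  simp

lemma fderiv_apply_apply {G : E → E →L[ℝ] E →L[ℝ] ℝ} {y : E} (hG : DifferentiableAt ℝ G y)
    (u v w : E) : fderiv ℝ (fun z => G z u v) y w = fderiv ℝ G y w u v := by
  have h1 := (hG.hasFDerivAt.clm_apply (hasFDerivAt_const u y)).clm_apply (hasFDerivAt_const v y)
  rw [h1.fderiv]
  simp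

lemma fderiv_symm_of_symm {G : E → E →L[ℝ] E →L[ℝ] ℝ} {y : E} (hG : DifferentiableAt ℝ G y)
    (hs : ∀ᶠ z in 𝓝 y, ∀ u v, G z u v = G z v u) (u v w : E) :
    fderiv ℝ G y w u v = fderiv ℝ G y w v u := by
  rw [← fderiv_apply_apply hG, ← fderiv_apply_apply hG]
  have : (fun z => G z u v) =ᶠ[𝓝 y] fun z => G z v u := hs.mono fun z hz => hz u v
  rw [this.fderiv_eq]

/-- In the sum of the two Koszul expressions the derivatives of `G` in the directions `u` and `v`
cancel by symmetry of `G`, and the two halves of the derivative along `w` add up. -/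
lemma flatChristoffel_compatible {G : E → E →L[ℝ] E →L[ℝ] ℝ} {y : E}
    (hG : DifferentiableAt ℝ G y) (hi : (G y).IsInvertible)
    (hs : ∀ᶠ z in 𝓝 y, ∀ u v, G z u v = G z v u) (u v w : E) :
    fderiv ℝ G y w u v = G y (flatChristoffel G y w u) v + G y u (flatChristoffel G y w v) := by
  rw [hs.self_of_nhds u, flatChristoffel_spec hi, flatChristoffel_spec hi,
    fderiv_symm_of_symm hG hs w v u, fderiv_symm_of_symm hG hs w u v,
    fderiv_symm_of_symm hG hs u v w]
  ring

/-- Differentiating the pulled-back metric produces, besides the derivative of `G'`, two terms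
containing the Hessian of `Φ`. In the alternating Koszul sum four of the six Hessian terms cancel
because the Hessian is symmetric; the other two leave the inhomogeneous term `D²Φ(u, v)`. -/
lemma flatChristoffel_change {G G' : E → E →L[ℝ] E →L[ℝ] ℝ} {Φ : E → E} {y : E}
    (hΦ : ContDiffAt ℝ ∞ Φ y) (hΦi : (fderiv ℝ Φ y).IsInvertible)
    (hG : DifferentiableAt ℝ G y) (hi : (G y).IsInvertible)
    (hG' : DifferentiableAt ℝ G' (Φ y)) (hi' : (G' (Φ y)).IsInvertible)
    (hs' : ∀ u v, G' (Φ y) u v = G' (Φ y) v u)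
    (h : ∀ᶠ z in 𝓝 y, ∀ u v, G z u v = G' (Φ z) (fderiv ℝ Φ z u) (fderiv ℝ Φ z v)) (u v : E) :
    fderiv ℝ Φ y (flatChristoffel G y u v) =
      flatChristoffel G' (Φ y) (fderiv ℝ Φ y u) (fderiv ℝ Φ y v)
        + fderiv ℝ (fderiv ℝ Φ) y u v := by
  have hD : DifferentiableAt ℝ (fderiv ℝ Φ) y :=
    (hΦ.fderiv_right (m := ∞) (by simp)).differentiableAt (by simp)
  have hsym : ∀ a b, fderiv ℝ (fderiv ℝ Φ) y a b = fderiv ℝ (fderiv ℝ Φ) y b a := fun a b =>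
    (hΦ.isSymmSndFDerivAt (by simpa using ENat.LEInfty.out)) a b
  have key : ∀ a b w, fderiv ℝ G y w a b =
      fderiv ℝ G' (Φ y) (fderiv ℝ Φ y w) (fderiv ℝ Φ y a) (fderiv ℝ Φ y b)
      + G' (Φ y) (fderiv ℝ (fderiv ℝ Φ) y w a) (fderiv ℝ Φ y b)
      + G' (Φ y) (fderiv ℝ Φ y a) (fderiv ℝ (fderiv ℝ Φ) y w b) := by
    intro a b w
    rw [← fderiv_apply_apply hG]
    have : (fun z => G z a b) =ᶠ[𝓝 y]
        fun z => G' (Φ z) (fderiv ℝ Φ z a) (fderiv ℝ Φ z b) := h.mono fun z hz => hz a b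
    rw [this.fderiv_eq]
    have h1 := HasFDerivAt.comp (g := G') (f := Φ) y hG'.hasFDerivAt (hΦ.differentiableAt (by simp)).hasFDerivAt
    have h2 := (h1.clm_apply (hD.hasFDerivAt.clm_apply (hasFDerivAt_const a y))).clm_apply
      (hD.hasFDerivAt.clm_apply (hasFDerivAt_const b y))
    refine (DFunLike.congr_fun h2.fderiv w).trans ?_
    simp
    ring
  -- The identity is tested by pairing with vectors `DΦ w`; these are all vectors, since `DΦ` is
  -- invertible.
  apply (show Function.Injective (G' (Φ y)) by obtain ⟨e, he⟩ := hi'; rw [← he]; exact e.injective)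
  ext w'
  obtain ⟨w, rfl⟩ : ∃ w, fderiv ℝ Φ y w = w' := by
    obtain ⟨e, he⟩ := hΦi
    exact ⟨e.symm w', by rw [← he]; simp⟩
  rw [← h.self_of_nhds, map_add, add_apply, flatChristoffel_spec hi,
    flatChristoffel_spec hi', key, key, key, hsym v u, hsym w u, hsym w v,
    hs' (fderiv ℝ Φ y u) (fderiv ℝ (fderiv ℝ Φ) y v w),
    hs' (fderiv ℝ Φ y v) (fderiv ℝ (fderiv ℝ Φ) y u w)]
  ring

/-- Inversion is smooth at invertible operators. Smoothness is taken jointly in the point and both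
vectors so that fields along a map can be substituted. -/
lemma contDiffAt_flatChristoffel [CompleteSpace E] {G : E → E →L[ℝ] E →L[ℝ] ℝ} {y : E}
    (hG : ContDiffAt ℝ ∞ G y) (hi : (G y).IsInvertible) (u v : E) :
    ContDiffAt ℝ ∞ (fun z : E × E × E => flatChristoffel G z.1 z.2.1 z.2.2) (y, u, v) := by
  have h1 : ContDiffAt ℝ ∞ (fun z : E × E × E => fderiv ℝ G z.1) (y, u, v) :=
    ContDiffAt.comp (g := fderiv ℝ G) (f := Prod.fst) (y, u, v)
      (hG.fderiv_right (m := ∞) (by simp)) contDiffAt_fst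
  have hu : ContDiffAt ℝ ∞ (fun z : E × E × E => z.2.1) (y, u, v) :=
    contDiffAt_snd.fst
  have hv : ContDiffAt ℝ ∞ (fun z : E × E × E => z.2.2) (y, u, v) :=
    contDiffAt_snd.snd
  have hfl : ContDiffAt ℝ ∞ (fun z : E × E × E => (fderiv ℝ G z.1).flip) (y, u, v) :=
    (ContinuousLinearMap.flipₗᵢ ℝ E E (E →L[ℝ] ℝ)).contDiff.contDiffAt.comp _ h1
  have hfl2 : ContDiffAt ℝ ∞ (fun z : E × E × E => ((fderiv ℝ G z.1).flip z.2.1).flip) (y, u, v) :=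
    (ContinuousLinearMap.flipₗᵢ ℝ E E ℝ).contDiff.contDiffAt.comp _ (hfl.clm_apply hu)
  have hinv : ContDiffAt ℝ ∞ (fun z : E × E × E => (G z.1).inverse) (y, u, v) :=
    ContDiffAt.comp (g := fun z => (G z).inverse) (f := Prod.fst) (y, u, v)
      (hi.contDiffAt_map_inverse.comp y hG) contDiffAt_fst
  exact hinv.clm_apply ((((h1.clm_apply hu).clm_apply hv).add ((h1.clm_apply hv).clm_apply hu)
    |>.sub (hfl2.clm_apply hv)).const_smul _)

end Euclidean

/-! ### Smooth metrics and the transformation law of their Christoffel symbols. -/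

section Metric

variable {n : ℕ} {M : Type*} [TopologicalSpace M] [ChartedSpace (EuclideanSpace ℝ (Fin n)) M]

instance (x : M) : FiniteDimensional ℝ (TangentSpace (𝓡 n) x) :=
  inferInstanceAs (FiniteDimensional ℝ (EuclideanSpace ℝ (Fin n)))

instance (x : M) : T2Space (TangentSpace (𝓡 n) x) :=
  inferInstanceAs (T2Space (EuclideanSpace ℝ (Fin n)))

/-- A smooth pseudo-Riemannian metric. -/
structure IsSmoothMetric (g : BilinField n M) : Prop where
  symm : ∀ (x : M) (v w : TangentSpace (𝓡 n) x), g x v w = g x w v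
  nondegenerate : ∀ (x : M) (v : TangentSpace (𝓡 n) x), (∀ w, g x v w = 0) → v = 0
  contDiffOn : ∀ c : M, ContDiffOn ℝ ∞ (chartMetric g c) (extChartAt (𝓡 n) c).target

variable [IsManifold (𝓡 n) ∞ M] {g : BilinField n M}

lemma chartMetric_symm (hg : IsSmoothMetric g) (c : M) (y u v : EuclideanSpace ℝ (Fin n)) :
    chartMetric g c y u v = chartMetric g c y v u :=
  hg.symm _ _ _

lemma IsSmoothMetric.isInvertible (hg : IsSmoothMetric g) (x : M) : (g x).IsInvertible :=
  isInvertible_of_nondegenerate _ (hg.nondegenerate x)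

lemma exists_coord_eq {c q : M} (hq : q ∈ (extChartAt (𝓡 n) c).source)
    (u : EuclideanSpace ℝ (Fin n)) : ∃ v, coord c q v = u :=
  ⟨_, apply_inverse_of_isInvertible (coord_isInvertible hq) u⟩

lemma chartMetric_isInvertible (hg : IsSmoothMetric g) {c q : M}
    (hq : q ∈ (extChartAt (𝓡 n) c).source) :
    (chartMetric g c (extChartAt (𝓡 n) c q)).IsInvertible := by
  refine isInvertible_of_nondegenerate _ fun u hu => ?_
  obtain ⟨v, rfl⟩ := exists_coord_eq hq u
  rw [hg.nondegenerate q v fun w => by rw [← chartMetric_coord g hq]; exact hu _, map_zero]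

lemma contDiffAt_chartMetric (hg : IsSmoothMetric g) {c q : M}
    (hq : q ∈ (extChartAt (𝓡 n) c).source) :
    ContDiffAt ℝ ∞ (chartMetric g c) (extChartAt (𝓡 n) c q) :=
  (hg.contDiffOn c).contDiffAt
    ((isOpen_extChartAt_target c).mem_nhds ((extChartAt (𝓡 n) c).map_source hq))

/-- Identities known at points of a chart overlap become identities on a neighbourhood in `ℝⁿ`,
where they can be differentiated. -/
lemma eventually_overlap {c c' q : M} (hq : q ∈ (extChartAt (𝓡 n) c).source)
    (hq' : q ∈ (extChartAt (𝓡 n) c').source) :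
    ∀ᶠ z in 𝓝 (extChartAt (𝓡 n) c q), ∃ q' : M, q' ∈ (extChartAt (𝓡 n) c).source ∧
      q' ∈ (extChartAt (𝓡 n) c').source ∧ extChartAt (𝓡 n) c q' = z := by
  have hc : ContinuousAt (extChartAt (𝓡 n) c).symm (extChartAt (𝓡 n) c q) :=
    continuousAt_extChartAt_symm' hq
  have h1 : ∀ᶠ z in 𝓝 (extChartAt (𝓡 n) c q),
      (extChartAt (𝓡 n) c).symm z ∈ (extChartAt (𝓡 n) c').source := by
    apply hc.eventually_mem
    rw [(extChartAt (𝓡 n) c).left_inv hq]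
    exact extChartAt_source_mem_nhds' hq'
  filter_upwards [h1, (isOpen_extChartAt_target c).mem_nhds
    ((extChartAt (𝓡 n) c).map_source hq)] with z hz hz'
  exact ⟨_, (extChartAt (𝓡 n) c).map_target hz', hz, (extChartAt (𝓡 n) c).right_inv hz'⟩

lemma chartMetric_change (g : BilinField n M) {c c' q : M}
    (hq : q ∈ (extChartAt (𝓡 n) c).source) (hq' : q ∈ (extChartAt (𝓡 n) c').source)
    (u v : EuclideanSpace ℝ (Fin n)) :
    chartMetric g c (extChartAt (𝓡 n) c q) u v =
      chartMetric g c' (transition c c' (extChartAt (𝓡 n) c q))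
        (fderiv ℝ (transition c c') (extChartAt (𝓡 n) c q) u)
        (fderiv ℝ (transition c c') (extChartAt (𝓡 n) c q) v) := by
  obtain ⟨u, rfl⟩ := exists_coord_eq hq u
  obtain ⟨v, rfl⟩ := exists_coord_eq hq v
  rw [chartMetric_coord g hq, ← coord_change hq hq', ← coord_change hq hq', transition_chart hq,
    chartMetric_coord g hq']

lemma christoffel_change (hg : IsSmoothMetric g) {c c' q : M}
    (hq : q ∈ (extChartAt (𝓡 n) c).source) (hq' : q ∈ (extChartAt (𝓡 n) c').source)
    (u v : EuclideanSpace ℝ (Fin n)) :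
    fderiv ℝ (transition c c') (extChartAt (𝓡 n) c q)
        (christoffel g c (extChartAt (𝓡 n) c q) u v) =
      christoffel g c' (extChartAt (𝓡 n) c' q)
        (fderiv ℝ (transition c c') (extChartAt (𝓡 n) c q) u)
        (fderiv ℝ (transition c c') (extChartAt (𝓡 n) c q) v)
      + fderiv ℝ (fderiv ℝ (transition c c')) (extChartAt (𝓡 n) c q) u v := by
  have h := transition_chart (n := n) (c' := c') hq
  rw [← h]
  refine flatChristoffel_change (contDiffAt_transition hq hq')
    (transition_deriv_isInvertible hq hq')
    ((contDiffAt_chartMetric hg hq).differentiableAt (by simp)) (chartMetric_isInvertible hg hq)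
    ?_ ?_ ?_ ?_ u v
  · rw [h]
    exact (contDiffAt_chartMetric hg hq').differentiableAt (by simp)
  · rw [h]
    exact chartMetric_isInvertible hg hq'
  · exact fun _ _ => chartMetric_symm hg _ _ _ _
  · filter_upwards [eventually_overlap hq hq'] with z ⟨q', h1, h2, h3⟩ u v
    rw [← h3]
    exact chartMetric_change g h1 h2 u v

end Metric

/-! ### Independence of the covariant derivative from the chart. -/

section CovariantDerivative

variable {m n : ℕ} {M : Type*} [TopologicalSpace M] [ChartedSpace (EuclideanSpace ℝ (Fin n)) M]
  [IsManifold (𝓡 n) ∞ M] {g : BilinField n M}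
  {S : Type*} [TopologicalSpace S] [ChartedSpace (EuclideanSpace ℝ (Fin m)) S]
  {f : S → M} {p : S}

variable (m) in
/-- The vector field `V` along `f` is smooth at `p`. -/
def SmoothAlongAt (f : S → M) (V : ∀ q, TangentSpace (𝓡 n) (f q)) (p : S) : Prop :=
  ContMDiffAt (𝓡 m) (𝓡 n).tangent ∞ (fun q => (⟨f q, V q⟩ : TangentBundle (𝓡 n) M)) p

lemma smoothAlongAt_iff (hf : ContMDiffAt (𝓡 m) (𝓡 n) ∞ f p) {c : M}
    (hc : f p ∈ (extChartAt (𝓡 n) c).source) (V : ∀ q, TangentSpace (𝓡 n) (f q)) :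
    SmoothAlongAt m f V p ↔ ContMDiffAt (𝓡 m) 𝓘(ℝ, EuclideanSpace ℝ (Fin n)) ∞
      (fun q => coord c (f q) (V q)) p :=
  contMDiffAt_along_iff hf hc V

/-- The derivative at `p` of the coordinates of a vector field along `f`. -/
def coordDeriv (c : M) (f : S → M) (V : ∀ q, TangentSpace (𝓡 n) (f q)) (p : S)
    (X : TangentSpace (𝓡 m) p) : EuclideanSpace ℝ (Fin n) :=
  mfderiv (𝓡 m) 𝓘(ℝ, EuclideanSpace ℝ (Fin n)) (fun q => coord c (f q) (V q)) p X

lemma covDerivAlong_eq (g : BilinField n M) (f : S → M) (V : ∀ q, TangentSpace (𝓡 n) (f q)) (p : S)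
    (X : TangentSpace (𝓡 m) p) :
    coord (f p) (f p) (covDerivAlong g f V p X) = coordDeriv (f p) f V p X +
      christoffel g (f p) (extChartAt (𝓡 n) (f p) (f p))
        (coord (f p) (f p) (mfderiv (𝓡 m) (𝓡 n) f p X)) (coord (f p) (f p) (V p)) :=
  apply_inverse_of_isInvertible (coord_isInvertible (mem_extChartAt_source _)) _

/-- The new coordinates of `V` are `DΦ` at the moving base point applied to the old ones, so the
product rule adds a Hessian term. -/
lemma coordDeriv_change (hf : ContMDiffAt (𝓡 m) (𝓡 n) ∞ f p) {c c' : M}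
    (hc : f p ∈ (extChartAt (𝓡 n) c).source) (hc' : f p ∈ (extChartAt (𝓡 n) c').source)
    {V : ∀ q, TangentSpace (𝓡 n) (f q)} (hV : SmoothAlongAt m f V p) (X : TangentSpace (𝓡 m) p) :
    coordDeriv c' f V p X =
      fderiv ℝ (transition c c') (extChartAt (𝓡 n) c (f p)) (coordDeriv c f V p X) +
      fderiv ℝ (fderiv ℝ (transition c c')) (extChartAt (𝓡 n) c (f p))
        (coord c (f p) (mfderiv (𝓡 m) (𝓡 n) f p X)) (coord c (f p) (V p)) := by
  set Φ : EuclideanSpace ℝ (Fin n) → EuclideanSpace ℝ (Fin n) := transition c c' with hΦ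
  have hW : MDifferentiableAt (𝓡 m) 𝓘(ℝ, EuclideanSpace ℝ (Fin n))
      (fun q => coord c (f q) (V q)) p :=
    ((smoothAlongAt_iff hf hc V).1 hV).mdifferentiableAt (by simp)
  have hy : MDifferentiableAt (𝓡 m) 𝓘(ℝ, EuclideanSpace ℝ (Fin n))
      (extChartAt (𝓡 n) c ∘ f) p :=
    (mdifferentiableAt_chart hc).comp p (hf.mdifferentiableAt (by simp))
  have hev : (fun q => coord c' (f q) (V q)) =ᶠ[𝓝 p]
      (fun z : EuclideanSpace ℝ (Fin n) × EuclideanSpace ℝ (Fin n) => fderiv ℝ Φ z.1 z.2) ∘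
        fun q => ((extChartAt (𝓡 n) c ∘ f) q, coord c (f q) (V q)) := by
    filter_upwards [hf.continuousAt.eventually_mem (extChartAt_source_mem_nhds' (I := 𝓡 n) hc),
      hf.continuousAt.eventually_mem (extChartAt_source_mem_nhds' (I := 𝓡 n) hc')] with q h1 h2
    exact coord_change h1 h2 (V q)
  have hD : DifferentiableAt ℝ (fderiv ℝ Φ) (extChartAt (𝓡 n) c (f p)) :=
    ((contDiffAt_transition hc hc').fderiv_right (m := ∞) (by simp)).differentiableAt (by simp)
  have hB : HasFDerivAt
      (fun z : EuclideanSpace ℝ (Fin n) × EuclideanSpace ℝ (Fin n) => fderiv ℝ Φ z.1 z.2) _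
      ((extChartAt (𝓡 n) c ∘ f) p, coord c (f p) (V p)) :=
    (HasFDerivAt.comp (g := fderiv ℝ Φ) (f := Prod.fst)
      ((extChartAt (𝓡 n) c ∘ f) p, coord c (f p) (V p)) hD.hasFDerivAt hasFDerivAt_fst).clm_apply
      hasFDerivAt_snd
  unfold coordDeriv
  have hcomp := HasMFDerivAt.comp p hB.hasMFDerivAt (hy.hasMFDerivAt.prodMk hW.hasMFDerivAt)
  rw [hev.mfderiv_eq, hcomp.mfderiv]
  have h1 := DFunLike.congr_fun
    (mfderiv_comp p (mdifferentiableAt_chart hc) (hf.mdifferentiableAt (by simp))) X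
  change fderiv ℝ Φ (extChartAt (𝓡 n) c (f p)) (mfderiv (𝓡 m) 𝓘(ℝ, EuclideanSpace ℝ (Fin n))
      (fun q => coord c (f q) (V q)) p X) + fderiv ℝ (fderiv ℝ Φ) (extChartAt (𝓡 n) c (f p))
      (mfderiv (𝓡 m) 𝓘(ℝ, EuclideanSpace ℝ (Fin n)) (extChartAt (𝓡 n) c ∘ f) p X)
      (coord c (f p) (V p)) = _
  rw [h1]
  rfl

/-- The Hessian term in `coordDeriv_change` is the same as the one in `christoffel_change`. The
chart `c` is now independent of `p`, as is needed to differentiate the result in `p`. -/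
lemma coord_covDerivAlong (hg : IsSmoothMetric g) (hf : ContMDiffAt (𝓡 m) (𝓡 n) ∞ f p) {c : M}
    (hc : f p ∈ (extChartAt (𝓡 n) c).source)
    {V : ∀ q, TangentSpace (𝓡 n) (f q)} (hV : SmoothAlongAt m f V p) (X : TangentSpace (𝓡 m) p) :
    coord c (f p) (covDerivAlong g f V p X) = coordDeriv c f V p X +
      christoffel g c (extChartAt (𝓡 n) c (f p))
        (coord c (f p) (mfderiv (𝓡 m) (𝓡 n) f p X)) (coord c (f p) (V p)) := by
  have h0 := mem_extChartAt_source (I := 𝓡 n) (f p)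
  rw [coord_change h0 hc, covDerivAlong_eq, map_add, christoffel_change hg h0 hc,
    coordDeriv_change hf h0 hc hV, ← coord_change h0 hc, ← coord_change h0 hc]
  abel

end CovariantDerivative

/-! ### Smoothness of fields along a map. -/

section SmoothFields

variable {m n : ℕ} {M : Type*} [TopologicalSpace M] [ChartedSpace (EuclideanSpace ℝ (Fin n)) M]
  [IsManifold (𝓡 n) ∞ M] {g : BilinField n M}
  {S : Type*} [TopologicalSpace S] [ChartedSpace (EuclideanSpace ℝ (Fin m)) S]
  [IsManifold (𝓡 m) ∞ S] {f : S → M} {p : S}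
  {F : Type*} [NormedAddCommGroup F] [NormedSpace ℝ F]

lemma contMDiffAt_zip {F' : Type*} [NormedAddCommGroup F'] [NormedSpace ℝ F']
    {F'' : Type*} [NormedAddCommGroup F''] [NormedSpace ℝ F'']
    {B : F × F' → F''} {a : S → F} {b : S → F'} (hB : ContDiffAt ℝ ∞ B (a p, b p))
    (ha : ContMDiffAt (𝓡 m) 𝓘(ℝ, F) ∞ a p) (hb : ContMDiffAt (𝓡 m) 𝓘(ℝ, F') ∞ b p) :
    ContMDiffAt (𝓡 m) 𝓘(ℝ, F'') ∞ (fun q => B (a q, b q)) p :=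
  ContDiffAt.comp_contMDiffAt (g := B) (f := fun q => (a q, b q)) hB (ha.prodMk_space hb)

variable (m) in
/-- The vector field `X` on `S` is smooth at `p`. -/
abbrev SmoothFieldAt (X : ∀ q : S, TangentSpace (𝓡 m) q) (p : S) : Prop :=
  ContMDiffAt (𝓡 m) (𝓡 m).tangent ∞ (fun q => (⟨q, X q⟩ : TangentBundle (𝓡 m) S)) p

lemma smoothFieldAt_iff {c : S} (hc : p ∈ (extChartAt (𝓡 m) c).source)
    (X : ∀ q : S, TangentSpace (𝓡 m) q) : SmoothFieldAt m X p ↔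
      ContMDiffAt (𝓡 m) 𝓘(ℝ, EuclideanSpace ℝ (Fin m)) ∞ (fun q => coord c q (X q)) p :=
  contMDiffAt_along_iff (f := id) contMDiffAt_id hc X

/-- The vector field with constant coordinates `u` in the chart around `c`. -/
def frame (c : S) (u : EuclideanSpace ℝ (Fin m)) (q : S) : TangentSpace (𝓡 m) q :=
  (coord c q).inverse u

lemma coord_frame {c q : S} (hq : q ∈ (extChartAt (𝓡 m) c).source)
    (u : EuclideanSpace ℝ (Fin m)) : coord c q (frame c u q) = u :=
  apply_inverse_of_isInvertible (coord_isInvertible hq) u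

lemma frame_coord {c q : S} (hq : q ∈ (extChartAt (𝓡 m) c).source)
    (X : TangentSpace (𝓡 m) q) : frame c (coord c q X) q = X :=
  inverse_apply_of_isInvertible (coord_isInvertible hq) X

lemma smoothFieldAt_frame {c : S} (hp : p ∈ (extChartAt (𝓡 m) c).source)
    (u : EuclideanSpace ℝ (Fin m)) : SmoothFieldAt m (frame c u) p := by
  rw [smoothFieldAt_iff hp]
  refine (contMDiffAt_const (c := u)).congr_of_eventuallyEq ?_
  filter_upwards [extChartAt_source_mem_nhds' (I := 𝓡 m) hp] with q hq
  exact coord_frame hq u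

lemma contMDiffAt_comp_chart_symm {N : Type*} [TopologicalSpace N] {H' E' : Type*}
    [TopologicalSpace H'] [NormedAddCommGroup E'] [NormedSpace ℝ E'] {I' : ModelWithCorners ℝ E' H'}
    [ChartedSpace H' N] {W : S → N} {c q : S} (hq : q ∈ (extChartAt (𝓡 m) c).source)
    (hW : ContMDiffAt (𝓡 m) I' ∞ W q) :
    ContMDiffAt 𝓘(ℝ, EuclideanSpace ℝ (Fin m)) I' ∞ (W ∘ (extChartAt (𝓡 m) c).symm)
      (extChartAt (𝓡 m) c q) := by
  refine ContMDiffAt.comp (I' := 𝓡 m) _ ?_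
    (contMDiffAt_chart_symm ((extChartAt (𝓡 m) c).map_source hq))
  rwa [(extChartAt (𝓡 m) c).left_inv hq]

lemma mfderiv_eq_coord {W : S → F} {c q : S} (hq : q ∈ (extChartAt (𝓡 m) c).source)
    (hW : MDifferentiableAt (𝓡 m) 𝓘(ℝ, F) W q) (X : TangentSpace (𝓡 m) q) :
    mfderiv (𝓡 m) 𝓘(ℝ, F) W q X =
      fderiv ℝ (W ∘ (extChartAt (𝓡 m) c).symm) (extChartAt (𝓡 m) c q) (coord c q X) := by
  have hs : MDifferentiableAt 𝓘(ℝ, EuclideanSpace ℝ (Fin m)) (𝓡 m) (extChartAt (𝓡 m) c).symm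
      (extChartAt (𝓡 m) c q) :=
    (contMDiffAt_chart_symm ((extChartAt (𝓡 m) c).map_source hq)).mdifferentiableAt (by simp)
  have h : W =ᶠ[𝓝 q] (W ∘ (extChartAt (𝓡 m) c).symm) ∘ extChartAt (𝓡 m) c := by
    filter_upwards [extChartAt_source_mem_nhds' (I := 𝓡 m) hq] with z hz
    simp only [Function.comp_apply, (extChartAt (𝓡 m) c).left_inv hz]
  have h1 : MDifferentiableAt 𝓘(ℝ, EuclideanSpace ℝ (Fin m)) 𝓘(ℝ, F)
      (W ∘ (extChartAt (𝓡 m) c).symm) (extChartAt (𝓡 m) c q) := by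
    refine MDifferentiableAt.comp (I' := 𝓡 m) _ ?_ hs
    rwa [(extChartAt (𝓡 m) c).left_inv hq]
  rw [h.mfderiv_eq, mfderiv_comp q h1 (mdifferentiableAt_chart hq), mfderiv_eq_fderiv]
  rfl

/-- `C^∞` at a point provides a neighbourhood for each finite order but no common one, so the
argument passes to order one. -/
lemma ContMDiffAt.eventually_mdifferentiableAt {W : S → F}
    (hW : ContMDiffAt (𝓡 m) 𝓘(ℝ, F) ∞ W p) :
    ∀ᶠ q in 𝓝 p, MDifferentiableAt (𝓡 m) 𝓘(ℝ, F) W q :=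
  ((contMDiffAt_iff_contMDiffAt_nhds (n := 1) (by simp)).1 (hW.of_le (by simp))).mono fun _ h =>
    h.mdifferentiableAt (by simp)

lemma contMDiffAt_mfderiv_apply {W : S → F} (hW : ContMDiffAt (𝓡 m) 𝓘(ℝ, F) ∞ W p)
    {X : ∀ q : S, TangentSpace (𝓡 m) q} (hX : SmoothFieldAt m X p) :
    ContMDiffAt (𝓡 m) 𝓘(ℝ, F) ∞ (fun q => (mfderiv (𝓡 m) 𝓘(ℝ, F) W q (X q) : F)) p := by
  have h0 := mem_extChartAt_source (I := 𝓡 m) p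
  have h1 : ContDiffAt ℝ ∞ (W ∘ (extChartAt (𝓡 m) p).symm) (extChartAt (𝓡 m) p p) :=
    contMDiffAt_iff_contDiffAt.1 (contMDiffAt_comp_chart_symm h0 hW)
  have h2 : ContMDiffAt (𝓡 m) 𝓘(ℝ, EuclideanSpace ℝ (Fin m) →L[ℝ] F) ∞
      (fun q => fderiv ℝ (W ∘ (extChartAt (𝓡 m) p).symm) (extChartAt (𝓡 m) p q)) p :=
    (h1.fderiv_right (m := ∞) (by simp)).comp_contMDiffAt (contMDiffAt_chart h0)
  refine (h2.clm_apply ((smoothFieldAt_iff h0 X).1 hX)).congr_of_eventuallyEq ?_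
  filter_upwards [extChartAt_source_mem_nhds' (I := 𝓡 m) h0,
    ContMDiffAt.eventually_mdifferentiableAt hW] with q hq hq'
  exact mfderiv_eq_coord hq hq' (X q)

section Along

lemma coord_mfderiv (hf : MDifferentiableAt (𝓡 m) (𝓡 n) f p) {c : M}
    (hc : f p ∈ (extChartAt (𝓡 n) c).source) (X : TangentSpace (𝓡 m) p) :
    coord c (f p) (mfderiv (𝓡 m) (𝓡 n) f p X) =
      mfderiv (𝓡 m) 𝓘(ℝ, EuclideanSpace ℝ (Fin n)) (extChartAt (𝓡 n) c ∘ f) p X := by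
  rw [mfderiv_comp p (mdifferentiableAt_chart hc) hf]
  rfl

lemma contMDiffAt_chart_comp (hf : ContMDiffAt (𝓡 m) (𝓡 n) ∞ f p) {c : M}
    (hc : f p ∈ (extChartAt (𝓡 n) c).source) :
    ContMDiffAt (𝓡 m) 𝓘(ℝ, EuclideanSpace ℝ (Fin n)) ∞ (fun q => extChartAt (𝓡 n) c (f q)) p :=
  (contMDiffAt_chart hc).comp p hf

lemma eventually_mem_chart (hf : ContinuousAt f p) {c : M}
    (hc : f p ∈ (extChartAt (𝓡 n) c).source) :
    ∀ᶠ q in 𝓝 p, f q ∈ (extChartAt (𝓡 n) c).source :=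
  hf.eventually_mem (extChartAt_source_mem_nhds' (I := 𝓡 n) hc)

lemma SmoothAlongAt.add (hf : ContMDiffAt (𝓡 m) (𝓡 n) ∞ f p)
    {V W : ∀ q, TangentSpace (𝓡 n) (f q)}
    (hV : SmoothAlongAt m f V p) (hW : SmoothAlongAt m f W p) :
    SmoothAlongAt m f (fun q => V q + W q) p := by
  have h0 := mem_extChartAt_source (I := 𝓡 n) (f p)
  rw [smoothAlongAt_iff hf h0] at *
  exact (ContMDiffAt.add hV hW).congr_of_eventuallyEq (.of_forall fun q => map_add _ _ _)

lemma SmoothAlongAt.smul (hf : ContMDiffAt (𝓡 m) (𝓡 n) ∞ f p)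
    {V : ∀ q, TangentSpace (𝓡 n) (f q)} {u : S → ℝ} (hu : ContMDiffAt (𝓡 m) 𝓘(ℝ, ℝ) ∞ u p)
    (hV : SmoothAlongAt m f V p) : SmoothAlongAt m f (fun q => u q • V q) p := by
  have h0 := mem_extChartAt_source (I := 𝓡 n) (f p)
  rw [smoothAlongAt_iff hf h0] at *
  exact (ContMDiffAt.smul hu hV).congr_of_eventuallyEq (.of_forall fun q => map_smul _ _ _)

lemma SmoothAlongAt.neg (hf : ContMDiffAt (𝓡 m) (𝓡 n) ∞ f p)
    {V : ∀ q, TangentSpace (𝓡 n) (f q)} (hV : SmoothAlongAt m f V p) :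
    SmoothAlongAt m f (fun q => -V q) p := by
  simpa using hV.smul hf (u := fun _ => -1) contMDiffAt_const

lemma SmoothAlongAt.sub (hf : ContMDiffAt (𝓡 m) (𝓡 n) ∞ f p)
    {V W : ∀ q, TangentSpace (𝓡 n) (f q)}
    (hV : SmoothAlongAt m f V p) (hW : SmoothAlongAt m f W p) :
    SmoothAlongAt m f (fun q => V q - W q) p := by
  simpa only [sub_eq_add_neg] using hV.add hf (hW.neg hf)

lemma SmoothAlongAt.sum {ι : Type*} (s : Finset ι) (hf : ContMDiffAt (𝓡 m) (𝓡 n) ∞ f p)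
    {V : ι → ∀ q, TangentSpace (𝓡 n) (f q)} (hV : ∀ a ∈ s, SmoothAlongAt m f (V a) p) :
    SmoothAlongAt m f (fun q => ∑ a ∈ s, V a q) p := by
  have h0 := mem_extChartAt_source (I := 𝓡 n) (f p)
  simp only [smoothAlongAt_iff hf h0] at *
  simp only [map_sum]
  exact contMDiffAt_finsetSum hV

lemma SmoothAlongAt.mfderiv (hf : ContMDiff (𝓡 m) (𝓡 n) ∞ f)
    {X : ∀ q : S, TangentSpace (𝓡 m) q} (hX : SmoothFieldAt m X p) :
    SmoothAlongAt m f (fun q => _root_.mfderiv (𝓡 m) (𝓡 n) f q (X q)) p := by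
  have h0 := mem_extChartAt_source (I := 𝓡 n) (f p)
  rw [smoothAlongAt_iff hf.contMDiffAt h0]
  refine (contMDiffAt_mfderiv_apply (contMDiffAt_chart_comp hf.contMDiffAt h0) hX).congr_of_eventuallyEq ?_
  filter_upwards [eventually_mem_chart hf.continuous.continuousAt h0] with q hq
  exact coord_mfderiv (hf.mdifferentiableAt (by simp)) hq _

/-- Continuity of the inner product of smooth fields, in the `C^∞` sense. -/
lemma SmoothAlongAt.metric (hg : IsSmoothMetric g) (hf : ContMDiffAt (𝓡 m) (𝓡 n) ∞ f p)
    {V W : ∀ q, TangentSpace (𝓡 n) (f q)}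
    (hV : SmoothAlongAt m f V p) (hW : SmoothAlongAt m f W p) :
    ContMDiffAt (𝓡 m) 𝓘(ℝ, ℝ) ∞ (fun q => g (f q) (V q) (W q)) p := by
  have h0 := mem_extChartAt_source (I := 𝓡 n) (f p)
  rw [smoothAlongAt_iff hf h0] at *
  have h1 : ContMDiffAt (𝓡 m)
      𝓘(ℝ, EuclideanSpace ℝ (Fin n) →L[ℝ] EuclideanSpace ℝ (Fin n) →L[ℝ] ℝ) ∞
      (fun q => chartMetric g (f p) (extChartAt (𝓡 n) (f p) (f q))) p :=
    ContDiffAt.comp_contMDiffAt (f := fun q => extChartAt (𝓡 n) (f p) (f q))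
      (contDiffAt_chartMetric hg h0) (contMDiffAt_chart_comp hf h0)
  refine ((h1.clm_apply hV).clm_apply hW).congr_of_eventuallyEq ?_
  filter_upwards [eventually_mem_chart hf.continuousAt h0] with q hq
  exact (chartMetric_coord g hq _ _).symm

/-- In the fixed chart at `f p` the covariant derivative is a smooth expression. That formula is
used at every nearby `q`, which is why `V` must be smooth near `p` and not only at `p`. -/
lemma SmoothAlongAt.covDerivAlong (hg : IsSmoothMetric g) (hf : ContMDiff (𝓡 m) (𝓡 n) ∞ f)
    {V : ∀ q, TangentSpace (𝓡 n) (f q)} (hV : ∀ᶠ q in 𝓝 p, SmoothAlongAt m f V q)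
    {X : ∀ q : S, TangentSpace (𝓡 m) q} (hX : SmoothFieldAt m X p) :
    SmoothAlongAt m f (fun q => covDerivAlong g f V q (X q)) p := by
  have h0 := mem_extChartAt_source (I := 𝓡 n) (f p)
  rw [smoothAlongAt_iff hf.contMDiffAt h0]
  have hVp := (smoothAlongAt_iff hf.contMDiffAt h0 V).1 hV.self_of_nhds
  have hdf := (smoothAlongAt_iff hf.contMDiffAt h0 _).1 (SmoothAlongAt.mfderiv hf hX)
  have h1 := contMDiffAt_mfderiv_apply hVp hX
  have h2 := contDiffAt_flatChristoffel (contDiffAt_chartMetric hg h0)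
    (chartMetric_isInvertible hg h0)
    (coord (f p) (f p) (_root_.mfderiv (𝓡 m) (𝓡 n) f p (X p))) (coord (f p) (f p) (V p))
  have h3 := contMDiffAt_zip h2 (contMDiffAt_chart_comp hf.contMDiffAt h0)
    (hdf.prodMk_space hVp)
  refine (h1.add h3).congr_of_eventuallyEq ?_
  filter_upwards [eventually_mem_chart hf.continuous.continuousAt h0, hV] with q hq hq'
  exact coord_covDerivAlong hg hf.contMDiffAt hq hq' (X q)

end Along

end SmoothFields

/-! ### Directional derivatives of vector valued functions. -/

section DirectionalDerivative

variable {m : ℕ} {S : Type*} [TopologicalSpace S] [ChartedSpace (EuclideanSpace ℝ (Fin m)) S]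
  {p : S} {F : Type*} [NormedAddCommGroup F] [NormedSpace ℝ F]

/-- The derivative of a vector valued function in the direction of a tangent vector. -/
def dirDeriv (W : S → F) (p : S) (X : TangentSpace (𝓡 m) p) : F :=
  mfderiv (𝓡 m) 𝓘(ℝ, F) W p X

lemma dirDeriv_congr {W W' : S → F} (h : W =ᶠ[𝓝 p] W') (X : TangentSpace (𝓡 m) p) :
    dirDeriv W p X = dirDeriv W' p X := by
  unfold dirDeriv
  rw [h.mfderiv_eq]
  rfl

lemma dirDeriv_const (a : F) (X : TangentSpace (𝓡 m) p) :
    dirDeriv (fun _ : S => a) p X = 0 := by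
  unfold dirDeriv
  rw [mfderiv_const]
  rfl

lemma dirDeriv_comp {F' : Type*} [NormedAddCommGroup F'] [NormedSpace ℝ F']
    {B : F → F'} {B' : F →L[ℝ] F'} {a : S → F} (hB : HasFDerivAt B B' (a p))
    (ha : MDifferentiableAt (𝓡 m) 𝓘(ℝ, F) a p) (X : TangentSpace (𝓡 m) p) :
    dirDeriv (fun q => B (a q)) p X = B' (dirDeriv a p X) := by
  have hcomp := HasMFDerivAt.comp p hB.hasMFDerivAt ha.hasMFDerivAt
  exact DFunLike.congr_fun hcomp.mfderiv X

lemma dirDeriv_zip {F' : Type*} [NormedAddCommGroup F'] [NormedSpace ℝ F']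
    {F'' : Type*} [NormedAddCommGroup F''] [NormedSpace ℝ F'']
    {B : F × F' → F''} {B' : F × F' →L[ℝ] F''} {a : S → F} {b : S → F'}
    (hB : HasFDerivAt B B' (a p, b p)) (ha : MDifferentiableAt (𝓡 m) 𝓘(ℝ, F) a p)
    (hb : MDifferentiableAt (𝓡 m) 𝓘(ℝ, F') b p) (X : TangentSpace (𝓡 m) p) :
    dirDeriv (fun q => B (a q, b q)) p X = B' (dirDeriv a p X, dirDeriv b p X) := by
  have hcomp := HasMFDerivAt.comp p hB.hasMFDerivAt (ha.hasMFDerivAt.prodMk hb.hasMFDerivAt)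
  exact DFunLike.congr_fun hcomp.mfderiv X

lemma dirDeriv_add {a b : S → F} (ha : MDifferentiableAt (𝓡 m) 𝓘(ℝ, F) a p)
    (hb : MDifferentiableAt (𝓡 m) 𝓘(ℝ, F) b p) (X : TangentSpace (𝓡 m) p) :
    dirDeriv (fun q => a q + b q) p X = dirDeriv a p X + dirDeriv b p X :=
  dirDeriv_zip (B := fun z : F × F => z.1 + z.2)
    (B' := ContinuousLinearMap.fst ℝ F F + ContinuousLinearMap.snd ℝ F F)
    (hasFDerivAt_fst.add hasFDerivAt_snd) ha hb X

lemma dirDeriv_smul {u : S → ℝ} {b : S → F} (hu : MDifferentiableAt (𝓡 m) 𝓘(ℝ, ℝ) u p)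
    (hb : MDifferentiableAt (𝓡 m) 𝓘(ℝ, F) b p) (X : TangentSpace (𝓡 m) p) :
    dirDeriv (fun q => u q • b q) p X = u p • dirDeriv b p X + dirDeriv u p X • b p := by
  rw [dirDeriv_zip (B := fun z : ℝ × F => z.1 • z.2) (hasFDerivAt_fst.smul hasFDerivAt_snd) hu hb]
  simp

lemma dirDeriv_clm_apply {F' : Type*} [NormedAddCommGroup F'] [NormedSpace ℝ F']
    {A : S → F →L[ℝ] F'} {b : S → F} (hA : MDifferentiableAt (𝓡 m) 𝓘(ℝ, F →L[ℝ] F') A p)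
    (hb : MDifferentiableAt (𝓡 m) 𝓘(ℝ, F) b p) (X : TangentSpace (𝓡 m) p) :
    dirDeriv (fun q => A q (b q)) p X = A p (dirDeriv b p X) + dirDeriv A p X (b p) := by
  rw [dirDeriv_zip (B := fun z : (F →L[ℝ] F') × F => z.1 z.2)
    ((hasFDerivAt_fst (𝕜 := ℝ)).clm_apply hasFDerivAt_snd) hA hb]
  simp

end DirectionalDerivative

/-! ### Linearity, Leibniz rule and metric compatibility of the connection. -/

section CovariantDerivative

variable {m n : ℕ} {M : Type*} [TopologicalSpace M] [ChartedSpace (EuclideanSpace ℝ (Fin n)) M]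
  [IsManifold (𝓡 n) ∞ M] {g : BilinField n M}
  {S : Type*} [TopologicalSpace S] [ChartedSpace (EuclideanSpace ℝ (Fin m)) S]
  [IsManifold (𝓡 m) ∞ S] {f : S → M} {p : S}

lemma christoffel_add (g : BilinField n M) (c : M) (y u v w : EuclideanSpace ℝ (Fin n)) :
    christoffel g c y u (v + w) = christoffel g c y u v + christoffel g c y u w := by
  unfold christoffel
  rw [← map_add, ← smul_add]
  congr 2
  simp only [map_add, add_apply]
  abel

lemma christoffel_smul (g : BilinField n M) (c : M) (y u v : EuclideanSpace ℝ (Fin n)) (a : ℝ) :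
    christoffel g c y u (a • v) = a • christoffel g c y u v := by
  unfold christoffel
  rw [← map_smul, smul_comm a]
  congr 2
  simp only [map_smul, FunLike.coe_smul, Pi.smul_apply, smul_add, smul_sub]

lemma christoffel_add_left (g : BilinField n M) (c : M) (y u v w : EuclideanSpace ℝ (Fin n)) :
    christoffel g c y (u + v) w = christoffel g c y u w + christoffel g c y v w := by
  unfold christoffel
  rw [← map_add, ← smul_add]
  congr 2
  simp only [map_add, add_apply, ContinuousLinearMap.flip_add]
  abel

lemma christoffel_smul_left (g : BilinField n M) (c : M) (y u v : EuclideanSpace ℝ (Fin n))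
    (a : ℝ) : christoffel g c y (a • u) v = a • christoffel g c y u v := by
  unfold christoffel
  rw [← map_smul, smul_comm a]
  congr 2
  simp only [map_smul, FunLike.coe_smul, Pi.smul_apply, smul_add, smul_sub,
    ContinuousLinearMap.flip_smul]

lemma SmoothAlongAt.mdifferentiableAt_coord (hf : ContMDiffAt (𝓡 m) (𝓡 n) ∞ f p)
    {V : ∀ q, TangentSpace (𝓡 n) (f q)} (hV : SmoothAlongAt m f V p) :
    MDifferentiableAt (𝓡 m) 𝓘(ℝ, EuclideanSpace ℝ (Fin n)) (fun q => coord (f p) (f q) (V q)) p :=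
  ((smoothAlongAt_iff hf (mem_extChartAt_source _) V).1 hV).mdifferentiableAt (by simp)

lemma coordDeriv_eq_dirDeriv (c : M) (f : S → M) (V : ∀ q, TangentSpace (𝓡 n) (f q)) (p : S)
    (X : TangentSpace (𝓡 m) p) :
    coordDeriv c f V p X = dirDeriv (fun q => coord c (f q) (V q)) p X := rfl

lemma dirDeriv_map_add {F : Type*} [NormedAddCommGroup F] [NormedSpace ℝ F] (W : S → F) (p : S)
    (X Y : TangentSpace (𝓡 m) p) : dirDeriv W p (X + Y) = dirDeriv W p X + dirDeriv W p Y :=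
  map_add (mfderiv (𝓡 m) 𝓘(ℝ, F) W p) X Y

lemma dirDeriv_map_smul {F : Type*} [NormedAddCommGroup F] [NormedSpace ℝ F] (W : S → F) (p : S)
    (a : ℝ) (X : TangentSpace (𝓡 m) p) : dirDeriv W p (a • X) = a • dirDeriv W p X :=
  map_smul (mfderiv (𝓡 m) 𝓘(ℝ, F) W p) a X

lemma covDerivAlong_congr (g : BilinField n M) {V W : ∀ q, TangentSpace (𝓡 n) (f q)}
    (h : ∀ᶠ q in 𝓝 p, V q = W q) (X : TangentSpace (𝓡 m) p) :
    covDerivAlong g f V p X = covDerivAlong g f W p X := by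
  apply coord_injective (mem_extChartAt_source (I := 𝓡 n) (f p))
  rw [covDerivAlong_eq, covDerivAlong_eq, h.self_of_nhds]
  congr 1
  exact dirDeriv_congr (h.mono fun q hq => by simp only [hq]) X

lemma covDerivAlong_map_add (g : BilinField n M) (f : S → M) (V : ∀ q, TangentSpace (𝓡 n) (f q))
    (p : S) (X Y : TangentSpace (𝓡 m) p) :
    covDerivAlong g f V p (X + Y) = covDerivAlong g f V p X + covDerivAlong g f V p Y := by
  apply coord_injective (mem_extChartAt_source (I := 𝓡 n) (f p))
  simp only [map_add, covDerivAlong_eq, christoffel_add_left, coordDeriv_eq_dirDeriv,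
    dirDeriv_map_add]
  abel

lemma covDerivAlong_map_smul (g : BilinField n M) (f : S → M) (V : ∀ q, TangentSpace (𝓡 n) (f q))
    (p : S) (a : ℝ) (X : TangentSpace (𝓡 m) p) :
    covDerivAlong g f V p (a • X) = a • covDerivAlong g f V p X := by
  apply coord_injective (mem_extChartAt_source (I := 𝓡 n) (f p))
  simp only [map_smul, covDerivAlong_eq, christoffel_smul_left, coordDeriv_eq_dirDeriv,
    dirDeriv_map_smul, smul_add]

lemma covDerivAlong_add (g : BilinField n M) (hf : ContMDiffAt (𝓡 m) (𝓡 n) ∞ f p)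
    {V W : ∀ q, TangentSpace (𝓡 n) (f q)}
    (hV : SmoothAlongAt m f V p) (hW : SmoothAlongAt m f W p) (X : TangentSpace (𝓡 m) p) :
    covDerivAlong g f (fun q => V q + W q) p X =
      covDerivAlong g f V p X + covDerivAlong g f W p X := by
  apply coord_injective (mem_extChartAt_source (I := 𝓡 n) (f p))
  have h := dirDeriv_add (hV.mdifferentiableAt_coord hf) (hW.mdifferentiableAt_coord hf) X
  simp only [← map_add] at h
  rw [map_add, covDerivAlong_eq, covDerivAlong_eq, covDerivAlong_eq, map_add, christoffel_add]
  simp only [coordDeriv_eq_dirDeriv, h]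
  abel

lemma covDerivAlong_smul (g : BilinField n M) (hf : ContMDiffAt (𝓡 m) (𝓡 n) ∞ f p)
    {u : S → ℝ} (hu : MDifferentiableAt (𝓡 m) 𝓘(ℝ, ℝ) u p)
    {V : ∀ q, TangentSpace (𝓡 n) (f q)} (hV : SmoothAlongAt m f V p) (X : TangentSpace (𝓡 m) p) :
    covDerivAlong g f (fun q => u q • V q) p X =
      u p • covDerivAlong g f V p X + dirDeriv u p X • V p := by
  apply coord_injective (mem_extChartAt_source (I := 𝓡 n) (f p))
  have h := dirDeriv_smul hu (hV.mdifferentiableAt_coord hf) X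
  simp only [map_add, map_smul, covDerivAlong_eq, christoffel_smul, coordDeriv_eq_dirDeriv, h,
    smul_add]
  abel

lemma covDerivAlong_zero (g : BilinField n M) (X : TangentSpace (𝓡 m) p) :
    covDerivAlong g f (fun q => (0 : TangentSpace (𝓡 n) (f q))) p X = 0 := by
  apply coord_injective (mem_extChartAt_source (I := 𝓡 n) (f p))
  have h1 := dirDeriv_const (S := S) (p := p) (0 : EuclideanSpace ℝ (Fin n)) X
  have h2 := christoffel_smul g (f p) (extChartAt (𝓡 n) (f p) (f p))
    (coord (f p) (f p) (mfderiv (𝓡 m) (𝓡 n) f p X)) 0 0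
  rw [zero_smul, zero_smul] at h2
  rw [covDerivAlong_eq, map_zero, h2, add_zero]
  simpa only [coordDeriv_eq_dirDeriv, map_zero] using h1

lemma covDerivAlong_sum {ι : Type*} (s : Finset ι) (g : BilinField n M)
    (hf : ContMDiffAt (𝓡 m) (𝓡 n) ∞ f p) {V : ι → ∀ q, TangentSpace (𝓡 n) (f q)}
    (hV : ∀ a, SmoothAlongAt m f (V a) p) (X : TangentSpace (𝓡 m) p) :
    covDerivAlong g f (fun q => ∑ a ∈ s, V a q) p X = ∑ a ∈ s, covDerivAlong g f (V a) p X := by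
  classical
  induction s using Finset.induction_on with
  | empty => simpa using covDerivAlong_zero g X
  | insert a s ha ih =>
    simp only [Finset.sum_insert ha]
    rw [covDerivAlong_add g hf (hV a) (SmoothAlongAt.sum s hf fun b _ => hV b), ih]

/-- The Levi-Civita connection is compatible with the metric. -/
lemma dirDeriv_metric (hg : IsSmoothMetric g) (hf : ContMDiffAt (𝓡 m) (𝓡 n) ∞ f p)
    {V W : ∀ q, TangentSpace (𝓡 n) (f q)}
    (hV : SmoothAlongAt m f V p) (hW : SmoothAlongAt m f W p) (X : TangentSpace (𝓡 m) p) :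
    dirDeriv (fun q => g (f q) (V q) (W q)) p X =
      g (f p) (covDerivAlong g f V p X) (W p) + g (f p) (V p) (covDerivAlong g f W p X) := by
  have h0 := mem_extChartAt_source (I := 𝓡 n) (f p)
  have hev : (fun q => g (f q) (V q) (W q)) =ᶠ[𝓝 p] fun q =>
      chartMetric g (f p) (extChartAt (𝓡 n) (f p) (f q)) (coord (f p) (f q) (V q))
        (coord (f p) (f q) (W q)) := by
    filter_upwards [eventually_mem_chart hf.continuousAt h0] with q hq
    exact (chartMetric_coord g hq _ _).symm
  have hG := contDiffAt_chartMetric hg h0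
  have hi := chartMetric_isInvertible hg h0
  have hy : MDifferentiableAt (𝓡 m) 𝓘(ℝ, EuclideanSpace ℝ (Fin n))
      (fun q => extChartAt (𝓡 n) (f p) (f q)) p :=
    (contMDiffAt_chart_comp hf h0).mdifferentiableAt (by simp)
  have h1 : MDifferentiableAt (𝓡 m)
      𝓘(ℝ, EuclideanSpace ℝ (Fin n) →L[ℝ] EuclideanSpace ℝ (Fin n) →L[ℝ] ℝ)
      (fun q => chartMetric g (f p) (extChartAt (𝓡 n) (f p) (f q))) p :=
    (ContDiffAt.comp_contMDiffAt (f := fun q => extChartAt (𝓡 n) (f p) (f q)) hG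
      (contMDiffAt_chart_comp hf h0)).mdifferentiableAt (by simp)
  have hVc := hV.mdifferentiableAt_coord hf
  have hWc := hW.mdifferentiableAt_coord hf
  have h2 := dirDeriv_comp (a := fun q => extChartAt (𝓡 n) (f p) (f q)) (hG.differentiableAt (by simp)).hasFDerivAt hy X
  have hdf := coord_mfderiv (hf.mdifferentiableAt (by simp)) h0 X
  have h3 : dirDeriv (fun q => extChartAt (𝓡 n) (f p) (f q)) p X =
      coord (f p) (f p) (mfderiv (𝓡 m) (𝓡 n) f p X) := hdf.symm
  rw [dirDeriv_congr hev, dirDeriv_clm_apply (h1.clm_apply hVc) hWc,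
    dirDeriv_clm_apply h1 hVc, h2, h3, ← chartMetric_coord g h0, ← chartMetric_coord g h0,
    covDerivAlong_eq, covDerivAlong_eq]
  simp only [map_add, add_apply]
  -- The derivatives of the coordinates of `V` and `W` already agree on both sides; what remains is
  -- the derivative of the metric coefficients.
  rw [flatChristoffel_compatible (hG.differentiableAt (by simp)) hi
    (.of_forall fun z u v => chartMetric_symm hg _ _ _ _)]
  simp only [coordDeriv_eq_dirDeriv]
  unfold christoffel flatChristoffel
  ring

end CovariantDerivative

/-! ### Raising indices, and smoothness tested on coordinate frames. -/

section Inverse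

variable {m : ℕ} {S : Type*} [TopologicalSpace S] [ChartedSpace (EuclideanSpace ℝ (Fin m)) S]
  [IsManifold (𝓡 m) ∞ S] {σ : BilinField m S} {p : S}

lemma chartMetric_inverse (hσ : IsSmoothMetric σ) {c q : S}
    (hq : q ∈ (extChartAt (𝓡 m) c).source) (η : TangentSpace (𝓡 m) q →L[ℝ] ℝ) :
    coord c q ((σ q).inverse η) = (chartMetric σ c (extChartAt (𝓡 m) c q)).inverse
      (η.comp (coord c q).inverse) := by
  have h1 := chartMetric_isInvertible hσ hq
  rw [← inverse_apply_of_isInvertible h1 (coord c q ((σ q).inverse η))]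
  congr 1
  ext1 u
  obtain ⟨v, rfl⟩ := exists_coord_eq hq u
  rw [chartMetric_coord σ hq, apply_inverse_of_isInvertible (hσ.isInvertible q),
    ContinuousLinearMap.comp_apply, inverse_apply_of_isInvertible (coord_isInvertible hq)]

/-- The vector field dual to a smooth covector field is smooth. -/
lemma smoothFieldAt_inverse (hσ : IsSmoothMetric σ) {η : ∀ q : S, TangentSpace (𝓡 m) q →L[ℝ] ℝ}
    (hη : ∀ u, ContMDiffAt (𝓡 m) 𝓘(ℝ, ℝ) ∞ (fun q => η q (frame p u q)) p) :
    SmoothFieldAt m (fun q => (σ q).inverse (η q)) p := by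
  have h0 := mem_extChartAt_source (I := 𝓡 m) p
  rw [smoothFieldAt_iff h0]
  have h1 : ContMDiffAt (𝓡 m) 𝓘(ℝ, EuclideanSpace ℝ (Fin m) →L[ℝ] ℝ) ∞
      (fun q => (η q).comp (coord p q).inverse) p := by
    -- The covector is expanded in the dual standard basis; its coefficients are the values on the
    -- coordinate frame, smooth by hypothesis.
    have h2 : ∀ q, (η q).comp (coord p q).inverse = ∑ a, η q (frame p
        (EuclideanSpace.basisFun (Fin m) ℝ a) q) • EuclideanSpace.proj (𝕜 := ℝ) a := by
      intro q
      ext1 u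
      nth_rw 1 [← (EuclideanSpace.basisFun (Fin m) ℝ).sum_repr u]
      simp only [map_sum, map_smul, EuclideanSpace.basisFun_repr, smul_eq_mul,
        ContinuousLinearMap.comp_apply, frame]
      simp [mul_comm]
    simp only [h2]
    exact contMDiffAt_finsetSum fun a _ => (hη _).smul contMDiffAt_const
  have h3 : ContMDiffAt (𝓡 m) 𝓘(ℝ, (EuclideanSpace ℝ (Fin m) →L[ℝ] ℝ) →L[ℝ]
      EuclideanSpace ℝ (Fin m)) ∞
      (fun q => (chartMetric σ p (extChartAt (𝓡 m) p q)).inverse) p :=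
    ContDiffAt.comp_contMDiffAt (g := fun y => (chartMetric σ p y).inverse)
      ((chartMetric_isInvertible hσ h0).contDiffAt_map_inverse.comp _
        (contDiffAt_chartMetric hσ h0)) (contMDiffAt_chart h0)
  refine (h3.clm_apply h1).congr_of_eventuallyEq ?_
  filter_upwards [extChartAt_source_mem_nhds' (I := 𝓡 m) h0] with q hq
  exact chartMetric_inverse hσ hq _

lemma chartMetric_eq_frame (σ : BilinField m S) {c q : S} (hq : q ∈ (extChartAt (𝓡 m) c).source)
    (u v : EuclideanSpace ℝ (Fin m)) :
    chartMetric σ c (extChartAt (𝓡 m) c q) u v = σ q (frame c u q) (frame c v q) := by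
  rw [← chartMetric_coord σ hq, coord_frame hq, coord_frame hq]

/-- A metric is smooth if its components in the coordinate frames are. -/
lemma IsSmoothMetric.of_frame
    (hs : ∀ (x : S) (v w : TangentSpace (𝓡 m) x), σ x v w = σ x w v)
    (hn : ∀ (x : S) (v : TangentSpace (𝓡 m) x), (∀ w, σ x v w = 0) → v = 0)
    (h : ∀ (c : S) (u v : EuclideanSpace ℝ (Fin m)), ∀ q ∈ (extChartAt (𝓡 m) c).source,
      ContMDiffAt (𝓡 m) 𝓘(ℝ, ℝ) ∞ (fun q => σ q (frame c u q) (frame c v q)) q) :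
    IsSmoothMetric σ where
  symm := hs
  nondegenerate := hn
  contDiffOn c := by
    rw [contDiffOn_clm_apply]
    intro u
    rw [contDiffOn_clm_apply]
    intro v y hy
    apply ContDiffAt.contDiffWithinAt
    obtain ⟨q, hq, rfl⟩ : ∃ q ∈ (extChartAt (𝓡 m) c).source, extChartAt (𝓡 m) c q = y :=
      ⟨_, (extChartAt (𝓡 m) c).map_target hy, (extChartAt (𝓡 m) c).right_inv hy⟩
    rw [← contMDiffAt_iff_contDiffAt]
    refine (contMDiffAt_comp_chart_symm hq (h c u v q hq)).congr_of_eventuallyEq ?_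
    filter_upwards [(isOpen_extChartAt_target (I := 𝓡 m) c).mem_nhds hy] with z hz
    have := chartMetric_eq_frame σ ((extChartAt (𝓡 m) c).map_target hz) u v
    rwa [(extChartAt (𝓡 m) c).right_inv hz] at this

end Inverse

/-! ### Gram matrices and basis independence of the metric trace. -/

section Gram

variable {n : ℕ} {S : Type*} [TopologicalSpace S] [ChartedSpace (EuclideanSpace ℝ (Fin n)) S]
  [IsManifold (𝓡 n) ∞ S] {σ : BilinField n S}

/-- The standard basis vectors of the coordinate space. -/
abbrev stdVec (a : Fin n) : EuclideanSpace ℝ (Fin n) := EuclideanSpace.basisFun (Fin n) ℝ a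

/-- The standard basis of a tangent space. -/
def tangentVec (x : S) (a : Fin n) : TangentSpace (𝓡 n) x := stdVec a

lemma coord_tangentVec (x : S) (a : Fin n) : coord x x (tangentVec x a) = stdVec a :=
  coord_self x _

lemma sum_smul_stdVec (u : EuclideanSpace ℝ (Fin n)) : ∑ a, u a • stdVec a = u :=
  (EuclideanSpace.basisFun (Fin n) ℝ).sum_repr u

/-- The Gram matrix of a bilinear form on the coordinate space. -/
def gram (B : EuclideanSpace ℝ (Fin n) →L[ℝ] EuclideanSpace ℝ (Fin n) →L[ℝ] ℝ) :
    Matrix (Fin n) (Fin n) ℝ :=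
  Matrix.of fun a b => B (stdVec a) (stdVec b)

/-- The matrix of a linear map of the coordinate space. -/
def stdMatrix (A : EuclideanSpace ℝ (Fin n) →L[ℝ] EuclideanSpace ℝ (Fin n)) :
    Matrix (Fin n) (Fin n) ℝ :=
  Matrix.of fun j a => A (stdVec a) j

lemma gram_pullback (B : EuclideanSpace ℝ (Fin n) →L[ℝ] EuclideanSpace ℝ (Fin n) →L[ℝ] ℝ)
    (A : EuclideanSpace ℝ (Fin n) →L[ℝ] EuclideanSpace ℝ (Fin n)) :
    (Matrix.of fun a b => B (A (stdVec a)) (A (stdVec b))) =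
      (stdMatrix A).transpose * gram B * stdMatrix A := by
  ext a b
  simp only [Matrix.of_apply, Matrix.mul_apply, Matrix.transpose_apply, stdMatrix, gram]
  nth_rw 1 [← sum_smul_stdVec (A (stdVec a)), ← sum_smul_stdVec (A (stdVec b))]
  simp only [map_sum, map_smul, sum_apply, smul_eq_mul, FunLike.coe_smul, Pi.smul_apply,
    Finset.mul_sum, Finset.sum_mul]
  exact Finset.sum_congr rfl fun _ _ => Finset.sum_congr rfl fun _ _ => by ring

lemma det_stdMatrix (A : EuclideanSpace ℝ (Fin n) →L[ℝ] EuclideanSpace ℝ (Fin n)) :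
    (stdMatrix A).det = A.det := by
  have : stdMatrix A = LinearMap.toMatrix (EuclideanSpace.basisFun (Fin n) ℝ).toBasis
      (EuclideanSpace.basisFun (Fin n) ℝ).toBasis A.toLinearMap := by
    ext j a
    simp [stdMatrix, LinearMap.toMatrix_apply]
  rw [this, LinearMap.det_toMatrix]

lemma gram_posDef {B : EuclideanSpace ℝ (Fin n) →L[ℝ] EuclideanSpace ℝ (Fin n) →L[ℝ] ℝ}
    (hs : ∀ u v, B u v = B v u) (hB : ∀ u, u ≠ 0 → 0 < B u u) : (gram B).PosDef := by
  refine Matrix.PosDef.of_dotProduct_mulVec_pos ?_ fun x hx => ?_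
  · ext a b
    simpa [gram] using hs _ _
  · have h := hB (∑ a, x a • stdVec a) fun h0 => hx <| by
      ext b
      have := congrArg (fun u : EuclideanSpace ℝ (Fin n) => u b) h0
      simpa [Pi.single_apply] using this
    refine h.trans_eq ?_
    simp only [map_sum, map_smul, sum_apply, smul_eq_mul, FunLike.coe_smul, Pi.smul_apply,
      Finset.mul_sum, dotProduct, Matrix.mulVec, gram, Matrix.of_apply, star_trivial]
    exact Finset.sum_congr rfl fun _ _ => Finset.sum_congr rfl fun _ _ => by
      rw [hs (stdVec _) (stdVec _)]
      ring

lemma gram_change (σ : BilinField n S) {c c' q : S}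
    (hq : q ∈ (extChartAt (𝓡 n) c).source) (hq' : q ∈ (extChartAt (𝓡 n) c').source) :
    gram (chartMetric σ c (extChartAt (𝓡 n) c q)) =
      (stdMatrix (fderiv ℝ (transition c c') (extChartAt (𝓡 n) c q))).transpose *
        gram (chartMetric σ c' (extChartAt (𝓡 n) c' q)) *
        stdMatrix (fderiv ℝ (transition c c') (extChartAt (𝓡 n) c q)) := by
  rw [← gram_pullback]
  ext a b
  simp only [gram, Matrix.of_apply]
  rw [chartMetric_change σ hq hq', transition_chart hq]

lemma gram_chartMetric_posDef (hσ : IsSmoothMetric σ)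
    (hpos : ∀ (x : S) (X : TangentSpace (𝓡 n) x), X ≠ 0 → 0 < σ x X X) {c q : S}
    (hq : q ∈ (extChartAt (𝓡 n) c).source) :
    (gram (chartMetric σ c (extChartAt (𝓡 n) c q))).PosDef := by
  refine gram_posDef (chartMetric_symm hσ _ _) fun u hu => ?_
  rw [chartMetric_eq_frame _ hq]
  refine hpos q _ fun h => hu ?_
  rw [← coord_frame hq u, h, map_zero]

/-- The trace of a bilinear map does not depend on the basis. -/
lemma sum_inv_smul_change {W : Type*} [AddCommGroup W] [Module ℝ W]
    (G P : Matrix (Fin n) (Fin n) ℝ) (hP : IsUnit P.det) (B : Fin n → Fin n → W) :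
    ∑ a, ∑ c, (P.transpose * G * P)⁻¹ a c • ∑ k, P k c • ∑ j, P j a • B j k =
      ∑ j, ∑ k, G⁻¹ j k • B j k := by
  -- `Matrix.mul_inv_rev` holds for the nonsingular inverse without conditions, so only `P` has to
  -- be invertible.
  have h : P * (P.transpose * G * P)⁻¹ * P.transpose = G⁻¹ := by
    rw [Matrix.mul_inv_rev, Matrix.mul_inv_rev, ← Matrix.mul_assoc, Matrix.mul_nonsing_inv _ hP,
      Matrix.one_mul, Matrix.mul_assoc, Matrix.nonsing_inv_mul _ (by rwa [Matrix.det_transpose]),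
      Matrix.mul_one]
  rw [← h]
  generalize (P.transpose * G * P)⁻¹ = Q
  simp only [Matrix.mul_apply, Matrix.transpose_apply, Finset.smul_sum, Finset.sum_smul, smul_smul,
    Finset.sum_mul]
  have h1 : ∀ a, ∑ c, ∑ k, ∑ j, (Q a c * (P k c * P j a)) • B j k =
      ∑ j, ∑ k, ∑ c, (Q a c * (P k c * P j a)) • B j k := fun a => by
    rw [Finset.sum_congr rfl fun c _ => Finset.sum_comm, Finset.sum_comm]
    exact Finset.sum_congr rfl fun j _ => Finset.sum_comm
  rw [Finset.sum_congr rfl fun a _ => h1 a, Finset.sum_comm]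
  refine Finset.sum_congr rfl fun j _ => ?_
  rw [Finset.sum_comm]
  refine Finset.sum_congr rfl fun k _ => ?_
  rw [Finset.sum_comm]
  refine Finset.sum_congr rfl fun c _ => Finset.sum_congr rfl fun a _ => ?_
  congr 1
  ring

end Gram

/-! ### Induced metric, second fundamental form and mean curvature. -/

section Surface

variable {N : Type*} [TopologicalSpace N] [ChartedSpace (EuclideanSpace ℝ (Fin 4)) N]
  [IsManifold (𝓡 4) ∞ N]
  {S : Type*} [TopologicalSpace S] [ChartedSpace (EuclideanSpace ℝ (Fin 2)) S]
  [IsManifold (𝓡 2) ∞ S] {g : LorentzMetric N} {i : S → N} {p : S}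

/-- The orthonormal basis pairs with `v` to give its coefficients up to sign, hence nondegeneracy. A
smooth section of the bundle of forms, evaluated on the smooth coordinate frames, gives smooth
components. -/
lemma LorentzMetric.isSmoothMetric (g : LorentzMetric N) : IsSmoothMetric g.inner := by
  refine IsSmoothMetric.of_frame g.symm (fun x v hv => ?_) fun c u v q hq => ?_
  · obtain ⟨e, he⟩ := g.signature x
    have h : ∀ b, e.repr v b = 0 := by
      intro b
      have h1 := hv (e b)
      rw [← e.sum_repr v] at h1
      simp only [map_sum, map_smul, sum_apply, FunLike.coe_smul, Pi.smul_apply, he,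
        Matrix.diagonal_apply, smul_eq_mul, mul_ite, mul_zero, Finset.sum_ite_eq',
        Finset.mem_univ, if_true] at h1
      fin_cases b <;> simpa using h1
    rw [← e.sum_repr v]
    simp [h]
  · have h1 := smoothFieldAt_frame hq u
    have h2 := smoothFieldAt_frame hq v
    have h3 := ContMDiffAt.clm_bundle_apply₂ (F₁ := EuclideanSpace ℝ (Fin 4))
      (F₂ := EuclideanSpace ℝ (Fin 4)) (F₃ := ℝ) (E₃ := Bundle.Trivial N ℝ)
      (b := fun x : N => x) (g.contMDiff q) h1 h2
    rw [Bundle.contMDiffAt_totalSpace] at h3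
    exact h3.2

lemma isSmoothMetric_inducedMetric (hi : ContMDiff (𝓡 2) (𝓡 4) ∞ i) (hsp : IsSpacelike g i) :
    IsSmoothMetric (inducedMetric g i) := by
  refine IsSmoothMetric.of_frame (fun x v w => g.symm _ _ _) (fun x v hv => ?_)
    fun c u v q hq => ?_
  · by_contra hne
    exact (hsp x v hne).ne' (hv v)
  · exact SmoothAlongAt.metric g.isSmoothMetric hi.contMDiffAt
      (SmoothAlongAt.mfderiv hi (smoothFieldAt_frame hq u))
      (SmoothAlongAt.mfderiv hi (smoothFieldAt_frame hq v))

lemma normalPart_add (v w : TangentSpace (𝓡 4) (i p)) :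
    normalPart g i p (v + w) = normalPart g i p v + normalPart g i p w := by
  unfold normalPart
  simp only [map_add, ContinuousLinearMap.add_comp]
  abel

lemma normalPart_smul (a : ℝ) (v : TangentSpace (𝓡 4) (i p)) :
    normalPart g i p (a • v) = a • normalPart g i p v := by
  unfold normalPart
  simp only [map_smul, ContinuousLinearMap.smul_comp, smul_sub]

lemma normalPart_sum {ι : Type*} (s : Finset ι) (v : ι → TangentSpace (𝓡 4) (i p)) :
    normalPart g i p (∑ a ∈ s, v a) = ∑ a ∈ s, normalPart g i p (v a) := by
  let L : TangentSpace (𝓡 4) (i p) →ₗ[ℝ] TangentSpace (𝓡 4) (i p) :=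
    { toFun := normalPart g i p, map_add' := normalPart_add, map_smul' := normalPart_smul }
  exact map_sum L v s

lemma normalPart_mfderiv (hσ : IsSmoothMetric (inducedMetric g i)) (X : TangentSpace (𝓡 2) p) :
    normalPart g i p (mfderiv (𝓡 2) (𝓡 4) i p X) = 0 := by
  have h : (g.inner (i p) (mfderiv (𝓡 2) (𝓡 4) i p X)).comp (mfderiv (𝓡 2) (𝓡 4) i p) =
    inducedMetric g i p X := rfl
  rw [normalPart, h, inverse_apply_of_isInvertible (hσ.isInvertible p), sub_self]

lemma isNormal_normalPart (hσ : IsSmoothMetric (inducedMetric g i))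
    (v : TangentSpace (𝓡 4) (i p)) : IsNormal g i p (normalPart g i p v) := by
  intro X
  have h := DFunLike.congr_fun (apply_inverse_of_isInvertible (hσ.isInvertible p)
    ((g.inner (i p) v).comp (mfderiv (𝓡 2) (𝓡 4) i p))) X
  rw [normalPart, map_sub]
  exact sub_eq_zero.2 h.symm

lemma SmoothAlongAt.normalPart (hi : ContMDiff (𝓡 2) (𝓡 4) ∞ i)
    (hσ : IsSmoothMetric (inducedMetric g i))
    {V : ∀ q, TangentSpace (𝓡 4) (i q)} (hV : SmoothAlongAt 2 i V p) :
    SmoothAlongAt 2 i (fun q => SpacetimeSurface.normalPart g i q (V q)) p := by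
  refine hV.sub hi.contMDiffAt (SmoothAlongAt.mfderiv hi (smoothFieldAt_inverse hσ fun u => ?_))
  exact hV.metric g.isSmoothMetric hi.contMDiffAt (SmoothAlongAt.mfderiv hi
    (smoothFieldAt_frame (mem_extChartAt_source p) u))

/-- The extension in the definition of `II` has constant coordinates in the chart at `p`, so the
calculus of coordinate frames applies to it. -/
lemma extend_eq_frame {q : S} (hq : q ∈ (extChartAt (𝓡 2) p).source) (Y : TangentSpace (𝓡 2) p) :
    FiberBundle.extend (E := fun q : S => TangentSpace (𝓡 2) q) (EuclideanSpace ℝ (Fin 2)) Y q =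
      frame p (coord p p Y) q := by
  have hc : q ∈ (chartAt (EuclideanSpace ℝ (Fin 2)) p).source := by
    rwa [← extChartAt_source (𝓡 2)]
  have hcoord : ∀ q, q ∈ (chartAt (EuclideanSpace ℝ (Fin 2)) p).source →
      ∀ v : TangentSpace (𝓡 2) q, coord p q v =
      (trivializationAt (EuclideanSpace ℝ (Fin 2)) (TangentSpace (𝓡 2)) p ⟨q, v⟩).2 := by
    intro q hq v
    have h := TangentBundle.continuousLinearMapAt_trivializationAt (I := 𝓡 2) hq
    have h2 := DFunLike.congr_fun h v
    rw [Bundle.Trivialization.continuousLinearMapAt_apply,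
      Bundle.Trivialization.coe_linearMapAt_of_mem _ (by simpa using hq)] at h2
    exact h2.symm
  apply coord_injective hq
  rw [coord_frame hq, hcoord q hc, hcoord p (mem_chart_source _ p)]
  simp only [FiberBundle.extend]
  rw [Bundle.Trivialization.apply_mk_symm _ (by simpa using hc)]

/-- This is tensoriality in `Y`: the extension is a combination of the frame of `c` with variable
coefficients, and by the Leibniz rule the derivatives of the coefficients multiply tangent vectors,
which the normal projection kills. -/
lemma secondFundamentalForm_eq (hi : ContMDiff (𝓡 2) (𝓡 4) ∞ i)
    (hσ : IsSmoothMetric (inducedMetric g i)) {c : S} (hp : p ∈ (extChartAt (𝓡 2) c).source)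
    (X Y : TangentSpace (𝓡 2) p) :
    secondFundamentalForm g i p X Y = ∑ k, coord c p Y k • normalPart g i p
      (covDerivAlong g.inner i
        (fun q => mfderiv (𝓡 2) (𝓡 4) i q (frame c (stdVec k) q)) p X) := by
  have h0 := mem_extChartAt_source (I := 𝓡 2) p
  set y : Fin 2 → S → ℝ := fun k q => coord c q (frame p (coord p p Y) q) k with hy
  have hyp : ∀ k, y k p = coord c p Y k := fun k => by simp only [hy, frame_coord h0]
  have hYs : ContMDiffAt (𝓡 2) 𝓘(ℝ, EuclideanSpace ℝ (Fin 2)) ∞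
      (fun q => coord c q (frame p (coord p p Y) q)) p :=
    (smoothFieldAt_iff hp _).1 (smoothFieldAt_frame h0 _)
  have hys : ∀ k, ContMDiffAt (𝓡 2) 𝓘(ℝ, ℝ) ∞ (y k) p := fun k =>
    ContDiffAt.comp_contMDiffAt (g := fun u : EuclideanSpace ℝ (Fin 2) => u k)
      (EuclideanSpace.proj (𝕜 := ℝ) k).contDiff.contDiffAt hYs
  have hfr : ∀ k, SmoothAlongAt 2 i
      (fun q => mfderiv (𝓡 2) (𝓡 4) i q (frame c (stdVec k) q)) p := fun k =>
    SmoothAlongAt.mfderiv hi (smoothFieldAt_frame hp _)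
  have hev : ∀ᶠ q in 𝓝 p, mfderiv (𝓡 2) (𝓡 4) i q (FiberBundle.extend
      (E := fun q : S => TangentSpace (𝓡 2) q) (EuclideanSpace ℝ (Fin 2)) Y q) =
      ∑ k, y k q • mfderiv (𝓡 2) (𝓡 4) i q (frame c (stdVec k) q) := by
    filter_upwards [extChartAt_source_mem_nhds' (I := 𝓡 2) h0,
      extChartAt_source_mem_nhds' (I := 𝓡 2) hp] with q hq hq'
    rw [extend_eq_frame hq]
    simp only [← map_smul, ← map_sum]
    congr 1
    apply coord_injective hq'
    simp only [map_sum, map_smul, coord_frame hq']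
    exact (sum_smul_stdVec _).symm
  rw [secondFundamentalForm, covDerivAlong_congr _ hev,
    covDerivAlong_sum _ _ hi.contMDiffAt fun k => (hfr k).smul hi.contMDiffAt (hys k),
    normalPart_sum]
  refine Finset.sum_congr rfl fun k _ => ?_
  rw [covDerivAlong_smul _ hi.contMDiffAt ((hys k).mdifferentiableAt (by simp)) (hfr k),
    normalPart_add, normalPart_smul, normalPart_smul, normalPart_mfderiv hσ, smul_zero, add_zero,
    hyp]

/-- The components of the mean curvature vector with respect to a coordinate frame. -/
lemma meanCurvature_eq (hi : ContMDiff (𝓡 2) (𝓡 4) ∞ i)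
    (hσ : IsSmoothMetric (inducedMetric g i)) {c : S} (hp : p ∈ (extChartAt (𝓡 2) c).source) :
    meanCurvature g i p =
      ∑ j, ∑ k, (gram (chartMetric (inducedMetric g i) c (extChartAt (𝓡 2) c p)))⁻¹ j k •
        normalPart g i p (covDerivAlong g.inner i
          (fun q => mfderiv (𝓡 2) (𝓡 4) i q (frame c (stdVec k) q)) p (frame c (stdVec j) p)) := by
  have h0 := mem_extChartAt_source (I := 𝓡 2) p
  set P := stdMatrix (fderiv ℝ (transition p c) (extChartAt (𝓡 2) p p)) with hP
  have hPc : ∀ a j, coord c p (tangentVec p a) j = P j a := fun a j => by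
    rw [coord_change h0 hp, coord_tangentVec]
    rfl
  have hG : (Matrix.of fun a b : Fin 2 => inducedMetric g i p
      (tangentVec p a) (tangentVec p b)) =
      P.transpose * gram (chartMetric (inducedMetric g i) c (extChartAt (𝓡 2) c p)) * P := by
    rw [hP, ← gram_change _ h0 hp]
    ext a b
    simp only [gram, Matrix.of_apply]
    rw [← chartMetric_coord _ h0, coord_tangentVec, coord_tangentVec]
  have hPu : IsUnit P.det := by
    rw [hP, det_stdMatrix]
    obtain ⟨e, he⟩ := transition_deriv_isInvertible (n := 2) h0 hp
    rw [← he]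
    exact e.toLinearEquiv.isUnit_det'
  -- `P` is the Jacobian from the chart at `p` to the chart at `c`; both the Gram matrix and `II`
  -- transform by it, and the trace does not see the change.
  rw [← sum_inv_smul_change _ P hPu, ← hG]
  change ∑ a, ∑ b, (Matrix.of fun a b : Fin 2 => inducedMetric g i p
    (tangentVec p a) (tangentVec p b))⁻¹ a b •
    secondFundamentalForm g i p (tangentVec p a) (tangentVec p b) = _
  refine Finset.sum_congr rfl fun a _ => Finset.sum_congr rfl fun b _ => ?_
  congr 1
  rw [secondFundamentalForm_eq hi hσ hp]
  refine Finset.sum_congr rfl fun k _ => ?_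
  congr 1
  · exact hPc b k
  · have h1 : tangentVec p a = ∑ j, P j a • frame c (stdVec j) p := by
      apply coord_injective hp
      simp only [map_sum, map_smul, coord_frame hp, ← hPc]
      exact (sum_smul_stdVec _).symm
    let L : TangentSpace (𝓡 2) p →ₗ[ℝ] TangentSpace (𝓡 4) (i p) :=
      { toFun := fun X => normalPart g i p (covDerivAlong g.inner i
          (fun q => mfderiv (𝓡 2) (𝓡 4) i q (frame c (stdVec k) q)) p X)
        map_add' := fun X Y => by rw [covDerivAlong_map_add, normalPart_add]
        map_smul' := fun a X => by rw [covDerivAlong_map_smul, normalPart_smul]; rfl }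
    change L (tangentVec p a) = ∑ j, P j a • L (frame c (stdVec j) p)
    rw [h1, map_sum]
    simp only [map_smul]

lemma SmoothAlongAt.congr {V W : ∀ q, TangentSpace (𝓡 4) (i q)} (hV : SmoothAlongAt 2 i V p)
    (h : ∀ᶠ q in 𝓝 p, W q = V q) : SmoothAlongAt 2 i W p :=
  ContMDiffAt.congr_of_eventuallyEq hV (h.mono fun q hq => by simp only [hq])

lemma contMDiffAt_gram {σ : BilinField 2 S} (hσ : IsSmoothMetric σ) {c : S}
    (hp : p ∈ (extChartAt (𝓡 2) c).source) (j k : Fin 2) : ContMDiffAt (𝓡 2) 𝓘(ℝ, ℝ) ∞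
      (fun q => gram (chartMetric σ c (extChartAt (𝓡 2) c q)) j k) p :=
  ContDiffAt.comp_contMDiffAt
    (g := fun y => chartMetric σ c y (stdVec j) (stdVec k))
    (((contDiffAt_chartMetric hσ hp).clm_apply contDiffAt_const).clm_apply contDiffAt_const)
    (contMDiffAt_chart hp)

/-- Near `p` all points use the frame of the one chart at `p`, where `meanCurvature_eq` writes `H`
with smooth ingredients. The inverse Gram matrix is smooth by the explicit adjugate formula, its
determinant being positive. -/
lemma smoothAlongAt_meanCurvature (hi : ContMDiff (𝓡 2) (𝓡 4) ∞ i) (hsp : IsSpacelike g i)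
    (p : S) : SmoothAlongAt 2 i (meanCurvature g i) p := by
  have h0 := mem_extChartAt_source (I := 𝓡 2) p
  have hσ := isSmoothMetric_inducedMetric hi hsp
  have hgram := contMDiffAt_gram hσ h0
  have hdet : ContMDiffAt (𝓡 2) 𝓘(ℝ, ℝ) ∞ (fun q =>
      (gram (chartMetric (inducedMetric g i) p (extChartAt (𝓡 2) p q))).det⁻¹) p := by
    refine ContDiffAt.comp_contMDiffAt (g := fun t : ℝ => t⁻¹) (contDiffAt_inv _
      (gram_chartMetric_posDef hσ hsp h0).det_pos.ne') ?_
    simp only [Matrix.det_fin_two]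
    exact ((hgram 0 0).mul (hgram 1 1)).sub ((hgram 0 1).mul (hgram 1 0))
  have hinv : ∀ j k, ContMDiffAt (𝓡 2) 𝓘(ℝ, ℝ) ∞ (fun q =>
      (gram (chartMetric (inducedMetric g i) p (extChartAt (𝓡 2) p q)))⁻¹ j k) p := by
    intro j k
    simp only [Matrix.inv_def, Ring.inverse_eq_inv', Matrix.adjugate_fin_two, Matrix.smul_apply,
      smul_eq_mul]
    fin_cases j <;> fin_cases k
    · exact hdet.mul (hgram 1 1)
    · exact hdet.mul (hgram 0 1).neg
    · exact hdet.mul (hgram 1 0).neg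
    · exact hdet.mul (hgram 0 0)
  have hev := extChartAt_source_mem_nhds' (I := 𝓡 2) h0
  refine SmoothAlongAt.congr (V := fun q => ∑ j, ∑ k,
    (gram (chartMetric (inducedMetric g i) p (extChartAt (𝓡 2) p q)))⁻¹ j k •
        normalPart g i q (covDerivAlong g.inner i
          (fun q => mfderiv (𝓡 2) (𝓡 4) i q (frame p (stdVec k) q)) q (frame p (stdVec j) q))) ?_ ?_
  · refine SmoothAlongAt.sum _ hi.contMDiffAt fun j _ => SmoothAlongAt.sum _ hi.contMDiffAt
      fun k _ => SmoothAlongAt.smul hi.contMDiffAt (hinv j k) (SmoothAlongAt.normalPart hi hσ ?_)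
    refine SmoothAlongAt.covDerivAlong g.isSmoothMetric hi ?_ (smoothFieldAt_frame h0 _)
    filter_upwards [hev] with q hq
    exact SmoothAlongAt.mfderiv hi (smoothFieldAt_frame hq _)
  · filter_upwards [hev] with q hq
    exact meanCurvature_eq hi hσ hq

end Surface

/-! ### The Lorentzian normal plane, future normals and boosts. -/

section NormalBundle

variable {N : Type*} [TopologicalSpace N] [ChartedSpace (EuclideanSpace ℝ (Fin 4)) N]
  [IsManifold (𝓡 4) ∞ N]
  {S : Type*} [TopologicalSpace S] [ChartedSpace (EuclideanSpace ℝ (Fin 2)) S]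
  [IsManifold (𝓡 2) ∞ S] {g : LorentzMetric N} {T : TimeOrientation g} {i : S → N} {p : S}

lemma inducedMetric_apply (X Y : TangentSpace (𝓡 2) p) : inducedMetric g i p X Y =
    g.inner (i p) (mfderiv (𝓡 2) (𝓡 4) i p X) (mfderiv (𝓡 2) (𝓡 4) i p Y) := rfl

lemma IsNormal.add {v w : TangentSpace (𝓡 4) (i p)} (hv : IsNormal g i p v)
    (hw : IsNormal g i p w) : IsNormal g i p (v + w) := fun X => by
  rw [map_add, add_apply, hv X, hw X, add_zero]

lemma IsNormal.smul {v : TangentSpace (𝓡 4) (i p)} (a : ℝ) (hv : IsNormal g i p v) :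
    IsNormal g i p (a • v) := fun X => by
  rw [map_smul, FunLike.coe_smul, Pi.smul_apply, hv X, smul_zero]

lemma IsNormal.neg {v : TangentSpace (𝓡 4) (i p)} (hv : IsNormal g i p v) :
    IsNormal g i p (-v) := by
  simpa using hv.smul (-1)

lemma IsNormal.sub {v w : TangentSpace (𝓡 4) (i p)} (hv : IsNormal g i p v)
    (hw : IsNormal g i p w) : IsNormal g i p (v - w) := by
  simpa only [sub_eq_add_neg] using hv.add hw.neg

/-- The normal space is spanned by an orthonormal pair. -/
lemma IsNormal.eq_zero (hsp : IsSpacelike g i) {v e₃ e₄ : TangentSpace (𝓡 4) (i p)}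
    (hv : IsNormal g i p v) (h3 : IsNormal g i p e₃) (h33 : g.inner (i p) e₃ e₃ = 1)
    (h4 : IsNormal g i p e₄) (h34 : g.inner (i p) e₃ e₄ = 0) (h44 : g.inner (i p) e₄ e₄ = -1)
    (hv3 : g.inner (i p) v e₃ = 0) (hv4 : g.inner (i p) v e₄ = 0) : v = 0 := by
  -- The map `(X, a, b) ↦ di(X) + a e₃ + b e₄` is injective between spaces of dimension `2 + 1 + 1`
  -- and `4`, hence onto. A normal vector orthogonal to both `e₃` and `e₄` is then orthogonal to
  -- everything.
  let L : (TangentSpace (𝓡 2) p × ℝ × ℝ) →ₗ[ℝ] TangentSpace (𝓡 4) (i p) :=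
    (mfderiv (𝓡 2) (𝓡 4) i p).toLinearMap.coprod
      ((LinearMap.toSpanSingleton ℝ _ e₃).coprod (LinearMap.toSpanSingleton ℝ _ e₄))
  have hL : ∀ X a b, L (X, a, b) = mfderiv (𝓡 2) (𝓡 4) i p X + (a • e₃ + b • e₄) :=
    fun X a b => rfl
  have hs : Function.Injective L := by
    rw [← LinearMap.ker_eq_bot, LinearMap.ker_eq_bot']
    rintro ⟨X, a, b⟩ h
    rw [hL] at h
    have ha : a = 0 := by
      have := congrArg (g.inner (i p) e₃) h
      simpa [h3 X, h33, h34] using this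
    have hb : b = 0 := by
      have := congrArg (g.inner (i p) e₄) h
      simpa [h4 X, h44, g.symm _ e₄ e₃, h34] using this
    subst ha hb
    have hX : X = 0 := by
      by_contra hne
      have h0 : mfderiv (𝓡 2) (𝓡 4) i p X = 0 := by simpa using h
      have := hsp p X hne
      rw [inducedMetric_apply, h0, map_zero] at this
      exact lt_irrefl _ this
    rw [hX]
    rfl
  have hfin : Module.finrank ℝ (TangentSpace (𝓡 2) p × ℝ × ℝ) =
      Module.finrank ℝ (TangentSpace (𝓡 4) (i p)) := by
    have h2 : Module.finrank ℝ (TangentSpace (𝓡 2) p) = 2 :=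
      finrank_euclideanSpace_fin (𝕜 := ℝ) (n := 2)
    have h4 : Module.finrank ℝ (TangentSpace (𝓡 4) (i p)) = 4 :=
      finrank_euclideanSpace_fin (𝕜 := ℝ) (n := 4)
    rw [Module.finrank_prod, Module.finrank_prod, h2, h4, Module.finrank_self]
  refine g.isSmoothMetric.nondegenerate (i p) v fun w => ?_
  obtain ⟨⟨X, a, b⟩, rfl⟩ := (LinearMap.injective_iff_surjective_of_finrank_eq_finrank hfin).1 hs w
  rw [hL, map_add, map_add, map_smul, map_smul, hv X, hv3, hv4]
  simp

/-- The minus sign reflects `⟨e₄, e₄⟩ = -1`. -/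
lemma IsNormal.expand (hsp : IsSpacelike g i) {v e₃ e₄ : TangentSpace (𝓡 4) (i p)}
    (hv : IsNormal g i p v) (h3 : IsNormal g i p e₃) (h33 : g.inner (i p) e₃ e₃ = 1)
    (h4 : IsFutureUnitNormal g T i p e₃ e₄) :
    v = g.inner (i p) v e₃ • e₃ - g.inner (i p) v e₄ • e₄ := by
  obtain ⟨h4, h34, h44, -⟩ := h4
  rw [← sub_eq_zero]
  refine IsNormal.eq_zero hsp (hv.sub ((h3.smul _).sub (h4.smul _))) h3 h33 h4 h34 h44 ?_ ?_
  · simp only [map_sub, map_smul, sub_apply, FunLike.coe_smul, Pi.smul_apply, h33,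
      g.symm _ e₄ e₃, h34, smul_eq_mul]
    ring
  · simp only [map_sub, map_smul, sub_apply, FunLike.coe_smul, Pi.smul_apply, h44, h34,
      smul_eq_mul]
    ring

lemma IsNormal.inner_normalPart {v : TangentSpace (𝓡 4) (i p)} (hv : IsNormal g i p v)
    (w : TangentSpace (𝓡 4) (i p)) :
    g.inner (i p) v (normalPart g i p w) = g.inner (i p) v w := by
  rw [normalPart, map_sub, hv, sub_zero]

/-- The discarded tangential component is orthogonal to the normal one and has nonnegative square,
so dropping it cannot increase `⟨w, w⟩`. -/
lemma inner_normalPart_self_neg (hsp : IsSpacelike g i) (hσ : IsSmoothMetric (inducedMetric g i))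
    {w : TangentSpace (𝓡 4) (i p)} (hw : g.inner (i p) w w < 0) :
    g.inner (i p) (normalPart g i p w) (normalPart g i p w) < 0 := by
  set X := (inducedMetric g i p).inverse ((g.inner (i p) w).comp (mfderiv (𝓡 2) (𝓡 4) i p)) with hX
  have hn := isNormal_normalPart hσ w
  have hdec : w = normalPart g i p w + mfderiv (𝓡 2) (𝓡 4) i p X := by
    rw [normalPart, sub_add_cancel]
  have hXX : 0 ≤ inducedMetric g i p X X := by
    by_cases h : X = 0
    · rw [h, map_zero]
    · exact (hsp p X h).le
  rw [inducedMetric_apply] at hXX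
  have h1 : g.inner (i p) w w = g.inner (i p) (normalPart g i p w) (normalPart g i p w) +
      g.inner (i p) (mfderiv (𝓡 2) (𝓡 4) i p X) (mfderiv (𝓡 2) (𝓡 4) i p X) := by
    nth_rw 1 2 [hdec]
    simp only [map_add, add_apply]
    rw [g.symm _ (mfderiv (𝓡 2) (𝓡 4) i p X) (normalPart g i p w), hn X]
    ring
  linarith

/-- The component of the time orientation that is normal to the surface and to `e₃`. -/
def timePart (g : LorentzMetric N) (T : TimeOrientation g) (i : S → N)
    (e₃ : ∀ p : S, TangentSpace (𝓡 4) (i p)) (p : S) : TangentSpace (𝓡 4) (i p) :=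
  normalPart g i p (T.field (i p)) -
    g.inner (i p) (normalPart g i p (T.field (i p))) (e₃ p) • e₃ p

variable {e₃ : ∀ p : S, TangentSpace (𝓡 4) (i p)}

lemma inner_timePart_self_neg (hsp : IsSpacelike g i) (hσ : IsSmoothMetric (inducedMetric g i))
    (h33 : g.inner (i p) (e₃ p) (e₃ p) = 1) :
    g.inner (i p) (timePart g T i e₃ p) (timePart g T i e₃ p) < 0 := by
  have h := inner_normalPart_self_neg hsp hσ (T.timelike (i p))
  simp only [timePart, map_sub, map_smul, sub_apply, FunLike.coe_smul, Pi.smul_apply, h33,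
    smul_eq_mul, g.symm _ (e₃ p) (normalPart g i p (T.field (i p)))]
  nlinarith [sq_nonneg (g.inner (i p) (normalPart g i p (T.field (i p))) (e₃ p))]

/-- Existence of `e₄`: the time orientation, projected off the surface and off `e₃`, stays
time-like. It is future-directed because an orthogonal projection `W` of `T` satisfies `⟨W, T⟩ = ⟨W,
W⟩ < 0`. -/
lemma isFutureUnitNormal_timePart (hsp : IsSpacelike g i)
    (hσ : IsSmoothMetric (inducedMetric g i)) (h3 : IsNormal g i p (e₃ p))
    (h33 : g.inner (i p) (e₃ p) (e₃ p) = 1) :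
    IsFutureUnitNormal g T i p (e₃ p)
      ((Real.sqrt (-g.inner (i p) (timePart g T i e₃ p) (timePart g T i e₃ p)))⁻¹ •
        timePart g T i e₃ p) := by
  have hneg := inner_timePart_self_neg (T := T) hsp hσ h33
  set W := timePart g T i e₃ p with hW
  have hn : IsNormal g i p W := (isNormal_normalPart hσ _).sub (h3.smul _)
  have hW3 : g.inner (i p) (e₃ p) W = 0 := by
    rw [hW, timePart, map_sub, map_smul, h33, g.symm _ (e₃ p)]
    simp
  have hWT : g.inner (i p) W (T.field (i p)) = g.inner (i p) W W := by
    rw [← hn.inner_normalPart]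
    nth_rw 3 [hW]
    rw [timePart, map_sub, map_smul, g.symm _ W (e₃ p), hW3]
    simp
  have hs : 0 < Real.sqrt (-g.inner (i p) W W) := Real.sqrt_pos.2 (by linarith)
  refine ⟨hn.smul _, ?_, ?_, ?_⟩
  · rw [map_smul, hW3, smul_zero]
  · simp only [map_smul, FunLike.coe_smul, Pi.smul_apply, smul_eq_mul]
    have := Real.mul_self_sqrt (show 0 ≤ -g.inner (i p) W W by linarith)
    field_simp
    nlinarith
  · simp only [map_smul, FunLike.coe_smul, Pi.smul_apply, smul_eq_mul, hWT]
    exact mul_neg_of_pos_of_neg (inv_pos.2 hs) hneg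

/-- Both vectors lie on the line orthogonal to `e₃` in the normal plane. Their lengths leave only a
sign, and the time orientation fixes it. -/
lemma IsFutureUnitNormal.unique (hsp : IsSpacelike g i) {e₃ e₄ e₄' : TangentSpace (𝓡 4) (i p)}
    (h3 : IsNormal g i p e₃) (h33 : g.inner (i p) e₃ e₃ = 1)
    (h : IsFutureUnitNormal g T i p e₃ e₄) (h' : IsFutureUnitNormal g T i p e₃ e₄') :
    e₄' = e₄ := by
  have hex := IsNormal.expand hsp h'.1 h3 h33 h
  rw [g.symm _ e₄' e₃, h'.2.1, zero_smul, zero_sub] at hex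
  set s := g.inner (i p) e₄' e₄
  have h1 := h'.2.2.1
  have h2 := h'.2.2.2
  rw [hex] at h1 h2
  simp only [map_smul, map_neg, neg_apply, FunLike.coe_smul, Pi.smul_apply, smul_eq_mul,
    h.2.2.1] at h1 h2
  have h3 := h.2.2.2
  have hs : s < 0 := by
    by_contra hs
    push Not at hs
    nlinarith
  have : s = -1 := by nlinarith
  rw [hex, this]
  simp

lemma isFutureUnitNormal_futureUnitNormal (hsp : IsSpacelike g i)
    (hσ : IsSmoothMetric (inducedMetric g i)) (h3 : IsNormal g i p (e₃ p))
    (h33 : g.inner (i p) (e₃ p) (e₃ p) = 1) :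
    IsFutureUnitNormal g T i p (e₃ p) (futureUnitNormal g T i e₃ p) :=
  Classical.epsilon_spec (p := fun e₄ => IsFutureUnitNormal g T i p (e₃ p) e₄)
    ⟨_, isFutureUnitNormal_timePart hsp hσ h3 h33⟩

lemma futureUnitNormal_eq (hsp : IsSpacelike g i)
    (hσ : IsSmoothMetric (inducedMetric g i)) (h3 : IsNormal g i p (e₃ p))
    (h33 : g.inner (i p) (e₃ p) (e₃ p) = 1) {e₄ : TangentSpace (𝓡 4) (i p)}
    (h : IsFutureUnitNormal g T i p (e₃ p) e₄) : futureUnitNormal g T i e₃ p = e₄ :=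
  IsFutureUnitNormal.unique hsp h3 h33 h (isFutureUnitNormal_futureUnitNormal hsp hσ h3 h33)

lemma IsSpacelikeUnitNormal.smoothAlongAt (h : IsSpacelikeUnitNormal g i e₃) (p : S) :
    SmoothAlongAt 2 i e₃ p := h.contMDiff p

/-- The vector selected by `Classical.epsilon` is, by uniqueness, the normalised `timePart`, which
is an explicit smooth expression. -/
lemma smoothAlongAt_futureUnitNormal (T : TimeOrientation g) (hi : ContMDiff (𝓡 2) (𝓡 4) ∞ i)
    (hsp : IsSpacelike g i) (h : IsSpacelikeUnitNormal g i e₃) (p : S) :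
    SmoothAlongAt 2 i (futureUnitNormal g T i e₃) p := by
  have hσ := isSmoothMetric_inducedMetric hi hsp
  have hT : SmoothAlongAt 2 i (fun q => normalPart g i q (T.field (i q))) p :=
    SmoothAlongAt.normalPart hi hσ ((T.contMDiff.comp hi) p)
  have hW : SmoothAlongAt 2 i (timePart g T i e₃) p :=
    hT.sub hi.contMDiffAt (SmoothAlongAt.smul hi.contMDiffAt
      (hT.metric g.isSmoothMetric hi.contMDiffAt (h.smoothAlongAt p)) (h.smoothAlongAt p))
  have hneg := inner_timePart_self_neg (T := T) hsp hσ (h.unit p)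
  have hne : -g.inner (i p) (timePart g T i e₃ p) (timePart g T i e₃ p) ≠ 0 := by linarith
  have hu := ContDiffAt.comp_contMDiffAt (g := fun t : ℝ => (Real.sqrt (-t))⁻¹)
    (f := fun q => g.inner (i q) (timePart g T i e₃ q) (timePart g T i e₃ q))
    (((contDiffAt_id.neg).sqrt hne).inv (Real.sqrt_ne_zero'.2 (by simpa using hneg)))
    (hW.metric g.isSmoothMetric hi.contMDiffAt hW)
  refine (SmoothAlongAt.smul hi.contMDiffAt hu hW).congr (.of_forall fun q => ?_)
  exact futureUnitNormal_eq hsp hσ (h.normal q) (h.unit q)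
    (isFutureUnitNormal_timePart hsp hσ (h.normal q) (h.unit q))

/-- A hyperbolic rotation of a normal frame is a normal frame with the same time orientation. -/
lemma IsFutureUnitNormal.boost (hsp : IsSpacelike g i) (hσ : IsSmoothMetric (inducedMetric g i))
    {e₃ e₄ : TangentSpace (𝓡 4) (i p)} (h3 : IsNormal g i p e₃) (h33 : g.inner (i p) e₃ e₃ = 1)
    (h : IsFutureUnitNormal g T i p e₃ e₄) (t : ℝ) :
    IsFutureUnitNormal g T i p (Real.cosh t • e₃ - Real.sinh t • e₄)
      (Real.cosh t • e₄ - Real.sinh t • e₃) := by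
  have hcs := Real.cosh_sq t
  have h43 : g.inner (i p) e₄ e₃ = 0 := by rw [g.symm, h.2.1]
  refine ⟨(h.1.smul _).sub (h3.smul _), ?_, ?_, ?_⟩
  · simp only [map_sub, map_smul, sub_apply, FunLike.coe_smul, Pi.smul_apply, smul_eq_mul, h33,
      h.2.1, h.2.2.1, h43]
    ring
  · simp only [map_sub, map_smul, sub_apply, FunLike.coe_smul, Pi.smul_apply, smul_eq_mul, h33,
      h.2.1, h.2.2.1, h43]
    nlinarith
  -- The normal part of `T` is `a e₃ - b e₄`. Being time-like it satisfies `a² < b²`, and `b < 0`,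
  -- so `|a| < -b`. Together with `|sinh t| < cosh t` this gives `b cosh t - a sinh t < 0`.
  · set n := normalPart g i p (T.field (i p)) with hn
    have hnn := inner_normalPart_self_neg hsp hσ (T.timelike (i p))
    have hex := IsNormal.expand hsp (isNormal_normalPart hσ (T.field (i p))) h3 h33 h
    rw [g.symm _ _ e₃, g.symm _ _ e₄, h3.inner_normalPart, h.1.inner_normalPart] at hex
    rw [hex] at hnn
    simp only [map_sub, map_smul, sub_apply, FunLike.coe_smul, Pi.smul_apply, smul_eq_mul, h33,
      h.2.1, h.2.2.1, h43] at hnn ⊢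
    have hb := h.2.2.2
    set a := g.inner (i p) e₃ (T.field (i p))
    set b := g.inner (i p) e₄ (T.field (i p))
    have hc := Real.cosh_pos t
    have hab : |a| < -b := abs_lt_of_sq_lt_sq (by nlinarith) (by linarith)
    have hsc : |Real.sinh t| < Real.cosh t := abs_lt_of_sq_lt_sq (by nlinarith) hc.le
    have h1 : -(Real.sinh t * a) ≤ |Real.sinh t| * |a| := by
      rw [← abs_mul]
      exact neg_le_abs _
    have h2 : |Real.sinh t| * |a| ≤ Real.cosh t * |a| :=
      mul_le_mul_of_nonneg_right hsc.le (abs_nonneg a)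
    have h3 : Real.cosh t * |a| < Real.cosh t * -b := mul_lt_mul_of_pos_left hab hc
    linarith

lemma IsSpacelikeUnitNormal.boost (T : TimeOrientation g) (hi : ContMDiff (𝓡 2) (𝓡 4) ∞ i)
    (hsp : IsSpacelike g i) (h : IsSpacelikeUnitNormal g i e₃) {t : S → ℝ}
    (ht : ContMDiff (𝓡 2) 𝓘(ℝ, ℝ) ∞ t) :
    IsSpacelikeUnitNormal g i (fun q =>
      Real.cosh (t q) • e₃ q - Real.sinh (t q) • futureUnitNormal g T i e₃ q) where
  contMDiff p := by
    refine SmoothAlongAt.sub hi.contMDiffAt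
      (SmoothAlongAt.smul hi.contMDiffAt ?_ (h.smoothAlongAt p))
      (SmoothAlongAt.smul hi.contMDiffAt ?_ (smoothAlongAt_futureUnitNormal T hi hsp h p))
    · exact Real.contDiff_cosh.contDiffAt.comp_contMDiffAt (ht p)
    · exact Real.contDiff_sinh.contDiffAt.comp_contMDiffAt (ht p)
  normal p := by
    have h4 := isFutureUnitNormal_futureUnitNormal (T := T) hsp
      (isSmoothMetric_inducedMetric hi hsp) (h.normal p) (h.unit p)
    exact ((h.normal p).smul _).sub (h4.1.smul _)
  unit p := by
    have h4 := isFutureUnitNormal_futureUnitNormal (T := T) hsp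
      (isSmoothMetric_inducedMetric hi hsp) (h.normal p) (h.unit p)
    simp only [map_sub, map_smul, sub_apply, FunLike.coe_smul, Pi.smul_apply, smul_eq_mul,
      h.unit p, h4.2.1, h4.2.2.1, g.symm _ (futureUnitNormal g T i e₃ p) (e₃ p)]
    nlinarith [Real.cosh_sq (t p)]

lemma futureUnitNormal_boost (T : TimeOrientation g) (hi : ContMDiff (𝓡 2) (𝓡 4) ∞ i)
    (hsp : IsSpacelike g i) (h : IsSpacelikeUnitNormal g i e₃) {t : S → ℝ}
    (ht : ContMDiff (𝓡 2) 𝓘(ℝ, ℝ) ∞ t) (p : S) :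
    futureUnitNormal g T i (fun q =>
      Real.cosh (t q) • e₃ q - Real.sinh (t q) • futureUnitNormal g T i e₃ q) p =
      Real.cosh (t p) • futureUnitNormal g T i e₃ p - Real.sinh (t p) • e₃ p := by
  have hσ := isSmoothMetric_inducedMetric hi hsp
  have h4 := isFutureUnitNormal_futureUnitNormal (T := T) hsp hσ (h.normal p) (h.unit p)
  have hb := h.boost T hi hsp ht
  exact futureUnitNormal_eq hsp hσ (hb.normal p) (hb.unit p)
    (h4.boost hsp hσ (h.normal p) (h.unit p) (t p))

/-- The connection form of a hyperbolically rotated frame. -/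
lemma connectionForm_boost (T : TimeOrientation g) (hi : ContMDiff (𝓡 2) (𝓡 4) ∞ i)
    (hsp : IsSpacelike g i) (h : IsSpacelikeUnitNormal g i e₃) {t : S → ℝ}
    (ht : ContMDiff (𝓡 2) 𝓘(ℝ, ℝ) ∞ t) (p : S) (X : TangentSpace (𝓡 2) p) :
    connectionForm g T i (fun q =>
      Real.cosh (t q) • e₃ q - Real.sinh (t q) • futureUnitNormal g T i e₃ q) p X =
      connectionForm g T i e₃ p X + dirDeriv t p X := by
  have hσ := isSmoothMetric_inducedMetric hi hsp
  have h4 : ∀ q, _ := fun q =>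
    isFutureUnitNormal_futureUnitNormal (T := T) hsp hσ (h.normal q) (h.unit q)
  have hs3 := h.smoothAlongAt p
  have hs4 := smoothAlongAt_futureUnitNormal T hi hsp h p
  have htd : MDifferentiableAt (𝓡 2) 𝓘(ℝ, ℝ) t p := (ht p).mdifferentiableAt (by simp)
  have hch : ContMDiffAt (𝓡 2) 𝓘(ℝ, ℝ) ∞ (fun q => Real.cosh (t q)) p :=
    Real.contDiff_cosh.contDiffAt.comp_contMDiffAt (ht p)
  have hsh : ContMDiffAt (𝓡 2) 𝓘(ℝ, ℝ) ∞ (fun q => Real.sinh (t q)) p :=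
    Real.contDiff_sinh.contDiffAt.comp_contMDiffAt (ht p)
  unfold connectionForm
  rw [futureUnitNormal_boost T hi hsp h ht]
  -- Differentiating the constant products of the frame shows that `⟨∇e₃, e₃⟩` and `⟨∇e₄, e₄⟩`
  -- vanish and that `⟨∇e₄, e₃⟩ = -⟨∇e₃, e₄⟩`.
  have hm33 := dirDeriv_metric g.isSmoothMetric hi.contMDiffAt hs3 hs3 X
  have hm34 := dirDeriv_metric g.isSmoothMetric hi.contMDiffAt hs3 hs4 X
  have hm44 := dirDeriv_metric g.isSmoothMetric hi.contMDiffAt hs4 hs4 X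
  simp only [h.unit, (h4 _).2.1, (h4 _).2.2.1, dirDeriv_const] at hm33 hm34 hm44
  have hdc : dirDeriv (fun q => Real.cosh (t q)) p X = Real.sinh (t p) * dirDeriv t p X := by
    rw [dirDeriv_comp (Real.hasDerivAt_cosh (t p)).hasFDerivAt htd]
    simp [mul_comm]
  have hds : dirDeriv (fun q => -Real.sinh (t q)) p X = -(Real.cosh (t p) * dirDeriv t p X) := by
    rw [dirDeriv_comp (B := fun s => -Real.sinh s) (Real.hasDerivAt_sinh (t p)).neg.hasFDerivAt htd]
    simp [mul_comm]
  have hcov : covDerivAlong g.inner i (fun q =>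
      Real.cosh (t q) • e₃ q - Real.sinh (t q) • futureUnitNormal g T i e₃ q) p X =
      (Real.cosh (t p) • covDerivAlong g.inner i e₃ p X
        + (Real.sinh (t p) * dirDeriv t p X) • e₃ p) +
      (-Real.sinh (t p) • covDerivAlong g.inner i (futureUnitNormal g T i e₃) p X
        + (-(Real.cosh (t p) * dirDeriv t p X)) • futureUnitNormal g T i e₃ p) := by
    simp only [sub_eq_add_neg, ← neg_smul]
    rw [covDerivAlong_add _ hi.contMDiffAt (SmoothAlongAt.smul hi.contMDiffAt hch hs3)
      (SmoothAlongAt.smul hi.contMDiffAt hsh.neg hs4),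
      covDerivAlong_smul _ hi.contMDiffAt (hch.mdifferentiableAt (by simp)) hs3,
      covDerivAlong_smul _ hi.contMDiffAt (hsh.neg.mdifferentiableAt (by simp)) hs4, hdc, hds]
  rw [hcov]
  have h43 : g.inner (i p) (futureUnitNormal g T i e₃ p) (e₃ p) = 0 := by
    rw [g.symm, (h4 p).2.1]
  rw [g.symm _ (e₃ p) (covDerivAlong _ _ _ _ _)] at hm33 hm34
  rw [g.symm _ (futureUnitNormal g T i e₃ p) (covDerivAlong _ _ _ _ _)] at hm44
  simp only [map_sub, map_add, map_smul, add_apply, FunLike.coe_smul, Pi.smul_apply,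
    smul_eq_mul, h.unit p, (h4 p).2.1, (h4 p).2.2.1, h43]
  set A := g.inner (i p) (covDerivAlong g.inner i e₃ p X) (e₃ p)
  set B := g.inner (i p) (covDerivAlong g.inner i e₃ p X) (futureUnitNormal g T i e₃ p)
  set C := g.inner (i p) (covDerivAlong g.inner i (futureUnitNormal g T i e₃) p X) (e₃ p)
  set D := g.inner (i p) (covDerivAlong g.inner i (futureUnitNormal g T i e₃) p X)
    (futureUnitNormal g T i e₃ p)
  have hA : A = 0 := by linarith
  have hD : D = 0 := by linarith
  have hC : C = -B := by linarith
  rw [hA, hC, hD]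
  -- Both `B` and `dt(X)` carry the factor `cosh² t - sinh² t = 1`.
  linear_combination (B + dirDeriv t p X) * Real.cosh_sq (t p)

end NormalBundle

/-! ### Weighted divergence on `ℝⁿ` and its behaviour under coordinate changes. -/

section FlatDivergence

variable {n : ℕ}

/-- The trace of an endomorphism of the coordinate space. -/
def flatTrace (L : EuclideanSpace ℝ (Fin n) →L[ℝ] EuclideanSpace ℝ (Fin n)) : ℝ :=
  LinearMap.trace ℝ (EuclideanSpace ℝ (Fin n)) L.toLinearMap

lemma flatTrace_add (L L' : EuclideanSpace ℝ (Fin n) →L[ℝ] EuclideanSpace ℝ (Fin n)) :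
    flatTrace (L + L') = flatTrace L + flatTrace L' := by
  simp [flatTrace]

lemma flatTrace_smul (a : ℝ) (L : EuclideanSpace ℝ (Fin n) →L[ℝ] EuclideanSpace ℝ (Fin n)) :
    flatTrace (a • L) = a * flatTrace L := by
  simp [flatTrace]

lemma flatTrace_comm (L L' : EuclideanSpace ℝ (Fin n) →L[ℝ] EuclideanSpace ℝ (Fin n)) :
    flatTrace (L.comp L') = flatTrace (L'.comp L) :=
  LinearMap.trace_mul_comm ℝ L.toLinearMap L'.toLinearMap

lemma flatTrace_eq_sum (L : EuclideanSpace ℝ (Fin n) →L[ℝ] EuclideanSpace ℝ (Fin n)) :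
    flatTrace L = ∑ a, L (stdVec a) a := by
  rw [flatTrace, LinearMap.trace_eq_matrix_trace ℝ (EuclideanSpace.basisFun (Fin n) ℝ).toBasis,
    Matrix.trace]
  exact Finset.sum_congr rfl fun a _ => by simp [LinearMap.toMatrix_apply]

lemma flatTrace_eq_matrix_trace (L : EuclideanSpace ℝ (Fin n) →L[ℝ] EuclideanSpace ℝ (Fin n)) :
    flatTrace L = (stdMatrix L).trace :=
  flatTrace_eq_sum L

lemma flatTrace_smulRight (η : EuclideanSpace ℝ (Fin n) →L[ℝ] ℝ) (u : EuclideanSpace ℝ (Fin n)) :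
    flatTrace (η.smulRight u) = η u := by
  rw [flatTrace_eq_sum]
  nth_rw 2 [← sum_smul_stdVec u]
  rw [map_sum]
  exact Finset.sum_congr rfl fun a _ => by
    simp only [ContinuousLinearMap.smulRight_apply, PiLp.smul_apply, map_smul, smul_eq_mul]
    ring

lemma flatTrace_fderiv_smul {ρ : EuclideanSpace ℝ (Fin n) → ℝ}
    {X : EuclideanSpace ℝ (Fin n) → EuclideanSpace ℝ (Fin n)} {y : EuclideanSpace ℝ (Fin n)}
    (hρ : DifferentiableAt ℝ ρ y) (hX : DifferentiableAt ℝ X y) :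
    flatTrace (fderiv ℝ (fun z => ρ z • X z) y) =
      ρ y * flatTrace (fderiv ℝ X y) + fderiv ℝ ρ y (X y) := by
  rw [(hρ.hasFDerivAt.fun_smul hX.hasFDerivAt).fderiv, flatTrace_add, flatTrace_smul,
    flatTrace_smulRight]

lemma contDiff_det : ContDiff ℝ ∞
    (fun L : EuclideanSpace ℝ (Fin n) →L[ℝ] EuclideanSpace ℝ (Fin n) => L.det) := by
  simp only [← det_stdMatrix, Matrix.det_apply']
  refine ContDiff.sum fun s _ => contDiff_const.mul (contDiff_prod fun a _ => ?_)
  exact (EuclideanSpace.proj (𝕜 := ℝ) (s a)).contDiff.comp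
    (ContinuousLinearMap.apply ℝ (EuclideanSpace ℝ (Fin n)) (stdVec a)).contDiff

lemma det_comp' (L L' : EuclideanSpace ℝ (Fin n) →L[ℝ] EuclideanSpace ℝ (Fin n)) :
    (L.comp L').det = L.det * L'.det :=
  LinearMap.det_comp L.toLinearMap L'.toLinearMap

/-- Jacobi's formula for the derivative of the determinant. -/
lemma fderiv_det (A : EuclideanSpace ℝ (Fin n) ≃L[ℝ] EuclideanSpace ℝ (Fin n))
    (B : EuclideanSpace ℝ (Fin n) →L[ℝ] EuclideanSpace ℝ (Fin n)) :
    fderiv ℝ (fun L : EuclideanSpace ℝ (Fin n) →L[ℝ] EuclideanSpace ℝ (Fin n) => L.det)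
      A.toContinuousLinearMap B = A.toContinuousLinearMap.det *
        flatTrace (A.symm.toContinuousLinearMap.comp B) := by
  set C := A.symm.toContinuousLinearMap.comp B with hC
  have hAC : B = A.toContinuousLinearMap.comp C := by ext1 u; simp [hC]
  have hd : DifferentiableAt ℝ (fun L : EuclideanSpace ℝ (Fin n) →L[ℝ] EuclideanSpace ℝ (Fin n) =>
      L.det) A.toContinuousLinearMap := contDiff_det.contDiffAt.differentiableAt (by simp)
  have h1 := hd.hasFDerivAt.hasLineDerivAt B
  have h2 : HasDerivAt (fun t : ℝ => (A.toContinuousLinearMap + t • B).det) _ 0 := h1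
  -- Since `A + tB = A(1 + tC)`, the determinant is `det A` times a polynomial `1 + t tr C + t²
  -- q(t)`; only the linear coefficient survives at `t = 0`.
  have h3 : ∀ t : ℝ, (A.toContinuousLinearMap + t • B).det =
      A.toContinuousLinearMap.det * (1 + (stdMatrix C).trace * t +
        (Matrix.det (1 + (Polynomial.X : Polynomial ℝ) •
          (stdMatrix C).map Polynomial.C)).divX.divX.eval t * t ^ 2) := by
    intro t
    have : A.toContinuousLinearMap + t • B =
        A.toContinuousLinearMap.comp (ContinuousLinearMap.id ℝ _ + t • C) := by
      rw [hAC]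
      ext1 u
      simp
    rw [this, det_comp', ← Matrix.det_one_add_smul, ← det_stdMatrix
      (ContinuousLinearMap.id ℝ _ + t • C)]
    congr 2
    ext a b
    simp [stdMatrix, Matrix.one_apply]
  simp only [h3] at h2
  refine h2.unique ?_
  set q := (Matrix.det (1 + (Polynomial.X : Polynomial ℝ) •
          (stdMatrix C).map Polynomial.C)).divX.divX
  have h4 : HasDerivAt (fun t : ℝ => A.toContinuousLinearMap.det * (1 + (stdMatrix C).trace * t +
        q.eval t * t ^ 2)) _ 0 :=
    ((((hasDerivAt_id (0 : ℝ)).const_mul (stdMatrix C).trace).const_add 1).add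
      ((q.hasDerivAt 0).mul (hasDerivAt_pow 2 0))).const_mul _
  exact h4.congr_deriv (by simp [flatTrace_eq_matrix_trace])

/-- The divergence with respect to a density does not depend on the coordinates. -/
lemma flat_divergence_change {ρ ρ' : EuclideanSpace ℝ (Fin n) → ℝ}
    {X X' Φ : EuclideanSpace ℝ (Fin n) → EuclideanSpace ℝ (Fin n)} {y : EuclideanSpace ℝ (Fin n)}
    (hΦ : ContDiffAt ℝ ∞ Φ y) (hΦi : (fderiv ℝ Φ y).IsInvertible)
    (hX : DifferentiableAt ℝ X y) (hX' : DifferentiableAt ℝ X' (Φ y))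
    (hρ' : DifferentiableAt ℝ ρ' (Φ y)) (hne : ρ' (Φ y) ≠ 0)
    (hρ : ∀ᶠ z in 𝓝 y, ρ z = |(fderiv ℝ Φ z).det| * ρ' (Φ z))
    (hXX : ∀ᶠ z in 𝓝 y, X' (Φ z) = fderiv ℝ Φ z (X z)) :
    (ρ y)⁻¹ * flatTrace (fderiv ℝ (fun z => ρ z • X z) y) =
      (ρ' (Φ y))⁻¹ * flatTrace (fderiv ℝ (fun z => ρ' z • X' z) (Φ y)) := by
  obtain ⟨A, hA⟩ := hΦi
  have hD : DifferentiableAt ℝ (fderiv ℝ Φ) y :=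
    (hΦ.fderiv_right (m := ∞) (by simp)).differentiableAt (by simp)
  have hΦd := hΦ.differentiableAt (n := ∞) (by simp)
  have hsym : ∀ a b, fderiv ℝ (fderiv ℝ Φ) y a b = fderiv ℝ (fderiv ℝ Φ) y b a := fun a b =>
    (hΦ.isSymmSndFDerivAt (by simpa using ENat.LEInfty.out)) a b
  have hdet : A.toContinuousLinearMap.det ≠ 0 := A.toLinearEquiv.isUnit_det'.ne_zero
  -- the derivative of the Jacobian determinant
  have hJ : HasFDerivAt (fun z => (fderiv ℝ Φ z).det) _ y :=
    HasFDerivAt.comp (f := fderiv ℝ Φ) y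
      ((contDiff_det (n := n)).contDiffAt.differentiableAt (by simp)).hasFDerivAt hD.hasFDerivAt
  -- The Jacobian determinant has constant sign near `y`. Replacing its absolute value by `ε` times
  -- it makes the relation differentiable, and `ε` cancels in the quotient.
  obtain ⟨ε, hε, hρε⟩ : ∃ ε : ℝ, ε ≠ 0 ∧
      ∀ᶠ z in 𝓝 y, ρ z = ε * ((fderiv ℝ Φ z).det * ρ' (Φ z)) := by
    have hc := hJ.continuousAt
    rcases lt_or_gt_of_ne hdet with h | h
    · refine ⟨-1, by norm_num, ?_⟩
      have h' : (fderiv ℝ Φ y).det < 0 := by rwa [← hA]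
      filter_upwards [hρ, hc.eventually (gt_mem_nhds h')] with z h1 h2
      rw [h1, abs_of_neg h2]
      ring
    · refine ⟨1, by norm_num, ?_⟩
      have h' : 0 < (fderiv ℝ Φ y).det := by rwa [← hA]
      filter_upwards [hρ, hc.eventually (lt_mem_nhds h')] with z h1 h2
      rw [h1, abs_of_pos h2]
      ring
  have hρ'Φ : HasFDerivAt (fun z => ρ' (Φ z)) _ y :=
    HasFDerivAt.comp (g := ρ') (f := Φ) y hρ'.hasFDerivAt hΦd.hasFDerivAt
  have hρd : HasFDerivAt ρ _ y :=
    ((hJ.mul hρ'Φ).const_mul ε).congr_of_eventuallyEq hρε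
  have hρX : fderiv ℝ ρ y (X y) = ε * ((fderiv ℝ Φ y).det * fderiv ℝ ρ' (Φ y) (X' (Φ y)) +
      ρ' (Φ y) * ((fderiv ℝ Φ y).det *
        flatTrace (A.symm.toContinuousLinearMap.comp (fderiv ℝ (fderiv ℝ Φ) y (X y))))) := by
    rw [hρd.fderiv, hXX.self_of_nhds, ← hA, ← fderiv_det, hA]
    simp
    ring
  -- Differentiating `X' ∘ Φ = DΦ X` and using the symmetric Hessian yields an extra trace of `A⁻¹
  -- D²Φ(X)`. By Jacobi's formula the same trace arises from the density, so the two sides balance.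
  have htr : flatTrace (fderiv ℝ X' (Φ y)) = flatTrace (fderiv ℝ X y) +
      flatTrace (A.symm.toContinuousLinearMap.comp (fderiv ℝ (fderiv ℝ Φ) y (X y))) := by
    have h1 : HasFDerivAt (fun z => X' (Φ z)) _ y :=
      HasFDerivAt.comp (g := X') (f := Φ) y hX'.hasFDerivAt hΦd.hasFDerivAt
    have h2 : HasFDerivAt (fun z => X' (Φ z)) _ y :=
      (hD.hasFDerivAt.clm_apply hX.hasFDerivAt).congr_of_eventuallyEq hXX
    have h3 := h1.unique h2
    have h4 : fderiv ℝ X' (Φ y) = (A.toContinuousLinearMap.comp (fderiv ℝ X y) +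
        fderiv ℝ (fderiv ℝ Φ) y (X y)).comp A.symm.toContinuousLinearMap := by
      ext1 u
      have := DFunLike.congr_fun h3 (A.symm u)
      rw [← hA] at this
      simp only [ContinuousLinearMap.comp_apply, ContinuousLinearEquiv.coe_coe,
        ContinuousLinearEquiv.apply_symm_apply, add_apply, ContinuousLinearMap.flip_apply] at this
      rw [this, hsym]
      rfl
    rw [h4, ContinuousLinearMap.add_comp, flatTrace_add, flatTrace_comm,
      flatTrace_comm _ A.symm.toContinuousLinearMap]
    congr 2
    ext1 u
    simp
  have hρy := hρε.self_of_nhds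
  have hdet' : (fderiv ℝ Φ y).det ≠ 0 := by rwa [← hA]
  rw [flatTrace_fderiv_smul hρd.differentiableAt hX, flatTrace_fderiv_smul hρ' hX', hρX, htr, hρy]
  field_simp
  ring

end FlatDivergence

/-! ### Divergence and Laplacian on a Riemannian manifold. -/

section Divergence

variable {n : ℕ} {S : Type*} [TopologicalSpace S] [ChartedSpace (EuclideanSpace ℝ (Fin n)) S]
  [IsManifold (𝓡 n) ∞ S] {σ : BilinField n S}

/-- A smooth Riemannian metric. -/
structure IsRiemannianMetric (σ : BilinField n S) : Prop extends IsSmoothMetric σ where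
  pos : ∀ (x : S) (X : TangentSpace (𝓡 n) x), X ≠ 0 → 0 < σ x X X

lemma chartDensity_eq (σ : BilinField n S) (c : S) (y : EuclideanSpace ℝ (Fin n)) :
    chartDensity σ c y = Real.sqrt (gram (chartMetric σ c y)).det := rfl

lemma det_gram_pos (hσ : IsRiemannianMetric σ) {c q : S}
    (hq : q ∈ (extChartAt (𝓡 n) c).source) :
    0 < (gram (chartMetric σ c (extChartAt (𝓡 n) c q))).det :=
  (gram_chartMetric_posDef hσ.toIsSmoothMetric hσ.pos hq).det_pos

lemma chartDensity_pos (hσ : IsRiemannianMetric σ) {c q : S}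
    (hq : q ∈ (extChartAt (𝓡 n) c).source) : 0 < chartDensity σ c (extChartAt (𝓡 n) c q) :=
  Real.sqrt_pos.2 (det_gram_pos hσ hq)

/-- Gram matrices change by congruence with the Jacobian matrix, so the determinant changes by its
squared determinant; the square root produces the absolute value. -/
lemma chartDensity_change (σ : BilinField n S) {c c' q : S}
    (hq : q ∈ (extChartAt (𝓡 n) c).source) (hq' : q ∈ (extChartAt (𝓡 n) c').source) :
    chartDensity σ c (extChartAt (𝓡 n) c q) =
      |(fderiv ℝ (transition c c') (extChartAt (𝓡 n) c q)).det| *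
        chartDensity σ c' (extChartAt (𝓡 n) c' q) := by
  rw [chartDensity_eq, gram_change σ hq hq', Matrix.det_mul, Matrix.det_mul, Matrix.det_transpose,
    det_stdMatrix, mul_assoc, mul_comm (Matrix.det _), ← mul_assoc, Real.sqrt_mul (mul_self_nonneg _),
    Real.sqrt_mul_self_eq_abs, chartDensity_eq]

lemma contDiffAt_chartDensity (hσ : IsRiemannianMetric σ) {c q : S}
    (hq : q ∈ (extChartAt (𝓡 n) c).source) :
    ContDiffAt ℝ ∞ (chartDensity σ c) (extChartAt (𝓡 n) c q) := by
  have h : ContDiffAt ℝ ∞ (fun y => (gram (chartMetric σ c y)).det) (extChartAt (𝓡 n) c q) := by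
    simp only [Matrix.det_apply']
    refine ContDiffAt.sum fun s _ => contDiffAt_const.mul (contDiffAt_prod fun a _ => ?_)
    exact ((contDiffAt_chartMetric hσ.toIsSmoothMetric hq).clm_apply contDiffAt_const).clm_apply
      contDiffAt_const
  exact h.sqrt (det_gram_pos hσ hq).ne'

/-- The coordinate expression of a vector field in the chart around `c`. -/
def chartField (c : S) (X : ∀ q : S, TangentSpace (𝓡 n) q) (y : EuclideanSpace ℝ (Fin n)) :
    EuclideanSpace ℝ (Fin n) :=
  coord c ((extChartAt (𝓡 n) c).symm y) (X ((extChartAt (𝓡 n) c).symm y))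

lemma chartField_chart {c q : S} (hq : q ∈ (extChartAt (𝓡 n) c).source)
    (X : ∀ q : S, TangentSpace (𝓡 n) q) :
    chartField c X (extChartAt (𝓡 n) c q) = coord c q (X q) := by
  unfold chartField
  rw [(extChartAt (𝓡 n) c).left_inv hq]

lemma contDiffAt_chartField {c q : S} (hq : q ∈ (extChartAt (𝓡 n) c).source)
    {X : ∀ q : S, TangentSpace (𝓡 n) q} (hX : SmoothFieldAt n X q) :
    ContDiffAt ℝ ∞ (chartField c X) (extChartAt (𝓡 n) c q) :=
  contMDiffAt_iff_contDiffAt.1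
    (contMDiffAt_comp_chart_symm hq ((smoothFieldAt_iff hq X).1 hX))

/-- The divergence of a vector field, computed in the chart around `c`. -/
def chartDivergence (σ : BilinField n S) (c : S) (X : ∀ q : S, TangentSpace (𝓡 n) q) (q : S) : ℝ :=
  (chartDensity σ c (extChartAt (𝓡 n) c q))⁻¹ *
    flatTrace (fderiv ℝ (fun y => chartDensity σ c y • chartField c X y) (extChartAt (𝓡 n) c q))

lemma laplacian_eq (σ : BilinField n S) (τ : S → ℝ) (q : S) :
    laplacian σ τ q = chartDivergence σ q (grad σ τ) q := rfl

lemma chartDivergence_change (hσ : IsRiemannianMetric σ) {c c' q : S}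
    (hq : q ∈ (extChartAt (𝓡 n) c).source) (hq' : q ∈ (extChartAt (𝓡 n) c').source)
    {X : ∀ q : S, TangentSpace (𝓡 n) q} (hX : SmoothFieldAt n X q) :
    chartDivergence σ c X q = chartDivergence σ c' X q := by
  have h := transition_chart (n := n) (c' := c') hq
  unfold chartDivergence
  rw [← h]
  refine flat_divergence_change (contDiffAt_transition hq hq')
    (transition_deriv_isInvertible hq hq')
    ((contDiffAt_chartField hq hX).differentiableAt (by simp)) ?_ ?_ ?_ ?_ ?_
  · rw [h]
    exact (contDiffAt_chartField hq' hX).differentiableAt (by simp)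
  · rw [h]
    exact (contDiffAt_chartDensity hσ hq').differentiableAt (by simp)
  · rw [h]
    exact (chartDensity_pos hσ hq').ne'
  · filter_upwards [eventually_overlap hq hq'] with z ⟨q', h1, h2, h3⟩
    rw [← h3, chartDensity_change σ h1 h2, transition_chart h1]
  · filter_upwards [eventually_overlap hq hq'] with z ⟨q', h1, h2, h3⟩
    rw [← h3, transition_chart h1, chartField_chart h1, chartField_chart h2, coord_change h1 h2]

lemma contMDiffAt_chartDivergence (hσ : IsRiemannianMetric σ) {c q : S}
    (hq : q ∈ (extChartAt (𝓡 n) c).source)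
    {X : ∀ q : S, TangentSpace (𝓡 n) q} (hX : SmoothFieldAt n X q) :
    ContMDiffAt (𝓡 n) 𝓘(ℝ, ℝ) ∞ (chartDivergence σ c X) q := by
  have h1 : ContDiffAt ℝ ∞ (fderiv ℝ (fun y => chartDensity σ c y • chartField c X y))
      (extChartAt (𝓡 n) c q) :=
    ((contDiffAt_chartDensity hσ hq).smul (contDiffAt_chartField hq hX)).fderiv_right (by simp)
  have h2 : ContDiffAt ℝ ∞ (fun y => (chartDensity σ c y)⁻¹ *
      flatTrace (fderiv ℝ (fun y => chartDensity σ c y • chartField c X y) y))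
      (extChartAt (𝓡 n) c q) := by
    refine ((contDiffAt_chartDensity hσ hq).inv (chartDensity_pos hσ hq).ne').mul ?_
    simp only [flatTrace_eq_sum]
    exact ContDiffAt.sum fun a _ => (EuclideanSpace.proj (𝕜 := ℝ) a).contDiff.contDiffAt.comp _
      (h1.clm_apply contDiffAt_const)
  exact h2.comp_contMDiffAt (contMDiffAt_chart hq)

lemma chartDivergence_smul (hσ : IsRiemannianMetric σ) {c q : S}
    (hq : q ∈ (extChartAt (𝓡 n) c).source) {u : S → ℝ} (hu : ContMDiffAt (𝓡 n) 𝓘(ℝ, ℝ) ∞ u q)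
    {X : ∀ q : S, TangentSpace (𝓡 n) q} (hX : SmoothFieldAt n X q) :
    chartDivergence σ c (fun q => u q • X q) q =
      u q * chartDivergence σ c X q + dirDeriv u q (X q) := by
  have hρ := (chartDensity_pos hσ hq).ne'
  have h1 : (fun y => chartDensity σ c y • chartField c (fun q => u q • X q) y) =
      fun y => (u ∘ (extChartAt (𝓡 n) c).symm) y • (chartDensity σ c y • chartField c X y) := by
    funext y
    simp only [chartField, map_smul, Function.comp_apply]
    rw [smul_comm]
  have hu' : DifferentiableAt ℝ (u ∘ (extChartAt (𝓡 n) c).symm) (extChartAt (𝓡 n) c q) :=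
    (contMDiffAt_iff_contDiffAt.1 (contMDiffAt_comp_chart_symm hq hu)).differentiableAt (by simp)
  have hd := mfderiv_eq_coord hq (hu.mdifferentiableAt (by simp)) (X q)
  have hY : DifferentiableAt ℝ (fun y => chartDensity σ c y • chartField c X y)
      (extChartAt (𝓡 n) c q) := ((contDiffAt_chartDensity hσ hq).smul
    (contDiffAt_chartField hq hX)).differentiableAt (by simp)
  unfold chartDivergence
  rw [h1, flatTrace_fderiv_smul hu' hY, map_smul, chartField_chart hq,
    ← hd, Function.comp_apply, (extChartAt (𝓡 n) c).left_inv hq]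
  change _ * (_ + _ * dirDeriv u q (X q)) = _
  field_simp

lemma smoothFieldAt_grad (hσ : IsSmoothMetric σ) {τ : S → ℝ} (hτ : ContMDiff (𝓡 n) 𝓘(ℝ, ℝ) ∞ τ)
    (p : S) : SmoothFieldAt n (grad σ τ) p :=
  smoothFieldAt_inverse hσ fun u => contMDiffAt_mfderiv_apply (hτ p)
    (smoothFieldAt_frame (mem_extChartAt_source p) u)

lemma inner_grad (hσ : IsSmoothMetric σ) (τ : S → ℝ) (p : S) (X : TangentSpace (𝓡 n) p) :
    σ p (grad σ τ p) X = dirDeriv τ p X :=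
  DFunLike.congr_fun (apply_inverse_of_isInvertible (hσ.isInvertible p)
    (mfderiv (𝓡 n) 𝓘(ℝ, ℝ) τ p : TangentSpace (𝓡 n) p →L[ℝ] ℝ)) X

/-- The chart in the definition moves with the point; near `p` it is exchanged for the one at `p`.
-/
lemma contMDiff_laplacian (hσ : IsRiemannianMetric σ) {τ : S → ℝ}
    (hτ : ContMDiff (𝓡 n) 𝓘(ℝ, ℝ) ∞ τ) : ContMDiff (𝓡 n) 𝓘(ℝ, ℝ) ∞ (laplacian σ τ) := by
  intro p
  have h0 := mem_extChartAt_source (I := 𝓡 n) p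
  have hg := smoothFieldAt_grad hσ.toIsSmoothMetric hτ
  refine (contMDiffAt_chartDivergence hσ h0 (hg p)).congr_of_eventuallyEq ?_
  filter_upwards [extChartAt_source_mem_nhds' (I := 𝓡 n) h0] with q hq
  rw [laplacian_eq]
  exact chartDivergence_change hσ (mem_extChartAt_source q) hq (hg q)

end Divergence

/-! ### The Riemannian measure on chart domains. -/

section ChartMeasure

variable {n : ℕ} {S : Type*} [TopologicalSpace S] [ChartedSpace (EuclideanSpace ℝ (Fin n)) S]
  [IsManifold (𝓡 n) ∞ S] [MeasurableSpace S] [BorelSpace S] {σ : BilinField n S}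

/-- The Riemannian measure of the domain of the chart around `c`. -/
def chartMeasure (σ : BilinField n S) (c : S) : Measure S :=
  Measure.map (extChartAt (𝓡 n) c).symm
    ((volume.restrict (extChartAt (𝓡 n) c).target).withDensity
      fun y => ENNReal.ofReal (chartDensity σ c y))

lemma chartDensity_nonneg (σ : BilinField n S) (c : S) (y : EuclideanSpace ℝ (Fin n)) :
    0 ≤ chartDensity σ c y :=
  Real.sqrt_nonneg _

lemma chartMeasure_le_volumeMeasure (σ : BilinField n S) (c : S) :
    chartMeasure σ c ≤ volumeMeasure σ :=
  le_iSup (chartMeasure σ) c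

lemma measurableSet_extChartAt_target (c : S) : MeasurableSet (extChartAt (𝓡 n) c).target :=
  (isOpen_extChartAt_target c).measurableSet

lemma measurableSet_extChartAt_source (c : S) : MeasurableSet (extChartAt (𝓡 n) c).source :=
  (isOpen_extChartAt_source c).measurableSet

lemma aemeasurable_chart_symm (σ : BilinField n S) (c : S) :
    AEMeasurable (extChartAt (𝓡 n) c).symm
      ((volume.restrict (extChartAt (𝓡 n) c).target).withDensity
        fun y => ENNReal.ofReal (chartDensity σ c y)) :=
  ((continuousOn_extChartAt_symm c).aemeasurable
    (measurableSet_extChartAt_target c)).mono_ac (withDensity_absolutelyContinuous _ _)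

lemma continuousOn_chartDensity (hσ : IsRiemannianMetric σ) (c : S) :
    ContinuousOn (chartDensity σ c) (extChartAt (𝓡 n) c).target := by
  intro y hy
  have h := (contDiffAt_chartDensity hσ ((extChartAt (𝓡 n) c).map_target hy)).continuousAt
  rw [(extChartAt (𝓡 n) c).right_inv hy] at h
  exact h.continuousWithinAt

lemma chartMeasure_apply (σ : BilinField n S) (c : S) {A : Set S} (hA : MeasurableSet A) :
    chartMeasure σ c A = ∫⁻ y in (extChartAt (𝓡 n) c).symm ⁻¹' A ∩ (extChartAt (𝓡 n) c).target,
      ENNReal.ofReal (chartDensity σ c y) := by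
  rw [chartMeasure, Measure.map_apply_of_aemeasurable (aemeasurable_chart_symm σ c) hA,
    withDensity_apply', Measure.restrict_restrict' (measurableSet_extChartAt_target c)]

lemma measurableSet_preimage_chart_symm (c : S) {A : Set S} (hA : MeasurableSet A) :
    MeasurableSet ((extChartAt (𝓡 n) c).symm ⁻¹' A ∩ (extChartAt (𝓡 n) c).target) := by
  have h := (continuousOn_iff_continuous_domRestrict.1
    (continuousOn_extChartAt_symm (I := 𝓡 n) c)).measurable hA
  have h' := (measurableSet_extChartAt_target (n := n) c).subtype_image h
  convert h' using 1
  ext y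
  simp [and_comm]

lemma chartMeasure_compl_source (σ : BilinField n S) (c : S) :
    chartMeasure σ c (extChartAt (𝓡 n) c).sourceᶜ = 0 := by
  rw [chartMeasure_apply σ c (measurableSet_extChartAt_source c).compl]
  have h : (extChartAt (𝓡 n) c).symm ⁻¹' (extChartAt (𝓡 n) c).sourceᶜ ∩
      (extChartAt (𝓡 n) c).target = ∅ := by
    ext y
    simp only [Set.mem_inter_iff, Set.mem_preimage, Set.mem_compl_iff, Set.mem_empty_iff_false,
      iff_false, not_and]
    exact fun h hy => h ((extChartAt (𝓡 n) c).map_target hy)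
  rw [h, Measure.restrict_empty, lintegral_zero_measure]

lemma chartMeasure_inter_source (σ : BilinField n S) (c : S) (A : Set S) :
    chartMeasure σ c (A ∩ (extChartAt (𝓡 n) c).source) = chartMeasure σ c A :=
  measure_inter_conull' (measure_mono_null (fun _ h => h.2) (chartMeasure_compl_source σ c))

/-- This is the change of variables formula for the transition map, whose Jacobian factor is exactly
the one relating the densities. -/
lemma chartMeasure_overlap (σ : BilinField n S) {c c' : S} {A : Set S} (hA : MeasurableSet A)
    (hc : A ⊆ (extChartAt (𝓡 n) c).source) (hc' : A ⊆ (extChartAt (𝓡 n) c').source) :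
    chartMeasure σ c A = chartMeasure σ c' A := by
  set s := (extChartAt (𝓡 n) c).symm ⁻¹' A ∩ (extChartAt (𝓡 n) c).target with hs
  have hpt : ∀ y ∈ s, ∃ q ∈ A, extChartAt (𝓡 n) c q = y ∧
      transition c c' y = extChartAt (𝓡 n) c' q := fun y hy =>
    ⟨_, hy.1, (extChartAt (𝓡 n) c).right_inv hy.2, rfl⟩
  have himage : transition c c' '' s =
      (extChartAt (𝓡 n) c').symm ⁻¹' A ∩ (extChartAt (𝓡 n) c').target := by
    ext z
    constructor
    · rintro ⟨y, hy, rfl⟩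
      obtain ⟨q, hq, -, h⟩ := hpt y hy
      rw [h]
      refine ⟨?_, (extChartAt (𝓡 n) c').map_source (hc' hq)⟩
      rwa [Set.mem_preimage, (extChartAt (𝓡 n) c').left_inv (hc' hq)]
    · rintro ⟨h1, h2⟩
      have h1' : (extChartAt (𝓡 n) c').symm z ∈ A := h1
      refine ⟨extChartAt (𝓡 n) c ((extChartAt (𝓡 n) c').symm z),
        ⟨?_, (extChartAt (𝓡 n) c).map_source (hc h1')⟩, ?_⟩
      · rwa [Set.mem_preimage, (extChartAt (𝓡 n) c).left_inv (hc h1')]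
      · rw [transition_chart (hc h1'), (extChartAt (𝓡 n) c').right_inv h2]
  have hsm : MeasurableSet s := measurableSet_preimage_chart_symm c hA
  rw [chartMeasure_apply σ c hA, chartMeasure_apply σ c' hA, ← himage,
    lintegral_image_eq_lintegral_abs_det_fderiv_mul volume hsm
      (f' := fun y => fderiv ℝ (transition c c') y)]
  · refine setLIntegral_congr_fun hsm fun y hy => ?_
    obtain ⟨q, hq, rfl, h⟩ := hpt y hy
    rw [h, chartDensity_change σ (hc hq) (hc' hq), ENNReal.ofReal_mul (abs_nonneg _)]
  · intro y hy
    obtain ⟨q, hq, rfl, h⟩ := hpt y hy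
    exact ((contDiffAt_transition (hc hq) (hc' hq)).differentiableAt
      (by simp)).hasFDerivAt.hasFDerivWithinAt
  · intro y hy z hz hyz
    obtain ⟨q, hq, rfl, h⟩ := hpt y hy
    obtain ⟨r, hr, rfl, h'⟩ := hpt z hz
    rw [h, h'] at hyz
    rw [(extChartAt (𝓡 n) c').injOn (hc' hq) (hc' hr) hyz]

/-- A supremum of measures is not computed set by set, so its value is controlled through an upper
bound: every chart measure agrees with that of `c` inside the domain of `c` and is at most the total
measure outside. -/
lemma volumeMeasure_le (σ : BilinField n S) (c : S) :
    volumeMeasure σ ≤ chartMeasure σ c +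
      (volumeMeasure σ).restrict (extChartAt (𝓡 n) c).sourceᶜ := by
  refine iSup_le fun c' => Measure.le_iff.2 fun B hB => ?_
  change chartMeasure σ c' B ≤ _
  have hm := measurableSet_extChartAt_source (n := n) c
  rw [← measure_inter_add_sdiff B hm, Measure.add_apply, Measure.restrict_apply hB]
  refine add_le_add ?_ (chartMeasure_le_volumeMeasure σ c' _)
  rw [← chartMeasure_inter_source, chartMeasure_overlap σ (c' := c)
    ((hB.inter hm).inter (measurableSet_extChartAt_source c')) (fun _ h => h.2) (fun _ h => h.1.2)]
  exact measure_mono fun _ h => h.1.1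

lemma volumeMeasure_apply (σ : BilinField n S) (c : S) {A : Set S} (hA : MeasurableSet A)
    (hc : A ⊆ (extChartAt (𝓡 n) c).source) : volumeMeasure σ A = chartMeasure σ c A := by
  refine le_antisymm ((volumeMeasure_le σ c A).trans ?_) (chartMeasure_le_volumeMeasure σ c A)
  rw [Measure.add_apply, Measure.restrict_apply hA, (Set.disjoint_compl_right_iff_subset.2 hc).inter_eq,
    measure_empty, add_zero]

lemma volumeMeasure_restrict_source (σ : BilinField n S) (c : S) :
    (volumeMeasure σ).restrict (extChartAt (𝓡 n) c).source = chartMeasure σ c := by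
  ext B hB
  rw [Measure.restrict_apply hB, volumeMeasure_apply σ c
    (hB.inter (measurableSet_extChartAt_source c)) Set.inter_subset_right,
    chartMeasure_inter_source]

/-- In a chart the density is continuous, hence bounded on a small ball, and the ball has finite
Lebesgue measure. -/
lemma isLocallyFiniteMeasure_volumeMeasure (hσ : IsRiemannianMetric σ) :
    IsLocallyFiniteMeasure (volumeMeasure σ) := by
  refine ⟨fun p => ?_⟩
  have hp := mem_extChartAt_source (I := 𝓡 n) p
  have h1 : ∀ᶠ y in 𝓝 (extChartAt (𝓡 n) p p),
      chartDensity σ p y < chartDensity σ p (extChartAt (𝓡 n) p p) + 1 :=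
    (contDiffAt_chartDensity hσ hp).continuousAt.eventually_lt continuousAt_const (by simp)
  obtain ⟨r, hr, hball⟩ := Metric.eventually_nhds_iff_ball.1 h1
  set C := chartDensity σ p (extChartAt (𝓡 n) p p) + 1
  have hU : IsOpen ((extChartAt (𝓡 n) p).source ∩
      extChartAt (𝓡 n) p ⁻¹' Metric.ball (extChartAt (𝓡 n) p p) r) :=
    isOpen_extChartAt_preimage' p Metric.isOpen_ball
  refine ⟨_, hU.mem_nhds ⟨hp, Metric.mem_ball_self hr⟩, ?_⟩
  rw [volumeMeasure_apply σ p hU.measurableSet Set.inter_subset_left,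
    chartMeasure_apply σ p hU.measurableSet]
  calc _ ≤ ∫⁻ y in Metric.ball (extChartAt (𝓡 n) p p) r,
        ENNReal.ofReal (chartDensity σ p y) := by
        refine lintegral_mono_set fun y hy => ?_
        have h := hy.1.2
        rwa [Set.mem_preimage, (extChartAt (𝓡 n) p).right_inv hy.2] at h
    _ ≤ ∫⁻ y in Metric.ball (extChartAt (𝓡 n) p p) r, ENNReal.ofReal C :=
        setLIntegral_mono' measurableSet_ball fun y hy => ENNReal.ofReal_le_ofReal (hball y hy).le
    _ < ⊤ := by
        rw [setLIntegral_const]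
        exact ENNReal.mul_lt_top ENNReal.ofReal_lt_top measure_ball_lt_top

lemma integrable_of_continuous [CompactSpace S] (hσ : IsRiemannianMetric σ) {f : S → ℝ}
    (hf : Continuous f) : Integrable f (volumeMeasure σ) := by
  have := isLocallyFiniteMeasure_volumeMeasure hσ
  exact hf.integrable_of_hasCompactSupport (HasCompactSupport.of_compactSpace f)

lemma setIntegral_chart_source (hσ : IsRiemannianMetric σ) (c : S) {f : S → ℝ}
    (hf : Continuous f) :
    ∫ q in (extChartAt (𝓡 n) c).source, f q ∂volumeMeasure σ =
      ∫ y in (extChartAt (𝓡 n) c).target,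
        chartDensity σ c y * f ((extChartAt (𝓡 n) c).symm y) := by
  have hd : AEMeasurable (fun y => ENNReal.ofReal (chartDensity σ c y))
      (volume.restrict (extChartAt (𝓡 n) c).target) :=
    ((continuousOn_chartDensity hσ c).aemeasurable
      (measurableSet_extChartAt_target c)).ennreal_ofReal
  rw [volumeMeasure_restrict_source, chartMeasure, integral_map (aemeasurable_chart_symm σ c)
    hf.stronglyMeasurable.aestronglyMeasurable, integral_withDensity_eq_integral_toReal_smul₀ hd
    (Filter.Eventually.of_forall fun _ => ENNReal.ofReal_lt_top)]
  refine integral_congr_ae (Filter.Eventually.of_forall fun y => ?_)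
  simp only [smul_eq_mul]
  rw [ENNReal.toReal_ofReal (chartDensity_nonneg σ c y)]

end ChartMeasure

/-! ### The divergence theorem on `ℝⁿ`. -/

section FlatDivergenceTheorem

variable {n : ℕ}

lemma integral_flatTrace_fderiv {Z : EuclideanSpace ℝ (Fin n) → EuclideanSpace ℝ (Fin n)}
    (hZ : ContDiff ℝ 1 Z) (hc : HasCompactSupport Z) : ∫ y, flatTrace (fderiv ℝ Z y) = 0 := by
  have hz : ∀ a : Fin n, ContDiff ℝ 1 fun y => Z y a := fun a =>
    (EuclideanSpace.proj (𝕜 := ℝ) a).contDiff.comp hZ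
  have hcz : ∀ a : Fin n, HasCompactSupport fun y => Z y a := fun a =>
    hc.comp_left (g := fun v : EuclideanSpace ℝ (Fin n) => v a) rfl
  have hd : ∀ (a : Fin n) (y v : EuclideanSpace ℝ (Fin n)),
      fderiv ℝ (fun y => Z y a) y v = fderiv ℝ Z y v a := by
    intro a y v
    have := ((EuclideanSpace.proj (𝕜 := ℝ) a).hasFDerivAt.comp y
      (hZ.differentiable one_ne_zero y).hasFDerivAt).fderiv
    exact DFunLike.congr_fun this v
  have hcont : ∀ (a : Fin n) (v : EuclideanSpace ℝ (Fin n)),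
      Integrable fun y => fderiv ℝ (fun y => Z y a) y v := fun a v =>
    (((hz a).continuous_fderiv one_ne_zero).clm_apply
      continuous_const).integrable_of_hasCompactSupport ((hcz a).fderiv_apply (𝕜 := ℝ) v)
  have h0 : ∀ (a : Fin n) (v : EuclideanSpace ℝ (Fin n)),
      ∫ y, fderiv ℝ (fun y => Z y a) y v = 0 := by
    intro a v
    -- Integration by parts against the constant function `1`.
    have := integral_mul_fderiv_eq_neg_fderiv_mul_of_integrable (μ := volume)
      (f := fun _ : EuclideanSpace ℝ (Fin n) => (1 : ℝ)) (g := fun y => Z y a) (v := v)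
      (by simp) (by simpa using hcont a v)
      (by simpa using (hz a).continuous.integrable_of_hasCompactSupport (hcz a))
      (fun _ _ => differentiableAt_const _) (fun _ _ => (hz a).differentiable one_ne_zero _)
    simpa using this
  simp only [flatTrace_eq_sum, ← hd]
  rw [integral_finsetSum _ fun a _ => hcont a _]
  exact Finset.sum_eq_zero fun a _ => h0 a _

end FlatDivergenceTheorem

/-! ### The divergence theorem and Green's identity on a closed manifold. -/

section DivergenceTheorem

variable {n : ℕ} {S : Type*} [TopologicalSpace S] [ChartedSpace (EuclideanSpace ℝ (Fin n)) S]
  [IsManifold (𝓡 n) ∞ S] {σ : BilinField n S}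

/-- The divergence of a vector field. -/
def divergence (σ : BilinField n S) (X : ∀ q : S, TangentSpace (𝓡 n) q) (q : S) : ℝ :=
  chartDivergence σ q X q

lemma divergence_eq (hσ : IsRiemannianMetric σ) {c q : S}
    (hq : q ∈ (extChartAt (𝓡 n) c).source) {X : ∀ q : S, TangentSpace (𝓡 n) q}
    (hX : SmoothFieldAt n X q) : divergence σ X q = chartDivergence σ c X q :=
  chartDivergence_change hσ (mem_extChartAt_source q) hq hX

lemma contMDiff_divergence (hσ : IsRiemannianMetric σ) {X : ∀ q : S, TangentSpace (𝓡 n) q}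
    (hX : ∀ q, SmoothFieldAt n X q) : ContMDiff (𝓡 n) 𝓘(ℝ, ℝ) ∞ (divergence σ X) := by
  intro p
  have h0 := mem_extChartAt_source (I := 𝓡 n) p
  refine (contMDiffAt_chartDivergence hσ h0 (hX p)).congr_of_eventuallyEq ?_
  filter_upwards [extChartAt_source_mem_nhds' (I := 𝓡 n) h0] with q hq
  exact divergence_eq hσ hq (hX q)

lemma divergence_smul (hσ : IsRiemannianMetric σ) {u : S → ℝ}
    (hu : ContMDiff (𝓡 n) 𝓘(ℝ, ℝ) ∞ u) {X : ∀ q : S, TangentSpace (𝓡 n) q}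
    (hX : ∀ q, SmoothFieldAt n X q) (q : S) :
    divergence σ (fun q => u q • X q) q = u q * divergence σ X q + dirDeriv u q (X q) :=
  chartDivergence_smul hσ (mem_extChartAt_source q) (hu q) (hX q)

lemma dirDeriv_sum {ι : Type*} (s : Finset ι) {u : ι → S → ℝ} {q : S}
    (hu : ∀ j ∈ s, ContMDiffAt (𝓡 n) 𝓘(ℝ, ℝ) ∞ (u j) q) (X : TangentSpace (𝓡 n) q) :
    dirDeriv (fun q => ∑ j ∈ s, u j q) q X = ∑ j ∈ s, dirDeriv (u j) q X := by
  classical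
  induction s using Finset.induction_on with
  | empty => simpa using dirDeriv_const (0 : ℝ) X
  | insert a s ha ih =>
    have hs : ∀ j ∈ s, ContMDiffAt (𝓡 n) 𝓘(ℝ, ℝ) ∞ (u j) q :=
      fun j hj => hu j (Finset.mem_insert_of_mem hj)
    simp only [Finset.sum_insert ha]
    rw [dirDeriv_add ((hu a (Finset.mem_insert_self a s)).mdifferentiableAt (by simp))
      ((contMDiffAt_finsetSum hs).mdifferentiableAt (by simp)), ih hs]

variable [MeasurableSpace S] [BorelSpace S]

/-- In the chart, density times divergence is the flat divergence of the density times the field.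
That product extends by zero to a smooth compactly supported field on `ℝⁿ`. -/
lemma integral_divergence_of_support_subset (hσ : IsRiemannianMetric σ) (c : S)
    {Y : ∀ q : S, TangentSpace (𝓡 n) q} (hY : ∀ q, SmoothFieldAt n Y q) {K : Set S}
    (hK : IsCompact K) (hKc : K ⊆ (extChartAt (𝓡 n) c).source) (hYK : ∀ q ∉ K, Y q = 0)
    (hdiv : ∀ q ∉ K, divergence σ Y q = 0) :
    ∫ q, divergence σ Y q ∂volumeMeasure σ = 0 := by
  set ψ := extChartAt (𝓡 n) c with hψ
  set Z : EuclideanSpace ℝ (Fin n) → EuclideanSpace ℝ (Fin n) :=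
    ψ.target.indicator fun y => chartDensity σ c y • chartField c Y y with hZ
  have hopen : IsOpen ψ.target := isOpen_extChartAt_target c
  have hKi : IsCompact (ψ '' K) := hK.image_of_continuousOn
    ((continuousOn_extChartAt c).mono hKc)
  have hZ0 : ∀ y ∉ ψ '' K, Z y = 0 := by
    intro y hy
    by_cases hyt : y ∈ ψ.target
    · rw [hZ, Set.indicator_of_mem hyt, chartField, hYK, map_zero, smul_zero]
      exact fun h => hy ⟨_, h, ψ.right_inv hyt⟩
    · exact Set.indicator_of_notMem hyt _
  have heq : ∀ y ∈ ψ.target, Z =ᶠ[𝓝 y] fun y => chartDensity σ c y • chartField c Y y := by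
    intro y hy
    filter_upwards [hopen.mem_nhds hy] with z hz
    exact Set.indicator_of_mem hz _
  have hsub : ψ '' K ⊆ ψ.target := by
    rintro _ ⟨q, hq, rfl⟩
    exact ψ.map_source (hKc hq)
  -- The compact set `ψ '' K` lies inside the target, so `Z` vanishes near every point outside the
  -- target; this makes the extension by zero smooth.
  have hout : ∀ y ∉ ψ.target, Z =ᶠ[𝓝 y] fun _ => 0 := by
    intro y hy
    filter_upwards [hKi.isClosed.isOpen_compl.mem_nhds fun h => hy (hsub h)] with z hz
    exact hZ0 z hz
  have hsmooth : ContDiff ℝ ∞ Z := by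
    rw [contDiff_iff_contDiffAt]
    intro y
    by_cases hy : y ∈ ψ.target
    · refine ContDiffAt.congr_of_eventuallyEq ?_ (heq y hy)
      have hq := ψ.map_target hy
      have h := (contDiffAt_chartDensity hσ hq).smul (contDiffAt_chartField hq (hY _))
      rwa [← hψ, ψ.right_inv hy] at h
    · exact contDiffAt_const.congr_of_eventuallyEq (hout y hy)
  have hcs : HasCompactSupport Z := HasCompactSupport.intro hKi hZ0
  rw [← setIntegral_eq_integral_of_forall_compl_eq_zero (s := ψ.source)
    (fun q hq => hdiv q fun h => hq (hKc h)),
    setIntegral_chart_source hσ c (contMDiff_divergence hσ hY).continuous,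
    ← integral_flatTrace_fderiv (hsmooth.of_le (by simp)) hcs,
    ← setIntegral_eq_integral_of_forall_compl_eq_zero (s := ψ.target) (f := fun y =>
      flatTrace (fderiv ℝ Z y))]
  · refine setIntegral_congr_fun hopen.measurableSet fun y hy => ?_
    have hq := ψ.map_target hy
    have h := chartDensity_pos hσ hq
    rw [divergence_eq hσ hq (hY _), (heq y hy).fderiv_eq, chartDivergence]
    rw [← hψ, ψ.right_inv hy] at h ⊢
    rw [mul_inv_cancel_left₀ h.ne']
  · intro y hy
    rw [(hout y hy).fderiv_eq]
    simp [flatTrace_eq_sum]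

/-- A partition of unity subordinate to finitely many charts splits the field into pieces, each
supported in a single chart. -/
lemma integral_divergence [T2Space S] [CompactSpace S] (hσ : IsRiemannianMetric σ)
    {X : ∀ q : S, TangentSpace (𝓡 n) q} (hX : ∀ q, SmoothFieldAt n X q) :
    ∫ q, divergence σ X q ∂volumeMeasure σ = 0 := by
  obtain ⟨t, ht⟩ := CompactSpace.elim_nhds_subcover
    (fun x : S => (extChartAt (𝓡 n) x).source) fun x => extChartAt_source_mem_nhds x
  obtain ⟨f, hf⟩ := SmoothPartitionOfUnity.exists_isSubordinate (𝓡 n) isClosed_univ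
    (fun x : t => (extChartAt (𝓡 n) (x : S)).source) (fun x => isOpen_extChartAt_source _)
    (by
      intro x _
      have hx : x ∈ ⋃ x ∈ t, (extChartAt (𝓡 n) x).source := by rw [ht]; trivial
      simpa using hx)
  have hfs : ∀ j : t, ContMDiff (𝓡 n) 𝓘(ℝ, ℝ) ∞ (f j) := fun j => (f j).contMDiff
  have hfX : ∀ (j : t) (q : S), SmoothFieldAt n (fun q => f j q • X q) q := fun j q =>
    SmoothAlongAt.smul contMDiffAt_id (hfs j q) (hX q)
  have hsum : ∀ q, ∑ j : t, f j q = 1 := fun q => by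
    rw [← finsum_eq_sum_of_fintype]
    exact f.sum_eq_one (Set.mem_univ q)
  -- The differentials of the partition functions add up to the differential of the constant `1`.
  have hdsum : ∀ q, ∑ j : t, dirDeriv (f j) q (X q) = 0 := by
    intro q
    rw [← dirDeriv_sum _ (fun j _ => hfs j q), dirDeriv_congr (Filter.Eventually.of_forall hsum),
      dirDeriv_const]
  have hdiv : ∀ q, divergence σ X q = ∑ j : t, divergence σ (fun q => f j q • X q) q := by
    intro q
    simp only [divergence_smul hσ (hfs _) hX, Finset.sum_add_distrib, ← Finset.sum_mul, hsum,
      hdsum, one_mul, add_zero]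
  have hint : ∀ j : t, Integrable (divergence σ fun q => f j q • X q) (volumeMeasure σ) :=
    fun j => integrable_of_continuous hσ (contMDiff_divergence hσ (hfX j)).continuous
  simp only [hdiv]
  rw [integral_finsetSum _ fun j _ => hint j]
  refine Finset.sum_eq_zero fun j _ => ?_
  have h0 : ∀ q ∉ tsupport (f j), f j =ᶠ[𝓝 q] fun _ => 0 := fun q hq =>
    notMem_tsupport_iff_eventuallyEq.1 hq
  refine integral_divergence_of_support_subset hσ j (hfX j) (isClosed_tsupport (f j)).isCompact
    (hf j) (fun q hq => ?_) (fun q hq => ?_)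
  · rw [(h0 q hq).eq_of_nhds, zero_smul]
  · rw [divergence_smul hσ (hfs j) hX, (h0 q hq).eq_of_nhds, zero_mul, zero_add,
      dirDeriv_congr (h0 q hq), dirDeriv_const]

/-- Green's first identity on a closed Riemannian manifold. -/
lemma integral_mul_laplacian_add [T2Space S] [CompactSpace S] (hσ : IsRiemannianMetric σ)
    {u τ : S → ℝ} (hu : ContMDiff (𝓡 n) 𝓘(ℝ, ℝ) ∞ u) (hτ : ContMDiff (𝓡 n) 𝓘(ℝ, ℝ) ∞ τ) :
    ∫ q, (u q * laplacian σ τ q + dirDeriv u q (grad σ τ q)) ∂volumeMeasure σ = 0 := by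
  have hg := smoothFieldAt_grad hσ.toIsSmoothMetric hτ
  rw [← integral_divergence hσ (X := fun q => u q • grad σ τ q)
    fun q => SmoothAlongAt.smul contMDiffAt_id (hu q) (hg q)]
  refine integral_congr_ae (Filter.Eventually.of_forall fun q => ?_)
  exact (divergence_smul hσ hu hg q).symm

end DivergenceTheorem

/-! ### Boosts of the base frame and the variational inequality. -/

section Gauge

variable {N : Type*} [TopologicalSpace N] [ChartedSpace (EuclideanSpace ℝ (Fin 4)) N]
  [IsManifold (𝓡 4) ∞ N]
  {S : Type*} [TopologicalSpace S] [ChartedSpace (EuclideanSpace ℝ (Fin 2)) S]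
  [IsManifold (𝓡 2) ∞ S] {g : LorentzMetric N} {T : TimeOrientation g} {i : S → N} {τ : S → ℝ}

lemma isRiemannianMetric_inducedMetric (hi : ContMDiff (𝓡 2) (𝓡 4) ∞ i) (hsp : IsSpacelike g i) :
    IsRiemannianMetric (inducedMetric g i) :=
  ⟨isSmoothMetric_inducedMetric hi hsp, hsp⟩

lemma inducedMetric_nonneg (hsp : IsSpacelike g i) (p : S) (X : TangentSpace (𝓡 2) p) :
    0 ≤ inducedMetric g i p X X := by
  by_cases h : X = 0
  · simp [h]
  · exact (hsp p X h).le

lemma gradNormSq_nonneg (hsp : IsSpacelike g i) (p : S) : 0 ≤ gradNormSq g i τ p :=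
  inducedMetric_nonneg hsp p _

lemma one_add_gradNormSq_pos (hsp : IsSpacelike g i) (p : S) : 0 < 1 + gradNormSq g i τ p := by
  linarith [gradNormSq_nonneg (τ := τ) hsp p]

lemma meanCurvatureNorm_pos (hH : HasSpacelikeMeanCurvature g i) (p : S) :
    0 < meanCurvatureNorm g i p :=
  Real.sqrt_pos.2 (hH p)

lemma meanCurvatureNorm_sq (hH : HasSpacelikeMeanCurvature g i) (p : S) :
    meanCurvatureNorm g i p ^ 2 = g.inner (i p) (meanCurvature g i p) (meanCurvature g i p) :=
  Real.sq_sqrt (hH p).le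

lemma IsNormal.zero {p : S} : IsNormal g i p 0 := fun X => by simp

lemma IsNormal.sum {ι : Type*} {p : S} (s : Finset ι) {v : ι → TangentSpace (𝓡 4) (i p)}
    (hv : ∀ a ∈ s, IsNormal g i p (v a)) : IsNormal g i p (∑ a ∈ s, v a) :=
  Finset.sum_induction v _ (fun _ _ h h' => h.add h') IsNormal.zero hv

lemma isNormal_meanCurvature (hi : ContMDiff (𝓡 2) (𝓡 4) ∞ i) (hsp : IsSpacelike g i) (p : S) :
    IsNormal g i p (meanCurvature g i p) := by
  unfold meanCurvature metricTrace
  exact IsNormal.sum _ fun _ _ => IsNormal.sum _ fun _ _ =>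
    (isNormal_normalPart (isSmoothMetric_inducedMetric hi hsp) _).smul _

lemma contMDiff_gradNormSq (hi : ContMDiff (𝓡 2) (𝓡 4) ∞ i) (hsp : IsSpacelike g i)
    (hτ : ContMDiff (𝓡 2) 𝓘(ℝ, ℝ) ∞ τ) :
    ContMDiff (𝓡 2) 𝓘(ℝ, ℝ) ∞ (gradNormSq g i τ) := fun p =>
  have h := smoothFieldAt_grad (isSmoothMetric_inducedMetric hi hsp) hτ p
  SmoothAlongAt.metric (isSmoothMetric_inducedMetric hi hsp) contMDiffAt_id h h

lemma ContMDiff.real_sqrt {f : S → ℝ} (hf : ContMDiff (𝓡 2) 𝓘(ℝ, ℝ) ∞ f) (h0 : ∀ p, 0 < f p) :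
    ContMDiff (𝓡 2) 𝓘(ℝ, ℝ) ∞ fun p => Real.sqrt (f p) := fun p =>
  ContDiffAt.comp_contMDiffAt (g := Real.sqrt) (Real.contDiffAt_sqrt (h0 p).ne') (hf p)

lemma ContMDiff.real_inv {f : S → ℝ} (hf : ContMDiff (𝓡 2) 𝓘(ℝ, ℝ) ∞ f) (h0 : ∀ p, 0 < f p) :
    ContMDiff (𝓡 2) 𝓘(ℝ, ℝ) ∞ fun p => (f p)⁻¹ := fun p =>
  ContDiffAt.comp_contMDiffAt (g := fun t : ℝ => t⁻¹) (contDiffAt_inv ℝ (h0 p).ne') (hf p)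

lemma ContMDiff.real_arsinh {f : S → ℝ} (hf : ContMDiff (𝓡 2) 𝓘(ℝ, ℝ) ∞ f) :
    ContMDiff (𝓡 2) 𝓘(ℝ, ℝ) ∞ fun p => Real.arsinh (f p) :=
  ContDiff.comp_contMDiff (g := Real.arsinh) Real.contDiff_arsinh hf

lemma contMDiff_lapse (hi : ContMDiff (𝓡 2) (𝓡 4) ∞ i) (hsp : IsSpacelike g i)
    (hτ : ContMDiff (𝓡 2) 𝓘(ℝ, ℝ) ∞ τ) :
    ContMDiff (𝓡 2) 𝓘(ℝ, ℝ) ∞ fun p => Real.sqrt (1 + gradNormSq g i τ p) :=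
  ContMDiff.real_sqrt (contMDiff_const.add (contMDiff_gradNormSq hi hsp hτ))
    (one_add_gradNormSq_pos hsp)

lemma contMDiff_meanCurvatureNorm (hi : ContMDiff (𝓡 2) (𝓡 4) ∞ i) (hsp : IsSpacelike g i)
    (hH : HasSpacelikeMeanCurvature g i) :
    ContMDiff (𝓡 2) 𝓘(ℝ, ℝ) ∞ (meanCurvatureNorm g i) :=
  ContMDiff.real_sqrt (fun p => SmoothAlongAt.metric g.isSmoothMetric hi.contMDiffAt
    (smoothAlongAt_meanCurvature hi hsp p) (smoothAlongAt_meanCurvature hi hsp p)) hH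

lemma isSpacelikeUnitNormal_baseNormal (hi : ContMDiff (𝓡 2) (𝓡 4) ∞ i) (hsp : IsSpacelike g i)
    (hH : HasSpacelikeMeanCurvature g i) : IsSpacelikeUnitNormal g i (baseNormal g i) where
  contMDiff p := SmoothAlongAt.neg hi.contMDiffAt (SmoothAlongAt.smul hi.contMDiffAt
    (ContMDiff.real_inv (contMDiff_meanCurvatureNorm hi hsp hH) (meanCurvatureNorm_pos hH) p)
    (smoothAlongAt_meanCurvature hi hsp p))
  normal p := ((isNormal_meanCurvature hi hsp p).smul _).neg
  unit p := by
    have h := (meanCurvatureNorm_pos hH p).ne'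
    simp only [baseNormal, map_neg, map_smul, neg_apply, FunLike.coe_smul, Pi.smul_apply,
      smul_eq_mul, ← meanCurvatureNorm_sq hH]
    field_simp

lemma meanCurvature_eq_smul_baseNormal (hH : HasSpacelikeMeanCurvature g i) (p : S) :
    meanCurvature g i p = -(meanCurvatureNorm g i p • baseNormal g i p) := by
  rw [baseNormal, smul_neg, neg_neg, smul_smul, mul_inv_cancel₀ (meanCurvatureNorm_pos hH p).ne',
    one_smul]

lemma contMDiff_gaugeAngle (hi : ContMDiff (𝓡 2) (𝓡 4) ∞ i) (hsp : IsSpacelike g i)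
    (hH : HasSpacelikeMeanCurvature g i) (hτ : ContMDiff (𝓡 2) 𝓘(ℝ, ℝ) ∞ τ) :
    ContMDiff (𝓡 2) 𝓘(ℝ, ℝ) ∞ (gaugeAngle g i τ) := by
  refine ContMDiff.real_arsinh ?_
  simp only [div_eq_mul_inv]
  exact (contMDiff_laplacian (isRiemannianMetric_inducedMetric hi hsp) hτ).neg.mul
    (ContMDiff.real_inv ((contMDiff_meanCurvatureNorm hi hsp hH).mul (contMDiff_lapse hi hsp hτ))
      fun p => mul_pos (meanCurvatureNorm_pos hH p) (Real.sqrt_pos.2 (one_add_gradNormSq_pos hsp p)))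

/-- In this form `φ` is the critical point of `W cosh t + t Δτ`, the integrand after integrating by
parts. -/
lemma mul_sinh_gaugeAngle (hsp : IsSpacelike g i) (hH : HasSpacelikeMeanCurvature g i) (p : S) :
    meanCurvatureNorm g i p * Real.sqrt (1 + gradNormSq g i τ p) * Real.sinh (gaugeAngle g i τ p) =
      -laplacian (inducedMetric g i) τ p := by
  rw [gaugeAngle, Real.sinh_arsinh]
  exact mul_div_cancel₀ _ (mul_pos (meanCurvatureNorm_pos hH p)
    (Real.sqrt_pos.2 (one_add_gradNormSq_pos hsp p))).ne'

lemma mul_cosh_gaugeAngle (hsp : IsSpacelike g i) (hH : HasSpacelikeMeanCurvature g i) (p : S) :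
    meanCurvatureNorm g i p * Real.sqrt (1 + gradNormSq g i τ p) * Real.cosh (gaugeAngle g i τ p) =
      Real.sqrt (laplacian (inducedMetric g i) τ p ^ 2
        + meanCurvatureNorm g i p ^ 2 * (1 + gradNormSq g i τ p)) := by
  have h1 := mul_sinh_gaugeAngle (τ := τ) hsp hH p
  have h2 := Real.sq_sqrt (one_add_gradNormSq_pos (τ := τ) hsp p).le
  have h3 := Real.cosh_sq (gaugeAngle g i τ p)
  rw [eq_comm, Real.sqrt_eq_iff_mul_self_eq_of_pos]
  · rw [← neg_sq, ← h1, ← h2]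
    simp only [Real.sq_sqrt (one_add_gradNormSq_pos (τ := τ) hsp p).le]
    linear_combination (meanCurvatureNorm g i p * Real.sqrt (1 + gradNormSq g i τ p)) ^ 2 * h3 +
      meanCurvatureNorm g i p ^ 2 * h2
  · exact mul_pos (mul_pos (meanCurvatureNorm_pos hH p)
      (Real.sqrt_pos.2 (one_add_gradNormSq_pos hsp p))) (Real.cosh_pos _)

/-- The field `cosh t ê₃ - sinh t ê₄`. -/
def boostedNormal (g : LorentzMetric N) (T : TimeOrientation g) (i : S → N) (t : S → ℝ) (p : S) :
    TangentSpace (𝓡 4) (i p) :=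
  Real.cosh (t p) • baseNormal g i p
    - Real.sinh (t p) • futureUnitNormal g T i (baseNormal g i) p

lemma gaugeNormal_eq (g : LorentzMetric N) (T : TimeOrientation g) (i : S → N) (τ : S → ℝ) :
    gaugeNormal g T i τ = boostedNormal g T i (gaugeAngle g i τ) := rfl

section Boost

variable {t : S → ℝ}

lemma isSpacelikeUnitNormal_boostedNormal (T : TimeOrientation g)
    (hi : ContMDiff (𝓡 2) (𝓡 4) ∞ i) (hsp : IsSpacelike g i) (hH : HasSpacelikeMeanCurvature g i)
    (ht : ContMDiff (𝓡 2) 𝓘(ℝ, ℝ) ∞ t) : IsSpacelikeUnitNormal g i (boostedNormal g T i t) :=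
  (isSpacelikeUnitNormal_baseNormal hi hsp hH).boost T hi hsp ht

lemma isFutureUnitNormal_baseNormal (T : TimeOrientation g)
    (hi : ContMDiff (𝓡 2) (𝓡 4) ∞ i) (hsp : IsSpacelike g i) (hH : HasSpacelikeMeanCurvature g i)
    (p : S) : IsFutureUnitNormal g T i p (baseNormal g i p)
      (futureUnitNormal g T i (baseNormal g i) p) :=
  have h := isSpacelikeUnitNormal_baseNormal hi hsp hH
  isFutureUnitNormal_futureUnitNormal hsp (isSmoothMetric_inducedMetric hi hsp) (h.normal p)
    (h.unit p)

lemma inner_meanCurvature (hH : HasSpacelikeMeanCurvature g i) (p : S)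
    (v : TangentSpace (𝓡 4) (i p)) : g.inner (i p) (meanCurvature g i p) v =
      -(meanCurvatureNorm g i p * g.inner (i p) (baseNormal g i p) v) := by
  rw [meanCurvature_eq_smul_baseNormal hH p, map_neg, map_smul, neg_apply, FunLike.coe_smul,
    Pi.smul_apply, smul_eq_mul]

lemma inner_meanCurvature_boostedNormal (T : TimeOrientation g)
    (hi : ContMDiff (𝓡 2) (𝓡 4) ∞ i) (hsp : IsSpacelike g i) (hH : HasSpacelikeMeanCurvature g i)
    (t : S → ℝ) (p : S) : g.inner (i p) (meanCurvature g i p) (boostedNormal g T i t p) =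
      -(meanCurvatureNorm g i p * Real.cosh (t p)) := by
  rw [inner_meanCurvature hH, boostedNormal, map_sub, map_smul, map_smul,
    (isSpacelikeUnitNormal_baseNormal hi hsp hH).unit p,
    (isFutureUnitNormal_baseNormal T hi hsp hH p).2.1]
  simp

lemma inner_meanCurvature_futureUnitNormal_boostedNormal (T : TimeOrientation g)
    (hi : ContMDiff (𝓡 2) (𝓡 4) ∞ i) (hsp : IsSpacelike g i) (hH : HasSpacelikeMeanCurvature g i)
    (ht : ContMDiff (𝓡 2) 𝓘(ℝ, ℝ) ∞ t) (p : S) :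
    g.inner (i p) (meanCurvature g i p) (futureUnitNormal g T i (boostedNormal g T i t) p) =
      meanCurvatureNorm g i p * Real.sinh (t p) := by
  have h := isSpacelikeUnitNormal_baseNormal hi hsp hH
  have h4 := futureUnitNormal_boost T hi hsp h ht p
  change futureUnitNormal g T i (boostedNormal g T i t) p = _ at h4
  rw [h4, inner_meanCurvature hH, map_sub, map_smul, map_smul, h.unit p,
    (isFutureUnitNormal_baseNormal T hi hsp hH p).2.1]
  simp

lemma generalizedMeanCurvature_boostedNormal (T : TimeOrientation g)
    (hi : ContMDiff (𝓡 2) (𝓡 4) ∞ i) (hsp : IsSpacelike g i) (hH : HasSpacelikeMeanCurvature g i)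
    (ht : ContMDiff (𝓡 2) 𝓘(ℝ, ℝ) ∞ t) (τ : S → ℝ) (p : S) :
    generalizedMeanCurvature g T i τ (boostedNormal g T i t) p =
      meanCurvatureNorm g i p * Real.sqrt (1 + gradNormSq g i τ p) * Real.cosh (t p)
        - dirDeriv t p (grad (inducedMetric g i) τ p)
        - connectionForm g T i (baseNormal g i) p (surfaceGrad g i τ p) := by
  have h := connectionForm_boost T hi hsp (isSpacelikeUnitNormal_baseNormal hi hsp hH) ht p
    (surfaceGrad g i τ p)
  change connectionForm g T i (boostedNormal g T i t) p _ = _ at h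
  rw [generalizedMeanCurvature, inner_meanCurvature_boostedNormal T hi hsp hH, h, surfaceGrad]
  ring

/-- Every admissible gauge is a smooth boost of the base frame. -/
lemma exists_boostedNormal_eq (T : TimeOrientation g)
    (hi : ContMDiff (𝓡 2) (𝓡 4) ∞ i) (hsp : IsSpacelike g i) (hH : HasSpacelikeMeanCurvature g i)
    {e₃ : ∀ p : S, TangentSpace (𝓡 4) (i p)} (he : IsSpacelikeUnitNormal g i e₃)
    (hneg : ∀ p, g.inner (i p) (meanCurvature g i p) (e₃ p) < 0) :
    ∃ t : S → ℝ, ContMDiff (𝓡 2) 𝓘(ℝ, ℝ) ∞ t ∧ e₃ = boostedNormal g T i t := by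
  have hb := isSpacelikeUnitNormal_baseNormal hi hsp hH
  -- For a boost of angle `t` the product with `ê₄` is `sinh t`, which dictates the angle; `arsinh`
  -- is smooth on all of `ℝ`.
  refine ⟨fun p => Real.arsinh
    (g.inner (i p) (e₃ p) (futureUnitNormal g T i (baseNormal g i) p)),
    ContMDiff.real_arsinh fun p => SmoothAlongAt.metric g.isSmoothMetric hi.contMDiffAt
      (he.smoothAlongAt p) (smoothAlongAt_futureUnitNormal T hi hsp hb p), funext fun p => ?_⟩
  have h4 := isFutureUnitNormal_baseNormal T hi hsp hH p
  have hex := (he.normal p).expand hsp (hb.normal p) (hb.unit p) h4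
  set A := g.inner (i p) (e₃ p) (baseNormal g i p) with hA
  set B := g.inner (i p) (e₃ p) (futureUnitNormal g T i (baseNormal g i) p) with hB
  -- The condition `⟨H, e₃⟩ < 0` selects the branch `A = √(1 + B²)` of the hyperbola `A² - B² = 1`.
  have hApos : 0 < A := by
    have h := hneg p
    rw [inner_meanCurvature hH, g.symm] at h
    exact pos_of_mul_pos_right (neg_lt_zero.1 h) (meanCurvatureNorm_pos hH p).le
  have hAB : 1 = A ^ 2 - B ^ 2 := by
    have h := congrArg (g.inner (i p) (e₃ p)) hex
    rw [map_sub, map_smul, map_smul, he.unit p, ← hA, ← hB, smul_eq_mul, smul_eq_mul] at h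
    linarith
  have hc : Real.cosh (Real.arsinh B) = A := by
    rw [Real.cosh_arsinh, show 1 + B ^ 2 = A ^ 2 by linarith, Real.sqrt_sq hApos.le]
  rw [boostedNormal, hc, Real.sinh_arsinh]
  exact hex

/-- Pointwise equality, with no integration by parts: the square root in the density is `W cosh φ`.
-/
lemma gaugeEnergyDensity_eq (T : TimeOrientation g)
    (hi : ContMDiff (𝓡 2) (𝓡 4) ∞ i) (hsp : IsSpacelike g i) (hH : HasSpacelikeMeanCurvature g i)
    (hτ : ContMDiff (𝓡 2) 𝓘(ℝ, ℝ) ∞ τ) :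
    gaugeEnergyDensity g T i τ =
      generalizedMeanCurvature g T i τ (boostedNormal g T i (gaugeAngle g i τ)) := by
  funext p
  have hσ := isSmoothMetric_inducedMetric hi hsp
  rw [generalizedMeanCurvature_boostedNormal T hi hsp hH (contMDiff_gaugeAngle hi hsp hH hτ),
    mul_cosh_gaugeAngle hsp hH, gaugeEnergyDensity, hσ.symm]
  unfold surfaceGrad
  rw [inner_grad hσ]

lemma continuous_dirDeriv_grad (hi : ContMDiff (𝓡 2) (𝓡 4) ∞ i) (hsp : IsSpacelike g i)
    (hτ : ContMDiff (𝓡 2) 𝓘(ℝ, ℝ) ∞ τ) (ht : ContMDiff (𝓡 2) 𝓘(ℝ, ℝ) ∞ t) :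
    Continuous fun p => dirDeriv t p (grad (inducedMetric g i) τ p) :=
  ContMDiff.continuous fun p => contMDiffAt_mfderiv_apply (ht p)
    (smoothFieldAt_grad (isSmoothMetric_inducedMetric hi hsp) hτ p)

lemma continuous_generalizedMeanCurvature (T : TimeOrientation g)
    (hi : ContMDiff (𝓡 2) (𝓡 4) ∞ i) (hsp : IsSpacelike g i)
    (hτ : ContMDiff (𝓡 2) 𝓘(ℝ, ℝ) ∞ τ) {e₃ : ∀ p : S, TangentSpace (𝓡 4) (i p)}
    (he : IsSpacelikeUnitNormal g i e₃) : Continuous (generalizedMeanCurvature g T i τ e₃) := by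
  have h1 : ContMDiff (𝓡 2) 𝓘(ℝ, ℝ) ∞
      fun p => g.inner (i p) (meanCurvature g i p) (e₃ p) := fun p =>
    SmoothAlongAt.metric g.isSmoothMetric hi.contMDiffAt (smoothAlongAt_meanCurvature hi hsp p)
      (he.smoothAlongAt p)
  have h2 : ContMDiff (𝓡 2) 𝓘(ℝ, ℝ) ∞
      fun p => connectionForm g T i e₃ p (surfaceGrad g i τ p) := fun p =>
    SmoothAlongAt.metric g.isSmoothMetric hi.contMDiffAt
      (SmoothAlongAt.covDerivAlong g.isSmoothMetric hi
        (Filter.Eventually.of_forall he.smoothAlongAt)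
        (smoothFieldAt_grad (isSmoothMetric_inducedMetric hi hsp) hτ p))
      (smoothAlongAt_futureUnitNormal T hi hsp he p)
  exact ((contMDiff_lapse hi hsp hτ).continuous.neg.mul h1.continuous).sub h2.continuous

end Boost

/-- The graph of `cosh` lies above its tangent lines. -/
lemma sub_mul_sinh_le_cosh_sub (x y : ℝ) : (x - y) * Real.sinh y ≤ Real.cosh x - Real.cosh y := by
  -- The bound `1 + s ≤ exp s` at `s = x - y` and `s = y - x`, weighted by `exp y` and `exp (-y)`,
  -- averages to the tangent line inequality.
  have h1 := mul_nonneg (Real.exp_pos y).le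
    (sub_nonneg.2 (Real.add_one_le_exp (x - y)))
  have h2 := mul_nonneg (Real.exp_pos (-y)).le
    (sub_nonneg.2 (Real.add_one_le_exp (-(x - y))))
  have h3 : Real.exp y * Real.exp (x - y) = Real.exp x := by rw [← Real.exp_add]; ring_nf
  have h4 : Real.exp (-y) * Real.exp (-(x - y)) = Real.exp (-x) := by rw [← Real.exp_add]; ring_nf
  rw [Real.cosh_eq, Real.cosh_eq, Real.sinh_eq]
  linarith

variable [T2Space S] [CompactSpace S] [MeasurableSpace S] [BorelSpace S]

/-- After subtracting Green's identity for `u = t - φ`, which integrates to zero, the comparison of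
integrands is pointwise: it is the tangent line inequality for `cosh` at `φ`, multiplied by `W ≥ 0`.
-/
lemma gaugeEnergy_le (T : TimeOrientation g)
    (hi : ContMDiff (𝓡 2) (𝓡 4) ∞ i) (hsp : IsSpacelike g i) (hH : HasSpacelikeMeanCurvature g i)
    (hτ : ContMDiff (𝓡 2) 𝓘(ℝ, ℝ) ∞ τ) {t : S → ℝ} (ht : ContMDiff (𝓡 2) 𝓘(ℝ, ℝ) ∞ t) :
    gaugeEnergy g T i τ ≤ ∫ p, generalizedMeanCurvature g T i τ (boostedNormal g T i t) p
      ∂volumeMeasure (inducedMetric g i) := by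
  have hσ := isRiemannianMetric_inducedMetric hi hsp
  have hφ := contMDiff_gaugeAngle hi hsp hH hτ
  set u : S → ℝ := fun p => t p + -gaugeAngle g i τ p with hu_def
  have hu : ContMDiff (𝓡 2) 𝓘(ℝ, ℝ) ∞ u := ht.add hφ.neg
  have hgreen := integral_mul_laplacian_add hσ hu hτ
  have hint : ∀ {s : S → ℝ}, ContMDiff (𝓡 2) 𝓘(ℝ, ℝ) ∞ s →
      Integrable (generalizedMeanCurvature g T i τ (boostedNormal g T i s))
        (volumeMeasure (inducedMetric g i)) := fun hs => integrable_of_continuous hσ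
    (continuous_generalizedMeanCurvature T hi hsp hτ
      (isSpacelikeUnitNormal_boostedNormal T hi hsp hH hs))
  have hintG : Integrable (fun p => u p * laplacian (inducedMetric g i) τ p +
      dirDeriv u p (grad (inducedMetric g i) τ p)) (volumeMeasure (inducedMetric g i)) :=
    integrable_of_continuous hσ ((hu.continuous.mul (contMDiff_laplacian hσ hτ).continuous).add
      (continuous_dirDeriv_grad hi hsp hτ hu))
  -- The zero subtracted here is the integral in `hgreen`, which trades `dt(∇τ)` and `dφ(∇τ)` for a
  -- multiple of `Δτ`.
  rw [gaugeEnergy, gaugeEnergyDensity_eq T hi hsp hH hτ, ← sub_zero (∫ p, _ ∂_), ← hgreen,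
    ← integral_sub (hint hφ) hintG]
  refine integral_mono ((hint hφ).sub hintG) (hint ht) fun p => ?_
  have hd : dirDeriv u p (grad (inducedMetric g i) τ p) =
      dirDeriv t p (grad (inducedMetric g i) τ p) -
        dirDeriv (gaugeAngle g i τ) p (grad (inducedMetric g i) τ p) := by
    have h := dirDeriv_add ((hu p).mdifferentiableAt (by simp)) ((hφ p).mdifferentiableAt (by simp))
      (grad (inducedMetric g i) τ p)
    simp only [hu_def, neg_add_cancel_right] at h
    rw [← eq_sub_iff_add_eq.2 h.symm]
  have hlap := mul_sinh_gaugeAngle (τ := τ) hsp hH p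
  have hpos : 0 ≤ meanCurvatureNorm g i p * Real.sqrt (1 + gradNormSq g i τ p) :=
    mul_nonneg (meanCurvatureNorm_pos hH p).le (Real.sqrt_nonneg _)
  have hc := mul_le_mul_of_nonneg_left (sub_mul_sinh_le_cosh_sub (t p) (gaugeAngle g i τ p)) hpos
  simp only [generalizedMeanCurvature_boostedNormal T hi hsp hH hφ,
    generalizedMeanCurvature_boostedNormal T hi hsp hH ht, hd]
  have hlap' : laplacian (inducedMetric g i) τ p = -(meanCurvatureNorm g i p *
    Real.sqrt (1 + gradNormSq g i τ p) * Real.sinh (gaugeAngle g i τ p)) := by rw [hlap, neg_neg]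
  rw [hlap']
  simp only [hu_def]
  linarith

end Gauge

end SpacetimeSurface

end

/-! ### The minimum over all gauges. -/

theorem mainTheorem8
    {N : Type*} [TopologicalSpace N] [T2Space N] [SecondCountableTopology N]
    [ChartedSpace (EuclideanSpace ℝ (Fin 4)) N] [IsManifold (𝓡 4) ∞ N]
    {S : Type*} [TopologicalSpace S] [T2Space S] [CompactSpace S]
    [ChartedSpace (EuclideanSpace ℝ (Fin 2)) S] [IsManifold (𝓡 2) ∞ S]
    [MeasurableSpace S] [BorelSpace S]
    (g : LorentzMetric N) (T : TimeOrientation g)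
    (i : S → N) (hi : Manifold.IsSmoothEmbedding (𝓡 2) (𝓡 4) ∞ i) (hsp : IsSpacelike g i)
    (hH : HasSpacelikeMeanCurvature g i)
    (τ : S → ℝ) (hτ : ContMDiff (𝓡 2) 𝓘(ℝ, ℝ) ∞ τ) :
    -- the functional `𝔥(Σ, i, τ)` is a convergent integral
    Integrable (gaugeEnergyDensity g T i τ) (volumeMeasure (inducedMetric g i)) ∧
    -- it bounds the integral of `h(Σ, i, τ, e₃)` from below for every admissible gauge `e₃`
    (∀ e₃ : ∀ p : S, TangentSpace (𝓡 4) (i p),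
      IsSpacelikeUnitNormal g i e₃ →
      (∀ p, g.inner (i p) (meanCurvature g i p) (e₃ p) < 0) →
      Integrable (generalizedMeanCurvature g T i τ e₃) (volumeMeasure (inducedMetric g i)) ∧
      gaugeEnergy g T i τ ≤
        ∫ p, generalizedMeanCurvature g T i τ e₃ p ∂volumeMeasure (inducedMetric g i)) ∧
    -- the gauge of angle `φ` is admissible and attains the bound
    (IsSpacelikeUnitNormal g i (gaugeNormal g T i τ) ∧
      (∀ p, g.inner (i p) (meanCurvature g i p) (gaugeNormal g T i τ p) < 0) ∧
      (∀ p, g.inner (i p) (meanCurvature g i p)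
          (futureUnitNormal g T i (gaugeNormal g T i τ) p) =
        -laplacian (inducedMetric g i) τ p / Real.sqrt (1 + gradNormSq g i τ p)) ∧
      ∫ p, generalizedMeanCurvature g T i τ (gaugeNormal g T i τ) p
          ∂volumeMeasure (inducedMetric g i) = gaugeEnergy g T i τ) := by
  have hi' : ContMDiff (𝓡 2) (𝓡 4) ∞ i := hi.contMDiff
  have hσ := isRiemannianMetric_inducedMetric hi' hsp
  have hφ := contMDiff_gaugeAngle hi' hsp hH hτ
  have hē := isSpacelikeUnitNormal_boostedNormal T hi' hsp hH hφ
  have hint : ∀ e₃ : ∀ p : S, TangentSpace (𝓡 4) (i p), IsSpacelikeUnitNormal g i e₃ →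
      Integrable (generalizedMeanCurvature g T i τ e₃) (volumeMeasure (inducedMetric g i)) :=
    fun e₃ he => integrable_of_continuous hσ
      (continuous_generalizedMeanCurvature T hi' hsp hτ he)
  refine ⟨?_, fun e₃ he hneg => ⟨hint e₃ he, ?_⟩, hē, fun p => ?_, fun p => ?_, ?_⟩
  · rw [gaugeEnergyDensity_eq T hi' hsp hH hτ]
    exact hint _ hē
  · obtain ⟨t, ht, rfl⟩ := exists_boostedNormal_eq T hi' hsp hH he hneg
    exact gaugeEnergy_le T hi' hsp hH hτ ht
  · rw [gaugeNormal_eq, inner_meanCurvature_boostedNormal T hi' hsp hH]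
    exact neg_lt_zero.2 (mul_pos (meanCurvatureNorm_pos hH p) (Real.cosh_pos _))
  · rw [gaugeNormal_eq, inner_meanCurvature_futureUnitNormal_boostedNormal T hi' hsp hH hφ,
      eq_div_iff (Real.sqrt_pos.2 (one_add_gradNormSq_pos hsp p)).ne',
      ← mul_sinh_gaugeAngle hsp hH]
    ring
  · rw [gaugeEnergy, gaugeEnergyDensity_eq T hi' hsp hH hτ, gaugeNormal_eq]
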